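/- **Model.** Let $X_0,X_1,X_2,\dots$ be iid random vectors in $\mathbb{R}^p$ and $\epsilon_0,\epsilon_1,\epsilon_2,\dots$ iid real random variables with mean $0$ and variance $\sigma^2\in(0,\infty)$, the two sequences being independent of each other. Let $m:\mathbb{R}^p\to\mathbb{R}$ be measurable and $Y_i=m(X_i)+\epsilon_i$. The data are $\mathcal D_n=\{(X_i,Y_i):1\le i\le n\}$; $X_0$ is an unseen input with response $Y_0=Y(X_0)$. **Random forest.** Let $m_{try}\in\{1,\dots,p\}$, $a_n\in\{1,\dots,n\}$ and $t_n\ge 1$. A tree is grown on $a_n$ observations drawn uniformly at random from $\mathcal D_n$, either with replacement, or without replacement with $\limsup_n a_n/n<1$. Starting from the root cell $\mathbb{R}^p$, cells are processed in breadth-first order. For each processed cell a uniformly random set of $m_{try}$ coordinates is drawn, and the cell is cut along one of them, halfway between two consecutive distinct values of that coordinate among the drawn observations in the cell, so as to maximize the CART criterion (the decrease of the within-cell empirical variance of the responses), ties being broken by an arbitrary fixed rule. A cell without such a cut is terminal, and growing stops when there are $t_n$ cells or no cell is left to process. The tree predicts at $x$ the mean response of the drawn observations (counted with multiplicity) in the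 final cell of $x$. For each $n$ the randomness of the trees is iid over the trees and independent of $(X_i,\epsilon_i)_{i\ge 0}$. Let $m_{n,M}(x)$ be the average of the predictions at $x$ of $M$ trees and $m^{OOB}_{n,M}(X_i)$, $1\le i\le n$, the average of the predictions at $X_i$ of those of the $M$ trees for which observation $i$ was not drawn ($0$ if there are none); $m_{n,\infty}(X_0)=\lim_{M\to\infty}m_{n,M}(X_0)$ and $m^{OOB}_{n,\infty}(X_i)=\lim_{M\to\infty}m^{OOB}_{n,M}(X_i)$. **Estimators.** With $\hat\epsilon_i=Y_i-m^{OOB}_{n,\infty}(X_i)$ and $\bar\epsilon=\frac1n\sum_{i=1}^n\hat\epsilon_i$ put $$\hat\sigma^2_{n,\infty}=\frac1{n-1}\sum_{i=1}^n(\hat\epsilon_i-\bar\epsilon)^2,\qquad \hat\sigma^2_{n,M}=\frac1n\sum_{i=1}^n\big(Y_i-m^{OOB}_{n,M}(X_i)\big)^2,$$ $$\hat\sigma^2_{n,MCorrect}=\Big|\hat\sigma^2_{n,M}-\frac8M\Big(\big(\max_{1\le i\le n}|m^{OOB}_{n,M}(X_i)|\big)^2+\hat\sigma^2_{n,M}(1+4\log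 n)\Big)\Big|,$$ $$\hat\sigma^2_{n,M;W}=\lambda_1\hat\sigma^2_{n,MCorrect}+(1-\lambda_1)\hat\sigma^2_{n,M},\qquad \lambda_1\in(0,1).$$ Each $\hat\sigma$ without the square is the nonnegative square root. Let $\alpha\in(0,1)$ and let $z_{1-\alpha/2}$ be the $(1-\alpha/2)$-quantile of the standard normal distribution. **Assumptions.** (A1) $\operatorname{supp}(X_1)=[0,1]^p$. (A2) $\sup_{x\in[0,1]^p}|m(x)|<\infty$. (A3) $\epsilon_1\sim N(0,\sigma^2)$. (A4) $\lim_{n\to\infty}\mathbb{E}[(m_{n,\infty}(X_0)-m(X_0))^2]=0$. **Statement.** 1. If (A1), (A3), (A4) hold and $\mathbb{E}|m(X_1)|^2<\infty$, then $C_n=[m_{n,\infty}(X_0)-z_{1-\alpha/2}\hat\sigma_{n,\infty},\;m_{n,\infty}(X_0)+z_{1-\alpha/2}\hat\sigma_{n,\infty}]$ is an asymptotically valid type-I prediction interval: $\lim_{n\to\infty}\mathbb{P}[Y_0\in C_n]$ exists and is at least $1-\alpha$. 2. If (A1)–(A4) hold, then for each of $\hat\sigma=\hat\sigma_{n,M}$,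 $\hat\sigma=\hat\sigma_{n,MCorrect}$ and (for every $\lambda_1\in(0,1)$) $\hat\sigma=\hat\sigma_{n,M;W}$, the interval $C_{n,M}=[m_{n,M}(X_0)-z_{1-\alpha/2}\hat\sigma,\;m_{n,M}(X_0)+z_{1-\alpha/2}\hat\sigma]$ is asymptotically type-I valid as $(n,M)\to\infty$ sequentially: $\lim_{M\to\infty}\mathbb{P}[Y_0\in C_{n,M}]$ exists for all large $n$, and $\lim_{n\to\infty}\lim_{M\to\infty}\mathbb{P}[Y_0\in C_{n,M}]$ exists and is at least $1-\alpha$. -/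

import Mathlib

open MeasureTheory ProbabilityTheory Filter Topology
open scoped ENNReal

noncomputable section

/-- The ways of drawing the sample of a tree in the bagging step. -/
inductive Resampling where
  | withReplacement
  | withoutReplacement

/-- A candidate cut of a regression tree grown on the sample points `0, …, a - 1` in `ℝ^p`: a
coordinate and two sample points. The cut is made along that coordinate, halfway between the two
points. -/
abbrev Split (p a : ℕ) := Fin p × Fin a × Fin a

/-- A cell of the feature space, given by the cuts that lead to it from the root. For each cut the
flag tells the side: `true` is the left side, where the coordinate is below the threshold. -/
abbrev Cell (p a : ℕ) := List (Split p a × Bool)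

/-- A rule that selects one element of each nonempty set of cuts (used to break ties). -/
abbrev TieRule (p a : ℕ) := (S : Finset (Split p a)) → S.Nonempty → {c : Split p a // c ∈ S}

namespace Cart

variable {p a : ℕ}

/-- Position of a cut. -/
def threshold (s : Fin a → (Fin p → ℝ) × ℝ) (c : Split p a) : ℝ :=
  ((s c.2.1).1 c.1 + (s c.2.2).1 c.1) / 2

/-- `x` lies in the cell `A`. -/
def InCell (s : Fin a → (Fin p → ℝ) × ℝ) (A : Cell p a) (x : Fin p → ℝ) : Prop :=
  ∀ c ∈ A, (x c.1.1 < threshold s c.1 ↔ c.2 = true)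

open Classical in
/-- The sample points in a cell. -/
def points (s : Fin a → (Fin p → ℝ) × ℝ) (A : Cell p a) : Finset (Fin a) :=
  Finset.univ.filter fun i => InCell s A (s i).1

/-- Mean response over a set of sample points (`0` for the empty set). -/
def meanResponse (s : Fin a → (Fin p → ℝ) × ℝ) (P : Finset (Fin a)) : ℝ :=
  (∑ i ∈ P, (s i).2) / (P.card : ℝ)

/-- Sum of the squared deviations of the responses from their mean. -/
def sumSq (s : Fin a → (Fin p → ℝ) × ℝ) (P : Finset (Fin a)) : ℝ :=
  ∑ i ∈ P, ((s i).2 - meanResponse s P) ^ 2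

/-- The CART criterion: the decrease of the within-cell empirical variance due to the cut `c`. -/
def criterion (s : Fin a → (Fin p → ℝ) × ℝ) (A : Cell p a) (c : Split p a) : ℝ :=
  (sumSq s (points s A) - sumSq s (points s ((c, true) :: A))
    - sumSq s (points s ((c, false) :: A))) / ((points s A).card : ℝ)

open Classical in
/-- The admissible cuts of the cell `A`: those along a coordinate in `F`, halfway between two
consecutive distinct values which that coordinate takes at the sample points in `A`. -/
def candidates (s : Fin a → (Fin p → ℝ) × ℝ) (A : Cell p a) (F : Finset (Fin p)) :
    Finset (Split p a) :=
  Finset.univ.filter fun c =>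
    c.1 ∈ F ∧ c.2.1 ∈ points s A ∧ c.2.2 ∈ points s A ∧
      (s c.2.1).1 c.1 < (s c.2.2).1 c.1 ∧
      ∀ k ∈ points s A, (s k).1 c.1 ≤ (s c.2.1).1 c.1 ∨ (s c.2.2).1 c.1 ≤ (s k).1 c.1

open Classical in
/-- The admissible cuts that maximize the CART criterion. -/
def bestSplits (s : Fin a → (Fin p → ℝ) × ℝ) (A : Cell p a) (F : Finset (Fin p)) :
    Finset (Split p a) :=
  (candidates s A F).filter fun c => ∀ d ∈ candidates s A F, criterion s A d ≤ criterion s A c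

open Classical in
/-- One step of growing a tree with at most `t` terminal nodes. The state holds the queue of cells
still to be processed and the list of cells that cannot be cut any more. The first cell of the
queue is cut by a best cut along a coordinate in `F`, and its two children join the end of the
queue; if it has no admissible cut, it becomes terminal. Nothing happens once there are `t`
cells. -/
def growStep (tie : TieRule p a) (t : ℕ) (s : Fin a → (Fin p → ℝ) × ℝ) :
    List (Cell p a) × List (Cell p a) → Finset (Fin p) → List (Cell p a) × List (Cell p a)
  | ([], done), _ => ([], done)
  | (A :: queue, done), F =>
    if t ≤ queue.length + 1 + done.length then (A :: queue, done)
    else if h : (bestSplits s A F).Nonempty then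
      (queue ++ [((tie _ h : Split p a), true) :: A, ((tie _ h : Split p a), false) :: A], done)
    else (queue, A :: done)

/-- The terminal cells of the tree grown from the root cell, where the `k`-th node to be processed
uses the coordinates `feat k`. At most `2 * t - 1` nodes are processed before the tree has `t`
terminal cells or no cell is left to be cut. -/
def leaves (tie : TieRule p a) (t : ℕ) (s : Fin a → (Fin p → ℝ) × ℝ)
    (feat : Fin (2 * t) → Finset (Fin p)) : List (Cell p a) :=
  let r := (List.ofFn feat).foldl (growStep tie t s) ([[]], [])
  r.1 ++ r.2

open Classical in
/-- Prediction of the tree at `x`: the mean response of the sample points that lie in the same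
terminal cell as `x`. -/
def predict (tie : TieRule p a) (t : ℕ) (s : Fin a → (Fin p → ℝ) × ℝ)
    (feat : Fin (2 * t) → Finset (Fin p)) (x : Fin p → ℝ) : ℝ :=
  meanResponse s (Finset.univ.filter fun i =>
    ∃ A ∈ leaves tie t s feat, InCell s A x ∧ InCell s A (s i).1)

end Cart

/-- The randomness of one tree of a forest: the `a` observations (out of `n`) drawn in the bagging
step, and the coordinates along which the successive nodes may be cut. -/
@[ext]
structure TreeSeed (p n a t : ℕ) where
  draw : Fin a → Fin n
  feat : Fin (2 * t) → Finset (Fin p)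

instance (p n a t : ℕ) : MeasurableSpace (TreeSeed p n a t) := ⊤

/-- The possible values of the randomness of a tree, on which it is uniformly distributed. -/
def treeSeeds (scheme : Resampling) (p n a t mtry : ℕ) : Set (TreeSeed p n a t) :=
  {θ | (scheme = Resampling.withoutReplacement → Function.Injective θ.draw) ∧
    ∀ k, (θ.feat k).card = mtry}

namespace RandomForest

variable {p n a t : ℕ}

/-- Prediction at `x` of the tree with randomness `θ`, grown on the points of the data set `D`
drawn in the bagging step (with their multiplicities). -/
def tree (tie : TieRule p a) (θ : TreeSeed p n a t) (D : Fin n → (Fin p → ℝ) × ℝ)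
    (x : Fin p → ℝ) : ℝ :=
  Cart.predict tie t (fun k => D (θ.draw k)) θ.feat x

/-- Prediction `m_{n,M}(x)` of the forest with the first `M` trees. -/
def finite (tie : TieRule p a) (θ : ℕ → TreeSeed p n a t) (D : Fin n → (Fin p → ℝ) × ℝ)
    (M : ℕ) (x : Fin p → ℝ) : ℝ :=
  (∑ j ∈ Finset.range M, tree tie (θ j) D x) / (M : ℝ)

/-- Prediction `m_{n,∞}(x)` of the infinite forest, the limit of `m_{n,M}(x)` for `M → ∞`. -/
def infinite (tie : TieRule p a) (θ : ℕ → TreeSeed p n a t) (D : Fin n → (Fin p → ℝ) × ℝ)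
    (x : Fin p → ℝ) : ℝ :=
  limUnder atTop fun M => finite tie θ D M x

open Classical in
/-- The trees among the first `M` that are grown without the `i`-th observation. -/
def oobTrees (θ : ℕ → TreeSeed p n a t) (M : ℕ) (i : Fin n) : Finset ℕ :=
  (Finset.range M).filter fun j => ∀ k, (θ j).draw k ≠ i

/-- Out-of-bag prediction at the `i`-th observation with `M` trees (`0` if there is no such tree
among them that is grown without the `i`-th observation). -/
def oob (tie : TieRule p a) (θ : ℕ → TreeSeed p n a t) (D : Fin n → (Fin p → ℝ) × ℝ)
    (M : ℕ) (i : Fin n) : ℝ :=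
  (∑ j ∈ oobTrees θ M i, tree tie (θ j) D (D i).1) / ((oobTrees θ M i).card : ℝ)

/-- Out-of-bag prediction with infinitely many trees. -/
def oobInfinite (tie : TieRule p a) (θ : ℕ → TreeSeed p n a t) (D : Fin n → (Fin p → ℝ) × ℝ)
    (i : Fin n) : ℝ :=
  limUnder atTop fun M => oob tie θ D M i

/-- Out-of-bag residuals for infinitely many trees. -/
def residInfinite (tie : TieRule p a) (θ : ℕ → TreeSeed p n a t)
    (D : Fin n → (Fin p → ℝ) × ℝ) (i : Fin n) : ℝ :=
  (D i).2 - oobInfinite tie θ D i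

/-- The residual variance estimator with infinitely many trees. -/
def varInfinite (tie : TieRule p a) (θ : ℕ → TreeSeed p n a t)
    (D : Fin n → (Fin p → ℝ) × ℝ) : ℝ :=
  1 / ((n : ℝ) - 1) * ∑ i, (residInfinite tie θ D i
    - 1 / (n : ℝ) * ∑ k, residInfinite tie θ D k) ^ 2

/-- The residual variance estimator with `M` trees. -/
def varFinite (tie : TieRule p a) (θ : ℕ → TreeSeed p n a t)
    (D : Fin n → (Fin p → ℝ) × ℝ) (M : ℕ) : ℝ :=
  1 / (n : ℝ) * ∑ i, ((D i).2 - oob tie θ D M i) ^ 2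

/-- The finite-`M` corrected residual variance estimator. -/
def varCorrect (tie : TieRule p a) (θ : ℕ → TreeSeed p n a t)
    (D : Fin n → (Fin p → ℝ) × ℝ) (M : ℕ) : ℝ :=
  |varFinite tie θ D M - 8 / (M : ℝ) * ((⨆ i, |oob tie θ D M i|) ^ 2
    + varFinite tie θ D M * (1 + 4 * Real.log n))|

/-- The weighted, finite-`M` corrected residual variance estimator, with weight `w` on the
corrected estimator. -/
def varWeighted (w : ℝ) (tie : TieRule p a) (θ : ℕ → TreeSeed p n a t)
    (D : Fin n → (Fin p → ℝ) × ℝ) (M : ℕ) : ℝ :=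
  w * varCorrect tie θ D M + (1 - w) * varFinite tie θ D M

end RandomForest

/-- Quantile function of the standard normal distribution. -/
def stdNormalQuantile (u : ℝ) : ℝ := sInf {x : ℝ | u ≤ cdf (gaussianReal 0 1) x}

/-- The interval `c ± z_{1-α/2} √v`. -/
def normalInterval (α c v : ℝ) : Set ℝ :=
  Set.Icc (c - stdNormalQuantile (1 - α / 2) * √v) (c + stdNormalQuantile (1 - α / 2) * √v)

section Model

variable {Ω : Type*} [MeasurableSpace Ω]

/-- The homoscedastic regression model `Y i = m (X i) + ε i`. The index `0` is the unseen point, the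
indices `1, 2, …` are the observations. -/
structure RegressionModel (μ : Measure Ω) {p : ℕ} (m : (Fin p → ℝ) → ℝ) (σ : ℝ)
    (X : ℕ → Ω → Fin p → ℝ) (ε Y : ℕ → Ω → ℝ) : Prop where
  measurable_m : Measurable m
  measurable_X : ∀ i, Measurable (X i)
  measurable_ε : ∀ i, Measurable (ε i)
  indep_X : iIndepFun X μ
  identDistrib_X : ∀ i, IdentDistrib (X i) (X 0) μ μ
  indep_ε : iIndepFun ε μ
  identDistrib_ε : ∀ i, IdentDistrib (ε i) (ε 0) μ μ
  indep_X_ε : IndepFun (fun ω i => X i ω) (fun ω i => ε i ω) μ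
  memLp_ε : MemLp (ε 0) 2 μ
  mean_ε : ∫ ω, ε 0 ω ∂μ = 0
  variance_ε : variance (ε 0) μ = σ ^ 2
  σ_pos : 0 < σ
  response : ∀ i ω, Y i ω = m (X i ω) + ε i ω

/-- The data set `((X 1, Y 1), …, (X n, Y n))`. -/
def dataSet {p : ℕ} (X : ℕ → Ω → Fin p → ℝ) (Y : ℕ → Ω → ℝ) (n : ℕ) (ω : Ω) :
    Fin n → (Fin p → ℝ) × ℝ :=
  fun i => (X (i + 1) ω, Y (i + 1) ω)

/-- For every sample size `n`, the randomness of the trees is independent, uniform on the possible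
values, and independent of the observations and of the unseen point. -/
structure ForestRandomness (μ : Measure Ω) {p : ℕ} (scheme : Resampling) (mtry : ℕ) (a t : ℕ → ℕ)
    (X : ℕ → Ω → Fin p → ℝ) (ε : ℕ → Ω → ℝ)
    (Θ : (n : ℕ) → ℕ → Ω → TreeSeed p n (a n) (t n)) : Prop where
  measurable : ∀ n j, Measurable (Θ n j)
  law : ∀ n j, μ.map (Θ n j) = uniformOn (treeSeeds scheme p n (a n) (t n) mtry)
  indep : ∀ n, iIndepFun (Θ n) μ
  indep_data : ∀ n, IndepFun (fun ω => (fun i => X i ω, fun i => ε i ω)) (fun ω j => Θ n j ω) μ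

/-- `C n` is asymptotically type-I valid at level `1 - α` for `y`, as `n → ∞`. -/
def AsympTypeI (μ : Measure Ω) (α : ℝ) (y : Ω → ℝ) (C : ℕ → Ω → Set ℝ) : Prop :=
  ∃ L : ℝ, 1 - α ≤ L ∧ Tendsto (fun n => μ.real {ω | y ω ∈ C n ω}) atTop (𝓝 L)

/-- `C n M` is asymptotically type-I valid at level `1 - α` for `y`, in the sequential limit where
first `M → ∞` and then `n → ∞`. -/
def SeqAsympTypeI (μ : Measure Ω) (α : ℝ) (y : Ω → ℝ) (C : ℕ → ℕ → Ω → Set ℝ) : Prop :=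
  ∃ (ℓ : ℕ → ℝ) (L : ℝ), 1 - α ≤ L ∧
    (∀ᶠ n in atTop, Tendsto (fun M => μ.real {ω | y ω ∈ C n M ω}) atTop (𝓝 (ℓ n))) ∧
    Tendsto ℓ atTop (𝓝 L)

end Model

end

noncomputable section

/-! ### Measurability and boundedness of tree predictions -/

/-! For fixed data a tree has finitely many possible seeds, so by the strong law a forest with
infinitely many trees is the exact average over seeds. It is therefore a sum over draws `d` from `1,
…, n` of `drawWeight` times `meanTree`. The out-of-bag prediction at `i` is the same sum over the
draws that avoid `i`, divided by the probability `q = missProb` that a draw avoids `i`. With `δ` the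
error of the forest at the unseen point and `v` the variance estimator, the interval contains `Y 0`
iff `|ε 0 - δ| ≤ z √v`. Consistency gives `δ → 0` in mean square. The residuals are the errors `ε i`
minus the out-of-bag errors, and the errors obey the strong law. So `v → σ ^ 2` in probability, and
hence coverage tending to `1 - α`, follows once the average squared out-of-bag error tends to `0` in
mean.

This is the core: mean square consistency of the full forest has to pass to the leave-one-out
forests, without any stability of the trees. By exchangeability the unseen point may take the place
of observation `i`. For symmetric statistics `H T`, `H T'` of an infinite exchangeable sequence with
`T`, `T'` of equal size, the mean of `H T * H T'` is nonnegative
(`IsContractable.integral_mul_nonneg`): otherwise the sum of many copies with the same pairwise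
overlaps would have a negative second moment. Hence a sum over a subfamily of index sets has a
smaller second moment than the full sum. Grouping draws by the `K`-sets that contain them, and
keeping only the sets without `i`, bounds a reweighted leave-one-out sum by the full one
(`IsContractable.integral_sq_leaveOneOut_le`). A draw with `k` distinct values gets the weight `n /
(n - k)` in place of `1 / q`. The fraction `(n - k) / n` has mean `q` and variance at most `1 / n`,
so the discrepancy costs a constant times the second moment of a bound for the tree errors, divided
by `n` (`IsContractable.sum_integral_sq_outOfBag_le`). That cost vanishes because the responses are
square integrable.

For finite forests `n` is fixed while `M → ∞`. Predictions and all three estimators converge almost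
surely, the latter to the common limit `varMean`, and the boundary event of the limiting interval is
null because `ε 0` has no atoms and is independent of everything else in it. The second limit, in
`n`, is again the coverage for infinitely many trees. -/

theorem abs_sum_div_card_le {ι : Type*} (s : Finset ι) {f : ι → ℝ} {B : ℝ} (hB : 0 ≤ B)
    (h : ∀ i, |f i| ≤ B) : |(∑ i ∈ s, f i) / (s.card : ℝ)| ≤ B := by
  rw [abs_div, Nat.abs_cast]
  refine div_le_of_le_mul₀ (by positivity) hB ?_
  calc |∑ i ∈ s, f i| ≤ ∑ i ∈ s, |f i| := Finset.abs_sum_le_sum_abs _ _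
    _ ≤ ∑ _i ∈ s, B := Finset.sum_le_sum fun i _ => h i
    _ = B * s.card := by simp [mul_comm]

namespace Cart

variable {p a : ℕ}

theorem measurableSet_forall_of_countable {α ι : Type*} [MeasurableSpace α] [Countable ι]
    {P : ι → α → Prop} (h : ∀ i, MeasurableSet {s | P i s}) : MeasurableSet {s | ∀ i, P i s} := by
  have : {s | ∀ i, P i s} = ⋂ i, {s | P i s} := by
    ext s
    simp
  rw [this]
  exact MeasurableSet.iInter h

theorem measurable_threshold (c : Split p a) :
    Measurable fun s : Fin a → (Fin p → ℝ) × ℝ => threshold s c := by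
  unfold threshold
  fun_prop

theorem measurableSet_inCell (A : Cell p a) :
    MeasurableSet {q : (Fin a → (Fin p → ℝ) × ℝ) × (Fin p → ℝ) | InCell q.1 A q.2} := by
  have : {q : (Fin a → (Fin p → ℝ) × ℝ) × (Fin p → ℝ) | InCell q.1 A q.2} =
      ⋂ c ∈ {c | c ∈ A}, {q | (q.2 c.1.1 < threshold q.1 c.1 ↔ c.2 = true)} := by
    ext q
    simp [InCell]
  rw [this]
  refine MeasurableSet.biInter (Set.to_countable _) fun c _ => ?_
  refine MeasurableSet.iff (measurableSet_lt ?_ ?_) (MeasurableSet.const _)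
  · fun_prop
  · exact (measurable_threshold c.1).comp measurable_fst

theorem measurableSet_inCell_sample (A : Cell p a) (i : Fin a) :
    MeasurableSet {s : Fin a → (Fin p → ℝ) × ℝ | InCell s A (s i).1} := by
  have h : Measurable fun s : Fin a → (Fin p → ℝ) × ℝ => (s, (s i).1) := by fun_prop
  exact h (measurableSet_inCell A)

theorem measurableSet_finset_eq {α β : Type*} [MeasurableSpace α] [Finite β] {B : α → Finset β}
    (h : ∀ c, MeasurableSet {s | c ∈ B s}) (b : Finset β) : MeasurableSet {s | B s = b} := by
  have : {s | B s = b} = ⋂ c, {s | c ∈ B s ↔ c ∈ b} := by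
    ext s
    simp [Finset.ext_iff]
  rw [this]
  exact MeasurableSet.iInter fun c => (h c).iff (MeasurableSet.const _)

theorem measurable_meanResponse (P : Finset (Fin a)) :
    Measurable fun s : Fin a → (Fin p → ℝ) × ℝ => meanResponse s P := by
  unfold meanResponse
  fun_prop

theorem measurable_sumSq (P : Finset (Fin a)) :
    Measurable fun s : Fin a → (Fin p → ℝ) × ℝ => sumSq s P := by
  unfold sumSq
  have := measurable_meanResponse (p := p) P
  fun_prop

/-- Point sets, cuts and lists of cells take countably many values. A quantity built on such a value
is measurable as soon as it is measurable for each fixed value and the fibers are measurable. -/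
theorem measurable_comp_of_fibers {α β γ : Type*} [MeasurableSpace α] [MeasurableSpace γ]
    [Countable β] {B : α → β} (hB : ∀ b, MeasurableSet {s | B s = b}) {g : β → α → γ}
    (hg : ∀ b, Measurable (g b)) : Measurable fun s => g (B s) s := by
  let _ : MeasurableSpace β := ⊤
  have h1 : Measurable B := measurable_to_countable' hB
  have h2 : Measurable fun x : β × α => g x.1 x.2 := measurable_from_prod_countable_right hg
  exact h2.comp (h1.prodMk measurable_id)

theorem measurableSet_points_eq (A : Cell p a) (P : Finset (Fin a)) :
    MeasurableSet {s : Fin a → (Fin p → ℝ) × ℝ | points s A = P} := by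
  refine measurableSet_finset_eq (fun i => ?_) P
  simpa [points] using measurableSet_inCell_sample A i

theorem measurable_criterion (A : Cell p a) (c : Split p a) :
    Measurable fun s : Fin a → (Fin p → ℝ) × ℝ => criterion s A c := by
  have h : ∀ A : Cell p a, Measurable fun s : Fin a → (Fin p → ℝ) × ℝ => sumSq s (points s A) :=
    fun A => measurable_comp_of_fibers (measurableSet_points_eq A) measurable_sumSq
  have h' : Measurable fun s : Fin a → (Fin p → ℝ) × ℝ => ((points s A).card : ℝ) :=
    measurable_comp_of_fibers (g := fun P _ => ((P : Finset (Fin a)).card : ℝ))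
      (measurableSet_points_eq A) fun _ => measurable_const
  exact (((h A).sub (h _)).sub (h _)).div h'

theorem measurableSet_mem_candidates (A : Cell p a) (F : Finset (Fin p)) (c : Split p a) :
    MeasurableSet {s : Fin a → (Fin p → ℝ) × ℝ | c ∈ candidates s A F} := by
  have hm : ∀ i, MeasurableSet {s : Fin a → (Fin p → ℝ) × ℝ | i ∈ points s A} := fun i => by
    simpa [points] using measurableSet_inCell_sample A i
  have hc : ∀ i : Fin a, Measurable fun s : Fin a → (Fin p → ℝ) × ℝ => (s i).1 c.1 :=
    fun i => by fun_prop
  simp only [candidates, Finset.mem_filter, Finset.mem_univ, true_and]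
  refine (MeasurableSet.const _).inter ((hm _).inter ((hm _).inter
    ((measurableSet_lt (hc _) (hc _)).inter (measurableSet_forall_of_countable fun k => (hm k).imp ?_))))
  exact (measurableSet_le (hc _) (hc _)).union (measurableSet_le (hc _) (hc _))

theorem measurableSet_bestSplits_eq (A : Cell p a) (F : Finset (Fin p)) (b : Finset (Split p a)) :
    MeasurableSet {s : Fin a → (Fin p → ℝ) × ℝ | bestSplits s A F = b} := by
  refine measurableSet_finset_eq (fun c => ?_) b
  simp only [bestSplits, Finset.mem_filter]
  exact (measurableSet_mem_candidates A F c).inter (measurableSet_forall_of_countable fun d =>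
    (measurableSet_mem_candidates A F d).imp
      (measurableSet_le (measurable_criterion A d) (measurable_criterion A c)))

/-- The sample enters a step only through the finite set `bestSplits`. The tie rule acts on that set
alone, so an arbitrary rule causes no measurability problem. -/
theorem measurableSet_growStep_eq (tie : TieRule p a) (t : ℕ)
    (st : List (Cell p a) × List (Cell p a)) (F : Finset (Fin p))
    (st' : List (Cell p a) × List (Cell p a)) :
    MeasurableSet {s : Fin a → (Fin p → ℝ) × ℝ | growStep tie t s st F = st'} := by
  classical
  obtain ⟨_ | ⟨A, queue⟩, done⟩ := st
  · simp [growStep]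
  · by_cases ht : t ≤ queue.length + 1 + done.length
    · simp [growStep, ht]
    · have : {s : Fin a → (Fin p → ℝ) × ℝ | growStep tie t s (A :: queue, done) F = st'} =
          ⋃ b ∈ {b : Finset (Split p a) | (if h : b.Nonempty then
            (queue ++ [((tie _ h : Split p a), true) :: A, ((tie _ h : Split p a), false) :: A],
              done) else (queue, A :: done)) = st'}, {s | bestSplits s A F = b} := by
        ext s
        simp [growStep, ht]
      rw [this]
      exact MeasurableSet.biUnion (Set.to_countable _) fun b _ => measurableSet_bestSplits_eq A F b

theorem measurableSet_foldl_growStep_eq (tie : TieRule p a) (t : ℕ) (Fs : List (Finset (Fin p)))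
    (st st' : List (Cell p a) × List (Cell p a)) :
    MeasurableSet {s : Fin a → (Fin p → ℝ) × ℝ | Fs.foldl (growStep tie t s) st = st'} := by
  induction Fs generalizing st with
  | nil => simp
  | cons F Fs ih =>
    have : {s : Fin a → (Fin p → ℝ) × ℝ | (F :: Fs).foldl (growStep tie t s) st = st'} =
        ⋃ st₁, {s | growStep tie t s st F = st₁} ∩ {s | Fs.foldl (growStep tie t s) st₁ = st'} := by
      ext s
      simp
    rw [this]
    exact MeasurableSet.iUnion fun st₁ => (measurableSet_growStep_eq tie t st F st₁).inter (ih st₁)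

theorem measurableSet_leaves_eq (tie : TieRule p a) (t : ℕ) (feat : Fin (2 * t) → Finset (Fin p))
    (L : List (Cell p a)) :
    MeasurableSet {s : Fin a → (Fin p → ℝ) × ℝ | leaves tie t s feat = L} := by
  have : {s : Fin a → (Fin p → ℝ) × ℝ | leaves tie t s feat = L} =
      ⋃ st ∈ {st : List (Cell p a) × List (Cell p a) | st.1 ++ st.2 = L},
        {s | (List.ofFn feat).foldl (growStep tie t s) ([[]], []) = st} := by
    ext s
    simp only [leaves, Set.mem_ofPred_eq, Set.mem_iUnion, exists_prop]
    constructor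
    · exact fun h => ⟨_, h, rfl⟩
    · rintro ⟨st, h, rfl⟩
      exact h
  rw [this]
  exact MeasurableSet.biUnion (Set.to_countable _) fun st _ =>
    measurableSet_foldl_growStep_eq tie t _ _ st

theorem measurable_predict (tie : TieRule p a) (t : ℕ) (feat : Fin (2 * t) → Finset (Fin p)) :
    Measurable fun q : (Fin a → (Fin p → ℝ) × ℝ) × (Fin p → ℝ) =>
      predict tie t q.1 feat q.2 := by
  classical
  refine measurable_comp_of_fibers (B := fun q : (Fin a → (Fin p → ℝ) × ℝ) × (Fin p → ℝ) =>
    Finset.univ.filter fun i => ∃ A ∈ leaves tie t q.1 feat, InCell q.1 A q.2 ∧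
      InCell q.1 A (q.1 i).1) (g := fun P q => meanResponse q.1 P) ?_ ?_
  · refine fun P => measurableSet_finset_eq (fun i => ?_) P
    simp only [Finset.mem_filter, Finset.mem_univ, true_and]
    have : {q : (Fin a → (Fin p → ℝ) × ℝ) × (Fin p → ℝ) | ∃ A ∈ leaves tie t q.1 feat,
        InCell q.1 A q.2 ∧ InCell q.1 A (q.1 i).1} =
        ⋃ L, ⋃ A ∈ {A | A ∈ L}, {q | leaves tie t q.1 feat = L} ∩
          ({q | InCell q.1 A q.2} ∩ {q | InCell q.1 A (q.1 i).1}) := by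
      ext q
      simp only [Set.mem_ofPred_eq, Set.mem_iUnion, Set.mem_inter_iff, exists_prop]
      constructor
      · rintro ⟨A, hA, h⟩
        exact ⟨_, A, hA, rfl, h⟩
      · rintro ⟨L, A, hA, rfl, h⟩
        exact ⟨A, hA, h⟩
    rw [this]
    exact MeasurableSet.iUnion fun L => MeasurableSet.biUnion (Set.to_countable _) fun A _ =>
      (measurable_fst (measurableSet_leaves_eq tie t feat L)).inter
        ((measurableSet_inCell A).inter (measurable_fst (measurableSet_inCell_sample A i)))
  · exact fun P => (measurable_meanResponse P).comp measurable_fst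

theorem abs_predict_le (tie : TieRule p a) (t : ℕ) {s : Fin a → (Fin p → ℝ) × ℝ}
    (feat : Fin (2 * t) → Finset (Fin p)) (x : Fin p → ℝ) {B : ℝ} (hB : 0 ≤ B)
    (h : ∀ k, |(s k).2| ≤ B) : |predict tie t s feat x| ≤ B :=
  abs_sum_div_card_le _ hB h

end Cart

/-! ### Leave-one-out comparison of symmetric statistics of exchangeable sequences -/

section LeaveOneOut

variable {E : Type*} [MeasurableSpace E]

/-- The law `ν` of a random sequence is invariant under injective reindexing. -/
def IsContractable (ν : Measure (ℕ → E)) : Prop :=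
  ∀ ρ : ℕ → ℕ, Function.Injective ρ → MeasurePreserving (fun z i => z (ρ i)) ν ν

/-- `H T` is a statistic of the coordinates `0` and `T`, symmetric in the latter. -/
def IsSymmStatistic {E : Type*} (H : Finset ℕ → (ℕ → E) → ℝ) : Prop :=
  ∀ ρ : ℕ → ℕ, Function.Injective ρ → ρ 0 = 0 → ∀ T z,
    H T (fun i => z (ρ i)) = H (T.image ρ) z

/-- A mixed moment depends only on how `T`, `T'` and the distinguished index `0` overlap. -/
theorem IsContractable.integral_mul_image {ν : Measure (ℕ → E)} (hν : IsContractable ν)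
    {H : Finset ℕ → (ℕ → E) → ℝ} (hH : IsSymmStatistic H) (hL : ∀ T, MemLp (H T) 2 ν)
    {ρ : ℕ → ℕ} (hρ : Function.Injective ρ) (h0 : ρ 0 = 0) (T T' : Finset ℕ) :
    ∫ z, H (T.image ρ) z * H (T'.image ρ) z ∂ν = ∫ z, H T z * H T' z ∂ν := by
  have hmp := hν ρ hρ
  have hs : AEStronglyMeasurable (fun z => H T z * H T' z)
      (ν.map (fun z i => z (ρ i))) := by
    rw [hmp.map_eq]
    exact (hL T).1.mul (hL T').1
  have := integral_map hmp.measurable.aemeasurable hs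
  rw [hmp.map_eq] at this
  rw [this]
  simp only [hH ρ hρ h0]

theorem sq_sum_integral {Ω : Type*} [MeasurableSpace Ω] {ν : Measure Ω} {ι : Type*}
    (s : Finset ι) {f : ι → Ω → ℝ} (hf : ∀ i, MemLp (f i) 2 ν) :
    ∫ z, (∑ i ∈ s, f i z) ^ 2 ∂ν = ∑ i ∈ s, ∑ j ∈ s, ∫ z, f i z * f j z ∂ν := by
  have hi : ∀ i j, Integrable (fun z => f i z * f j z) ν := fun i j => (hf i).integrable_mul (hf j)
  simp only [sq, Finset.sum_mul_sum]
  rw [integral_finsetSum _ fun i _ => integrable_finsetSum _ fun j _ => hi i j]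
  exact Finset.sum_congr rfl fun i _ => integral_finsetSum _ fun j _ => hi i j

/-- Infinitely many index sets can be placed so that every two of them overlap like `T` and `T'`.
The corresponding variables have a common second moment `γ₀` and common mixed moment `γ`. Since the
square of a sum of `J` of them has nonnegative mean for every `J`, `γ < 0` is impossible. -/
theorem IsContractable.integral_mul_nonneg {ν : Measure (ℕ → E)} (hν : IsContractable ν)
    {H : Finset ℕ → (ℕ → E) → ℝ} (hH : IsSymmStatistic H) (hL : ∀ T, MemLp (H T) 2 ν)
    {T T' : Finset ℕ} (h0 : 0 ∉ T) (h0' : 0 ∉ T') (hcard : T.card = T'.card) :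
    0 ≤ ∫ z, H T z * H T' z ∂ν := by
  classical
  have hc : (T' \ T).card = (T \ T').card := by
    have h1 := Finset.card_sdiff_add_card_inter T T'
    have h2 := Finset.card_sdiff_add_card_inter T' T
    rw [Finset.inter_comm] at h2
    omega
  obtain ⟨b, hb⟩ : ∃ b : ℕ → ℕ, Set.BijOn b (T' \ T : Finset ℕ) (T \ T' : Finset ℕ) := by
    let e := Finset.equivOfCardEq hc
    refine ⟨fun x => if h : x ∈ T' \ T then (e ⟨x, h⟩ : ℕ) else 0, fun x hx => ?_, ?_, ?_⟩
    · have hx' : x ∈ T' \ T := hx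
      simp only [hx', dif_pos]
      exact (e ⟨x, hx'⟩).2
    · intro x hx y hy hxy
      have hx' : x ∈ T' \ T := hx
      have hy' : y ∈ T' \ T := hy
      simp only [hx', hy', dif_pos] at hxy
      simpa using e.injective (Subtype.ext hxy)
    · intro y hy
      have hy' : y ∈ T \ T' := hy
      refine ⟨(e.symm ⟨y, hy'⟩ : ℕ), (e.symm ⟨y, hy'⟩).2, ?_⟩
      have := (e.symm ⟨y, hy'⟩).2
      simp only [this, dif_pos]
      simp
  -- `r j` keeps `T ∩ T'` in layer `0` and sends `T \ T'` to the fresh layer `j + 1`, so the images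
  -- of `T` for different `j` share exactly the image of `T ∩ T'`. The index `0` is fixed because
  -- `Nat.pair 0 0 = 0` and `0 ∉ T`.
  let r : ℕ → ℕ → ℕ := fun j x => Nat.pair x (if x ∈ T \ T' then j + 1 else 0)
  have hr : ∀ j, Function.Injective (r j) := fun j x y h => (Nat.pair_eq_pair.1 h).1
  have hr0 : ∀ j, r j 0 = 0 := fun j => by simp [r, h0, Nat.pair]
  have hdiag : ∀ j, ∫ z, H (T.image (r j)) z * H (T.image (r j)) z ∂ν = ∫ z, H T z * H T z ∂ν :=
    fun j => hν.integral_mul_image hH hL (hr j) (hr0 j) T T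
  have hoff : ∀ j l, j ≠ l →
      ∫ z, H (T.image (r j)) z * H (T.image (r l)) z ∂ν = ∫ z, H T z * H T' z ∂ν := by
    intro j l hjl
    -- A single reindexing that sends `T` to its `j`-th copy and `T'` to the `l`-th copy of `T`. The
    -- bijection `b` identifies `T' \ T` with `T \ T'`.
    let g : ℕ → ℕ := fun x => if x ∈ T' \ T then Nat.pair (b x) (l + 1) else r j x
    have hg : Function.Injective g := by
      intro x y h
      simp only [g, r] at h
      split_ifs at h with h1 h2 h3 h4 h5 h6 <;> rw [Nat.pair_eq_pair] at h
      · exact hb.injOn h1 h2 h.1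
      all_goals first | exact h.1 | omega
    have hg0 : g 0 = 0 := by simp [g, h0', hr0]
    have hT : T.image g = T.image (r j) := by
      refine Finset.image_congr fun x hx => ?_
      have : x ∈ T := hx
      simp [g, this]
    have hT' : T'.image g = T.image (r l) := by
      ext y
      simp only [Finset.mem_image]
      constructor
      · rintro ⟨x, hx, rfl⟩
        by_cases hxT : x ∈ T
        · exact ⟨x, hxT, by simp [g, r, hxT, hx]⟩
        · have hx' : x ∈ T' \ T := by simp [hx, hxT]
          have hbx : b x ∈ T \ T' := hb.mapsTo hx'
          refine ⟨b x, (Finset.mem_sdiff.1 hbx).1, ?_⟩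
          simp only [g, r, if_pos hx', if_pos hbx]
      · rintro ⟨x, hx, rfl⟩
        by_cases hxT : x ∈ T'
        · exact ⟨x, hxT, by simp [g, r, hxT, hx]⟩
        · have hx' : x ∈ T \ T' := by simp [hx, hxT]
          obtain ⟨w, hw, rfl⟩ := hb.surjOn hx'
          have hw' : w ∈ T' \ T := hw
          refine ⟨w, (Finset.mem_sdiff.1 hw').1, ?_⟩
          simp only [g, r, if_pos hx', if_pos hw']
    rw [← hT, ← hT']
    exact hν.integral_mul_image hH hL hg hg0 T T'
  set γ₀ := ∫ z, H T z * H T z ∂ν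
  set γ := ∫ z, H T z * H T' z ∂ν
  -- The second moment of the sum of `J` copies has `J` diagonal terms `γ₀` and `J * (J - 1)` mixed
  -- terms `γ`.
  have hJ : ∀ J : ℕ, 0 ≤ (J : ℝ) * (γ₀ + ((J : ℝ) - 1) * γ) := by
    intro J
    have h1 : 0 ≤ ∫ z, (∑ j ∈ Finset.range J, H (T.image (r j)) z) ^ 2 ∂ν :=
      integral_nonneg fun z => sq_nonneg _
    rw [sq_sum_integral (f := fun j => H (T.image (r j))) _ fun j => hL _] at h1
    have h2 : ∀ j ∈ Finset.range J, ∑ l ∈ Finset.range J,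
        ∫ z, H (T.image (r j)) z * H (T.image (r l)) z ∂ν = γ₀ + ((J : ℝ) - 1) * γ := by
      intro j hj
      rw [← Finset.add_sum_erase _ _ hj, hdiag]
      rw [Finset.sum_congr rfl fun l hl => hoff j l (Finset.ne_of_mem_erase hl).symm]
      have : 1 ≤ J := by have := Finset.mem_range.1 hj; omega
      simp [Finset.card_erase_of_mem hj, Nat.cast_sub this]
    rw [Finset.sum_congr rfl h2] at h1
    simpa [mul_add] using h1
  by_contra hneg
  push Not at hneg
  obtain ⟨J, hJ'⟩ := exists_nat_gt (γ₀ / (-γ))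
  have h1 : γ₀ < J * (-γ) := by rwa [div_lt_iff₀ (by linarith)] at hJ'
  have h2 := hJ (J + 1)
  have h3 : 0 ≤ γ₀ + (((J + 1 : ℕ) : ℝ) - 1) * γ := nonneg_of_mul_nonneg_right h2 (by positivity)
  push_cast at h3
  linarith

/-- After expanding the squares, the larger family only adds mixed moments, all of them nonnegative.
-/
theorem IsContractable.integral_sq_sum_mono {ν : Measure (ℕ → E)} (hν : IsContractable ν)
    {H : Finset ℕ → (ℕ → E) → ℝ} (hH : IsSymmStatistic H) (hL : ∀ T, MemLp (H T) 2 ν)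
    {K : ℕ} {𝒮 𝒯 : Finset (Finset ℕ)} (hsub : 𝒮 ⊆ 𝒯) (hK : ∀ T ∈ 𝒯, T.card = K)
    (h0 : ∀ T ∈ 𝒯, 0 ∉ T) :
    ∫ z, (∑ T ∈ 𝒮, H T z) ^ 2 ∂ν ≤ ∫ z, (∑ T ∈ 𝒯, H T z) ^ 2 ∂ν := by
  have hpos : ∀ T ∈ 𝒯, ∀ T' ∈ 𝒯, 0 ≤ ∫ z, H T z * H T' z ∂ν := fun T hT T' hT' =>
    hν.integral_mul_nonneg hH hL (h0 T hT) (h0 T' hT') ((hK T hT).trans (hK T' hT').symm)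
  rw [sq_sum_integral _ hL, sq_sum_integral _ hL]
  calc _ ≤ ∑ i ∈ 𝒮, ∑ j ∈ 𝒯, ∫ z, H i z * H j z ∂ν :=
        Finset.sum_le_sum fun i hi => Finset.sum_le_sum_of_subset_of_nonneg hsub
          fun j hj _ => hpos i (hsub hi) j hj
    _ ≤ _ := Finset.sum_le_sum_of_subset_of_nonneg hsub
          fun i hi _ => Finset.sum_nonneg fun j hj => hpos i hi j hj

/-! ### Sums over draws, regrouped by index sets of fixed size -/

variable {a : ℕ}

/-- The number of distinct values of a map. -/
def distinctCount (d : Fin a → ℕ) : ℕ := (Finset.univ.image d).card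

theorem distinctCount_comp {ρ : ℕ → ℕ} (hρ : Function.Injective ρ) (d : Fin a → ℕ) :
    distinctCount (fun k => ρ (d k)) = distinctCount d := by
  rw [distinctCount, distinctCount, ← Finset.card_image_of_injective (Finset.univ.image d) hρ,
    Finset.image_image]
  rfl

/-- The weight sees a draw only through its number of distinct values, which injective relabelling
preserves. -/
theorem isSymmStatistic_sum_piFinset {E : Type*} (b : ℕ → ℝ) (Φ : (Fin a → E) → E → ℝ) :
    IsSymmStatistic fun (T : Finset ℕ) (z : ℕ → E) =>
      ∑ d ∈ Fintype.piFinset fun _ : Fin a => T, b (distinctCount d) * Φ (fun k => z (d k)) (z 0) := by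
  intro ρ hρ h0 T z
  simp only [h0]
  refine Finset.sum_nbij (fun d k => ρ (d k)) ?_ ?_ ?_ ?_
  · intro d hd
    simp only [Fintype.mem_piFinset] at hd ⊢
    exact fun k => Finset.mem_image_of_mem _ (hd k)
  · intro d _ d' _ h
    funext k
    exact hρ (congrFun h k)
  · intro d hd
    have hd' : ∀ k, ∃ x ∈ T, ρ x = d k := fun k => by
      simpa using (Fintype.mem_piFinset.1 hd) k
    choose e he hed using hd'
    exact ⟨e, Finset.mem_coe.2 (Fintype.mem_piFinset.2 he), funext hed⟩
  · intro d _
    rw [distinctCount_comp hρ]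

theorem card_filter_superset_powersetCard {A S : Finset ℕ} (hS : S ⊆ A) {K : ℕ}
    (hK : S.card ≤ K) : ((A.powersetCard K).filter fun T => S ⊆ T).card =
      (A.card - S.card).choose (K - S.card) := by
  rw [← Finset.card_sdiff_of_subset hS, ← Finset.card_powersetCard]
  refine Finset.card_bij' (fun T _ => T \ S) (fun T _ => T ∪ S) ?_ ?_ ?_ ?_
  · intro T hT
    simp only [Finset.mem_filter, Finset.mem_powersetCard] at hT ⊢
    exact ⟨Finset.sdiff_subset_sdiff hT.1.1 le_rfl, by
      rw [Finset.card_sdiff_of_subset hT.2, hT.1.2]⟩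
  · intro T hT
    simp only [Finset.mem_filter, Finset.mem_powersetCard] at hT ⊢
    have hd : Disjoint T S := Finset.disjoint_of_subset_left hT.1 Finset.sdiff_disjoint
    refine ⟨⟨Finset.union_subset (hT.1.trans Finset.sdiff_subset) hS, ?_⟩,
      Finset.subset_union_right⟩
    rw [Finset.card_union_of_disjoint hd, hT.2]
    omega
  · intro T hT
    simp only [Finset.mem_filter] at hT
    exact Finset.sdiff_union_of_subset hT.2
  · intro T hT
    simp only [Finset.mem_powersetCard] at hT
    have hd : Disjoint T S := Finset.disjoint_of_subset_left hT.1 Finset.sdiff_disjoint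
    rw [Finset.union_sdiff_right, hd.sdiff_eq_left]

/-- Double counting: a draw with `k` distinct values lies in exactly those `K`-subsets of `A` that
contain its range. -/
theorem sum_powersetCard_sum_piFinset (A : Finset ℕ) (K : ℕ) (g : (Fin a → ℕ) → ℝ) :
    ∑ T ∈ A.powersetCard K, ∑ d ∈ Fintype.piFinset fun _ : Fin a => T, g d =
      ∑ d ∈ (Fintype.piFinset fun _ : Fin a => A).filter fun d => distinctCount d ≤ K,
        ((A.card - distinctCount d).choose (K - distinctCount d) : ℝ) * g d := by
  have himg : ∀ (d : Fin a → ℕ) (T : Finset ℕ),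
      d ∈ (Fintype.piFinset fun _ : Fin a => T) ↔ Finset.univ.image d ⊆ T := fun d T => by
    simp [Fintype.mem_piFinset, Finset.image_subset_iff]
  rw [Finset.sum_comm' (t' := (Fintype.piFinset fun _ : Fin a => A).filter
    fun d => distinctCount d ≤ K) (s' := fun d => (A.powersetCard K).filter
    fun T => Finset.univ.image d ⊆ T)]
  · refine Finset.sum_congr rfl fun d hd => ?_
    rw [Finset.mem_filter, himg] at hd
    rw [Finset.sum_const, card_filter_superset_powersetCard hd.1 hd.2, nsmul_eq_mul]
    rfl
  · intro T d
    simp only [Finset.mem_filter, himg, Finset.mem_powersetCard]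
    constructor
    · rintro ⟨⟨h1, h2⟩, h3⟩
      exact ⟨⟨⟨h1, h2⟩, h3⟩, h3.trans h1, h2 ▸ Finset.card_le_card h3⟩
    · rintro ⟨⟨⟨h1, h2⟩, h3⟩, -, -⟩
      exact ⟨⟨h1, h2⟩, h3⟩

/-- Both sides are sums of one symmetric statistic over `K`-sets: over those in `A.erase i` on the
left, over all those in `A` on the right. Regrouped by draws, removing `i` multiplies the weight of
a draw with `k` distinct values by `(n - K) / (n - k)`, where `n = A.card`. This is the prefactor
times `n / (n - k)`. -/
theorem IsContractable.integral_sq_leaveOneOut_le {ν : Measure (ℕ → E)} (hν : IsContractable ν)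
    {Φ : (Fin a → E) → E → ℝ}
    (hL : ∀ d : Fin a → ℕ, MemLp (fun z : ℕ → E => Φ (fun k => z (d k)) (z 0)) 2 ν)
    (u : ℕ → ℝ) {A : Finset ℕ} (h0 : 0 ∉ A) {i : ℕ} (hi : i ∈ A) {K : ℕ} (hK : K < A.card) :
    (((A.card : ℝ) - K) / A.card) ^ 2 *
      ∫ z, (∑ d ∈ (Fintype.piFinset fun _ : Fin a => A.erase i).filter
        fun d => distinctCount d ≤ K, u (distinctCount d) *
          ((A.card : ℝ) / (A.card - distinctCount d)) * Φ (fun k => z (d k)) (z 0)) ^ 2 ∂ν ≤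
      ∫ z, (∑ d ∈ (Fintype.piFinset fun _ : Fin a => A).filter
        fun d => distinctCount d ≤ K, u (distinctCount d) * Φ (fun k => z (d k)) (z 0)) ^ 2 ∂ν := by
  set n := A.card
  -- Dividing by the number of `K`-sets around a draw makes the sum over all `K`-subsets of `A`
  -- return the weights `u`.
  let b : ℕ → ℝ := fun k => u k / ((n - k).choose (K - k) : ℝ)
  have hsymm := isSymmStatistic_sum_piFinset (E := E) b Φ
  have hL' : ∀ T : Finset ℕ, MemLp (fun z : ℕ → E => ∑ d ∈ Fintype.piFinset fun _ : Fin a => T,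
      b (distinctCount d) * Φ (fun k => z (d k)) (z 0)) 2 ν := fun T =>
    memLp_finsetSum _ fun d _ => (hL d).const_mul _
  have hmain := hν.integral_sq_sum_mono hsymm hL' (K := K) (𝒮 := (A.erase i).powersetCard K)
    (𝒯 := A.powersetCard K) (Finset.powersetCard_mono (Finset.erase_subset _ _))
    (fun T hT => (Finset.mem_powersetCard.1 hT).2)
    (fun T hT h => h0 ((Finset.mem_powersetCard.1 hT).1 h))
  simp only [sum_powersetCard_sum_piFinset] at hmain
  have hchoose : ∀ k ≤ K, ((n - k).choose (K - k) : ℝ) ≠ 0 := fun k hk =>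
    Nat.cast_ne_zero.2 (Nat.choose_pos (by omega)).ne'
  rw [← integral_const_mul]
  refine le_trans (le_of_eq ?_) (hmain.trans (le_of_eq ?_))
  · refine integral_congr_ae (Eventually.of_forall fun z => ?_)
    simp only
    rw [← mul_pow, Finset.mul_sum]
    congr 1
    refine Finset.sum_congr rfl fun d hd => ?_
    have hdK := (Finset.mem_filter.1 hd).2
    set k := distinctCount d
    rw [Finset.card_erase_of_mem hi]
    -- This identity evaluates the ratio of the numbers of `K`-sets around a draw without and with
    -- `i` available.
    have hid := Nat.choose_mul_succ_eq (n - k - 1) (K - k)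
    have e1 : n - k - 1 + 1 = n - k := by omega
    have e2 : n - k - (K - k) = n - K := by omega
    have e3 : A.card - 1 - k = n - k - 1 := by omega
    rw [e1, e2] at hid
    rw [e3]
    have hid' : ((n - k - 1).choose (K - k) : ℝ) * ((n : ℝ) - k) =
        ((n - k).choose (K - k) : ℝ) * ((n : ℝ) - K) := by
      have h1 : ((n - k : ℕ) : ℝ) = (n : ℝ) - k := Nat.cast_sub (by omega)
      have h2 : ((n - K : ℕ) : ℝ) = (n : ℝ) - K := Nat.cast_sub hK.le
      rw [← h1, ← h2]
      exact_mod_cast hid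
    have hn0 : (n : ℝ) ≠ 0 := Nat.cast_ne_zero.2 (by omega)
    have hnk : (n : ℝ) - k ≠ 0 := by
      have : (k : ℝ) < n := by exact_mod_cast lt_of_le_of_lt hdK hK
      linarith
    have hc := hchoose k hdK
    simp only [b]
    have : ((n : ℝ) - K) = ((n - k - 1).choose (K - k) : ℝ) * ((n : ℝ) - k) /
        ((n - k).choose (K - k) : ℝ) := by
      rw [hid']
      field_simp
    rw [this]
    field_simp
  · refine integral_congr_ae (Eventually.of_forall fun z => ?_)
    simp only
    congr 1
    refine Finset.sum_congr rfl fun d hd => ?_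
    have hc := hchoose _ (Finset.mem_filter.1 hd).2
    simp only [b]
    change ((n - distinctCount d).choose (K - distinctCount d) : ℝ) * _ = _
    field_simp

end LeaveOneOut

/-! ### Out-of-bag averages are controlled by the full average -/

section OutOfBag

theorem integral_sq_le_of_abs_sub_le {Ω : Type*} [MeasurableSpace Ω] {ν : Measure Ω}
    {f g B : Ω → ℝ} (hf : MemLp f 2 ν) (hg : MemLp g 2 ν) (hB : MemLp B 2 ν) {c : ℝ}
    (h : ∀ z, |f z - g z| ≤ c * B z) :
    ∫ z, f z ^ 2 ∂ν ≤ 2 * ∫ z, g z ^ 2 ∂ν + 2 * c ^ 2 * ∫ z, B z ^ 2 ∂ν := by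
  rw [← integral_const_mul, ← integral_const_mul,
    ← integral_add (hg.integrable_sq.const_mul _) (hB.integrable_sq.const_mul _)]
  refine integral_mono hf.integrable_sq
    ((hg.integrable_sq.const_mul _).add (hB.integrable_sq.const_mul _)) fun z => ?_
  have h1 : (f z - g z) ^ 2 ≤ (c * B z) ^ 2 := sq_le_sq.2 ((h z).trans (le_abs_self _))
  simp only
  nlinarith [sq_nonneg (f z - 2 * g z)]

variable {a : ℕ}

/-- A draw with `k` distinct values is avoided by exactly `A.card - k` indices. -/
theorem sum_sum_piFinset_erase (A : Finset ℕ) (g : (Fin a → ℕ) → ℝ) :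
    ∑ i ∈ A, ∑ d ∈ Fintype.piFinset fun _ : Fin a => A.erase i, g d =
      ∑ d ∈ Fintype.piFinset fun _ : Fin a => A, ((A.card : ℝ) - distinctCount d) * g d := by
  rw [Finset.sum_comm' (t' := Fintype.piFinset fun _ : Fin a => A)
    (s' := fun d => A \ Finset.univ.image d)]
  · refine Finset.sum_congr rfl fun d hd => ?_
    have hs : Finset.univ.image d ⊆ A := by
      simpa [Finset.image_subset_iff] using hd
    rw [Finset.sum_const, nsmul_eq_mul, Finset.card_sdiff_of_subset hs,
      Nat.cast_sub (Finset.card_le_card hs)]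
    rfl
  · intro i d
    simp only [Fintype.mem_piFinset, Finset.mem_erase, Finset.mem_sdiff, Finset.mem_image,
      Finset.mem_univ, true_and, not_exists]
    constructor
    · rintro ⟨h1, h2⟩
      exact ⟨⟨h1, fun k => (h2 k).1⟩, fun k => (h2 k).2⟩
    · rintro ⟨⟨h1, h2⟩, h3⟩
      exact ⟨h1, fun k => ⟨h2 k, h3 k⟩⟩

variable {E : Type*} [MeasurableSpace E]

/-- The passage from the full average `f` to the out-of-bag averages `V i` goes through two
intermediate sums. Truncating `f` to draws with at most `K` distinct values gives `fK`. The
leave-one-out comparison bounds `V' i` by `fK`, and `V' i` differs from `V i` only in its weights.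
Both differences are controlled by `B` and the concentration of the fraction `R d` of observations
missed by `d` around `q`. -/
theorem IsContractable.sum_integral_sq_outOfBag_le {ν : Measure (ℕ → E)} (hν : IsContractable ν)
    {Φ : (Fin a → E) → E → ℝ}
    (hL : ∀ d : Fin a → ℕ, MemLp (fun z : ℕ → E => Φ (fun k => z (d k)) (z 0)) 2 ν)
    {u : ℕ → ℝ} (hu : ∀ k, 0 ≤ u k) {A : Finset ℕ} (h0 : 0 ∉ A) (hA : A.Nonempty)
    (hsum : ∑ d ∈ Fintype.piFinset fun _ : Fin a => A, u (distinctCount d) = 1)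
    {q c : ℝ} (hc : 0 < c) (hcq : c ≤ q)
    (hq : ∀ i ∈ A, ∑ d ∈ Fintype.piFinset fun _ : Fin a => A.erase i, u (distinctCount d) = q)
    (hvar : ∑ d ∈ Fintype.piFinset fun _ : Fin a => A, u (distinctCount d) *
      (((A.card : ℝ) - distinctCount d) / A.card - q) ^ 2 ≤ 1 / A.card)
    {B : (ℕ → E) → ℝ} (hB : MemLp B 2 ν)
    (hΦB : ∀ d ∈ Fintype.piFinset fun _ : Fin a => A, ∀ z : ℕ → E,
      |Φ (fun k => z (d k)) (z 0)| ≤ B z) :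
    1 / (A.card : ℝ) * ∑ i ∈ A, ∫ z, (1 / q * ∑ d ∈ Fintype.piFinset fun _ : Fin a => A.erase i,
        u (distinctCount d) * Φ (fun k => z (d k)) (z 0)) ^ 2 ∂ν ≤
      16 / c ^ 2 * ∫ z, (∑ d ∈ Fintype.piFinset fun _ : Fin a => A,
        u (distinctCount d) * Φ (fun k => z (d k)) (z 0)) ^ 2 ∂ν +
      72 / c ^ 4 * ((∫ z, B z ^ 2 ∂ν) / A.card) := by
  classical
  set n : ℝ := (A.card : ℝ) with hn
  have hn0 : 0 < n := Nat.cast_pos.2 hA.card_pos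
  have hq0 : 0 < q := hc.trans_le hcq
  set W := Fintype.piFinset fun _ : Fin a => A with hW
  set W' : ℕ → Finset (Fin a → ℕ) := fun i => Fintype.piFinset fun _ : Fin a => A.erase i with hW'
  have hWsub : ∀ i, W' i ⊆ W := fun i =>
    Fintype.piFinset_subset _ _ fun _ => Finset.erase_subset _ _
  have hkA : ∀ d ∈ W, (distinctCount d : ℝ) ≤ n := fun d hd => by
    have hs : Finset.univ.image d ⊆ A := by
      simpa [hW, Finset.image_subset_iff] using hd
    exact Nat.cast_le.2 (Finset.card_le_card hs)
  have hq1 : q ≤ 1 := by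
    obtain ⟨i, hi⟩ := hA
    rw [← hq i hi, ← hsum]
    exact Finset.sum_le_sum_of_subset_of_nonneg (hWsub i) fun _ _ _ => hu _
  have hc1 : c ≤ 1 := hcq.trans hq1
  set R : (Fin a → ℕ) → ℝ := fun d => (n - distinctCount d) / n with hR
  -- The cutoff keeps `(n - K) / n ≥ c / 2`, so the prefactor of the comparison stays away from
  -- zero, while the draws beyond it have `R d < c / 2 ≤ q - c / 2` and are therefore rare.
  set K : ℕ := ⌊n * (1 - c / 2)⌋₊ with hKdef
  have hgood : ∀ d, distinctCount d ≤ K ↔ c / 2 ≤ R d := fun d => by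
    rw [hKdef, Nat.le_floor_iff (mul_nonneg hn0.le (by linarith)), hR, le_div_iff₀ hn0]
    constructor <;> intro h <;> linarith
  have hKn : (K : ℝ) ≤ n * (1 - c / 2) := Nat.floor_le (mul_nonneg hn0.le (by linarith))
  have hKlt : K < A.card := by
    have : (K : ℝ) < n := hKn.trans_lt (by nlinarith)
    rw [hn] at this
    exact_mod_cast this
  set v : ℝ := ∑ d ∈ W, u (distinctCount d) * (R d - q) ^ 2 with hv
  set I : ℝ := ∫ z, B z ^ 2 ∂ν with hI
  have hI0 : 0 ≤ I := integral_nonneg fun z => sq_nonneg _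
  set f : (ℕ → E) → ℝ := fun z => ∑ d ∈ W, u (distinctCount d) * Φ (fun k => z (d k)) (z 0) with hf
  set fK : (ℕ → E) → ℝ := fun z => ∑ d ∈ W.filter fun d => distinctCount d ≤ K,
    u (distinctCount d) * Φ (fun k => z (d k)) (z 0) with hfK
  set V' : ℕ → (ℕ → E) → ℝ := fun i z => ∑ d ∈ (W' i).filter fun d => distinctCount d ≤ K,
    u (distinctCount d) * (n / (n - distinctCount d)) * Φ (fun k => z (d k)) (z 0) with hV'
  set V : ℕ → (ℕ → E) → ℝ := fun i z => 1 / q * ∑ d ∈ W' i,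
    u (distinctCount d) * Φ (fun k => z (d k)) (z 0) with hV
  have hfL : MemLp f 2 ν := memLp_finsetSum _ fun d _ => (hL d).const_mul _
  have hfKL : MemLp fK 2 ν := memLp_finsetSum _ fun d _ => (hL d).const_mul _
  have hV'L : ∀ i, MemLp (V' i) 2 ν := fun i => memLp_finsetSum _ fun d _ => (hL d).const_mul _
  have hVL : ∀ i, MemLp (V i) 2 ν := fun i =>
    (memLp_finsetSum _ fun d _ => (hL d).const_mul _).const_mul _
  -- the mass of the draws with too many distinct values
  set β : ℝ := ∑ d ∈ W.filter fun d => ¬ distinctCount d ≤ K, u (distinctCount d) with hβ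
  have hβ0 : 0 ≤ β := Finset.sum_nonneg fun _ _ => hu _
  have hβ1 : β ≤ 1 := by
    rw [← hsum]
    exact Finset.sum_le_sum_of_subset_of_nonneg (Finset.filter_subset _ _) fun _ _ _ => hu _
  -- Chebyshev's inequality: excluded draws have `|R d - q| ≥ c / 2`.
  have hβv : β ≤ 4 / c ^ 2 * v := by
    calc β ≤ ∑ d ∈ W.filter fun d => ¬ distinctCount d ≤ K,
          4 / c ^ 2 * (u (distinctCount d) * (R d - q) ^ 2) := by
          refine Finset.sum_le_sum fun d hd => ?_
          have hbad := (Finset.mem_filter.1 hd).2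
          rw [hgood, not_le] at hbad
          have h1 : (c / 2) ^ 2 ≤ (R d - q) ^ 2 := by
            have : c / 2 ≤ q - R d := by linarith
            nlinarith
          have h2 : 1 ≤ 4 / c ^ 2 * (R d - q) ^ 2 := by
            rw [div_mul_eq_mul_div, le_div_iff₀ (by positivity)]
            linarith
          nlinarith [hu (distinctCount d)]
      _ ≤ ∑ d ∈ W, 4 / c ^ 2 * (u (distinctCount d) * (R d - q) ^ 2) :=
          Finset.sum_le_sum_of_subset_of_nonneg (Finset.filter_subset _ _) fun d _ _ =>
            mul_nonneg (by positivity) (mul_nonneg (hu _) (sq_nonneg _))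
      _ = 4 / c ^ 2 * v := by rw [← Finset.mul_sum]
  have hβsq : β ^ 2 ≤ 4 / c ^ 2 * (1 / n) := by
    have : 4 / c ^ 2 * v ≤ 4 / c ^ 2 * (1 / n) := mul_le_mul_of_nonneg_left hvar (by positivity)
    nlinarith
  have hfK_le : ∫ z, fK z ^ 2 ∂ν ≤ 2 * ∫ z, f z ^ 2 ∂ν + 2 * β ^ 2 * I := by
    refine integral_sq_le_of_abs_sub_le hfKL hfL hB fun z => ?_
    have hsplit : fK z - f z = -∑ d ∈ W.filter fun d => ¬ distinctCount d ≤ K,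
        u (distinctCount d) * Φ (fun k => z (d k)) (z 0) := by
      simp only [hf, hfK]
      rw [← Finset.sum_filter_add_sum_filter_not W fun d => distinctCount d ≤ K]
      ring
    rw [hsplit, abs_neg, hβ, Finset.sum_mul]
    refine (Finset.abs_sum_le_sum_abs _ _).trans (Finset.sum_le_sum fun d hd => ?_)
    rw [abs_mul, abs_of_nonneg (hu _)]
    exact mul_le_mul_of_nonneg_left (hΦB d (Finset.filter_subset _ _ hd) z) (hu _)
  have hV'_le : ∀ i ∈ A, ∫ z, V' i z ^ 2 ∂ν ≤ 4 / c ^ 2 * ∫ z, fK z ^ 2 ∂ν := by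
    intro i hi
    have h1 := hν.integral_sq_leaveOneOut_le hL u h0 hi hKlt
    have h2 : (c / 2) ^ 2 ≤ ((n - K) / n) ^ 2 := by
      have : c / 2 ≤ (n - K) / n := by
        rw [le_div_iff₀ hn0]
        linarith
      exact pow_le_pow_left₀ (by positivity) this 2
    have h3 : 0 ≤ ∫ z, V' i z ^ 2 ∂ν := integral_nonneg fun z => sq_nonneg _
    have h4 : (c / 2) ^ 2 * ∫ z, V' i z ^ 2 ∂ν ≤ ∫ z, fK z ^ 2 ∂ν :=
      (mul_le_mul_of_nonneg_right h2 h3).trans h1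
    rw [div_mul_eq_mul_div, le_div_iff₀ (by positivity)]
    nlinarith
  -- The factors in `V' i`, extended by `0` to the excluded draws; `τ i` is the `L¹` distance
  -- between the weights of `V i` and `V' i`.
  let g : (Fin a → ℕ) → ℝ := fun d => if distinctCount d ≤ K then n / (n - distinctCount d) else 0
  let τ : ℕ → ℝ := fun i => ∑ d ∈ W' i, u (distinctCount d) * |1 / q - g d|
  have hV_le : ∀ i, ∫ z, V i z ^ 2 ∂ν ≤ 2 * ∫ z, V' i z ^ 2 ∂ν + 2 * τ i ^ 2 * I := by
    intro i
    refine integral_sq_le_of_abs_sub_le (hVL i) (hV'L i) hB fun z => ?_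
    have hsplit : V i z - V' i z = ∑ d ∈ W' i,
        u (distinctCount d) * (1 / q - g d) * Φ (fun k => z (d k)) (z 0) := by
      simp only [hV, hV', g]
      rw [Finset.sum_filter, Finset.mul_sum, ← Finset.sum_sub_distrib]
      refine Finset.sum_congr rfl fun d _ => ?_
      split_ifs <;> ring
    rw [hsplit]
    simp only [τ]
    rw [Finset.sum_mul]
    refine (Finset.abs_sum_le_sum_abs _ _).trans (Finset.sum_le_sum fun d hd => ?_)
    rw [abs_mul, abs_mul, abs_of_nonneg (hu _)]
    exact mul_le_mul_of_nonneg_left (hΦB d (hWsub i hd) z)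
      (mul_nonneg (hu _) (abs_nonneg _))
  have hτ : ∀ i ∈ A, τ i ^ 2 ≤ ∑ d ∈ W' i, u (distinctCount d) * (1 / q - g d) ^ 2 := by
    intro i hi
    have h1 : τ i ^ 2 ≤ (∑ d ∈ W' i, u (distinctCount d)) *
        ∑ d ∈ W' i, u (distinctCount d) * (1 / q - g d) ^ 2 := by
      refine Finset.sum_sq_le_sum_mul_sum_of_sq_le_mul _ (fun d _ => hu _)
        (fun d _ => mul_nonneg (hu _) (sq_nonneg _)) fun d _ => le_of_eq ?_
      rw [mul_pow, sq_abs]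
      ring
    rw [hq i hi] at h1
    refine h1.trans (mul_le_of_le_one_left ?_ hq1)
    exact Finset.sum_nonneg fun d _ => mul_nonneg (hu _) (sq_nonneg _)
  -- The factor `R d` arises from summing over the indices that `d` avoids. For `g d = 1 / R d` the
  -- left side equals `(R d - q) ^ 2 / (q ^ 2 * R d)`. For excluded draws it is at most `1 / c ^ 2`,
  -- and `(R d - q) ^ 2` is bounded below.
  have hterm : ∀ d ∈ W, R d * (1 / q - g d) ^ 2 ≤ 4 / c ^ 4 * (R d - q) ^ 2 := by
    intro d hd
    have hR0 : 0 ≤ R d := div_nonneg (by linarith [hkA d hd]) hn0.le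
    have hqc : 1 / q ^ 2 ≤ 1 / c ^ 2 :=
      one_div_le_one_div_of_le (by positivity) (pow_le_pow_left₀ hc.le hcq 2)
    by_cases hk : distinctCount d ≤ K
    · have hRc := (hgood d).1 hk
      have hRp : 0 < R d := by linarith
      have hg : g d = 1 / R d := by
        simp only [g, if_pos hk, hR, one_div_div]
      have e1 : R d * (1 / q - g d) ^ 2 = 1 / q ^ 2 * (1 / R d) * (R d - q) ^ 2 := by
        rw [hg]
        field_simp
      rw [e1]
      refine mul_le_mul_of_nonneg_right ?_ (sq_nonneg _)
      have h3 : 1 / R d ≤ 4 / c ^ 2 := by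
        rw [div_le_div_iff₀ hRp (by positivity)]
        nlinarith
      calc 1 / q ^ 2 * (1 / R d) ≤ 1 / c ^ 2 * (4 / c ^ 2) :=
            mul_le_mul hqc h3 (by positivity) (by positivity)
        _ = 4 / c ^ 4 := by field_simp
    · have hg : g d = 0 := if_neg hk
      rw [hgood, not_le] at hk
      have h1 : (c / 2) ^ 2 ≤ (R d - q) ^ 2 := by
        have : c / 2 ≤ q - R d := by linarith
        nlinarith
      have h2 : R d ≤ 1 := by linarith
      calc R d * (1 / q - g d) ^ 2 = R d * (1 / q ^ 2) := by rw [hg]; ring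
        _ ≤ 1 * (1 / c ^ 2) := mul_le_mul h2 hqc (by positivity) (by positivity)
        _ = 4 / c ^ 4 * (c / 2) ^ 2 := by field_simp; ring
        _ ≤ 4 / c ^ 4 * (R d - q) ^ 2 := mul_le_mul_of_nonneg_left h1 (by positivity)
  have hτsum : ∑ i ∈ A, τ i ^ 2 ≤ 4 / c ^ 4 := by
    calc ∑ i ∈ A, τ i ^ 2
        ≤ ∑ i ∈ A, ∑ d ∈ W' i, u (distinctCount d) * (1 / q - g d) ^ 2 := Finset.sum_le_sum hτ
      _ = ∑ d ∈ W, (n - distinctCount d) * (u (distinctCount d) * (1 / q - g d) ^ 2) :=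
          sum_sum_piFinset_erase A fun d => u (distinctCount d) * (1 / q - g d) ^ 2
      _ ≤ ∑ d ∈ W, n * (4 / c ^ 4) * (u (distinctCount d) * (R d - q) ^ 2) := by
          refine Finset.sum_le_sum fun d hd => ?_
          have e : n - distinctCount d = n * R d := by
            simp only [hR]
            field_simp
          rw [e]
          calc n * R d * (u (distinctCount d) * (1 / q - g d) ^ 2)
              = n * u (distinctCount d) * (R d * (1 / q - g d) ^ 2) := by ring
            _ ≤ n * u (distinctCount d) * (4 / c ^ 4 * (R d - q) ^ 2) :=
                mul_le_mul_of_nonneg_left (hterm d hd) (mul_nonneg hn0.le (hu _))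
            _ = _ := by ring
      _ = n * (4 / c ^ 4) * v := by rw [← Finset.mul_sum]
      _ ≤ n * (4 / c ^ 4) * (1 / n) := mul_le_mul_of_nonneg_left hvar (by positivity)
      _ = 4 / c ^ 4 := by field_simp
  -- The losses are a factor `2` for reweighting, `4 / c ^ 2` for leaving out `i`, and `2` for
  -- truncation. They give the final `16 / c ^ 2`, and the coefficient `72` is `64` from truncation
  -- plus `8` from reweighting.
  have hfin : ∑ i ∈ A, ∫ z, V i z ^ 2 ∂ν ≤
      n * (2 * (4 / c ^ 2 * (2 * ∫ z, f z ^ 2 ∂ν + 2 * (4 / c ^ 2 * (1 / n)) * I))) +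
        2 * (4 / c ^ 4) * I := by
    calc ∑ i ∈ A, ∫ z, V i z ^ 2 ∂ν
        ≤ ∑ i ∈ A, (2 * (4 / c ^ 2 * (2 * ∫ z, f z ^ 2 ∂ν + 2 * (4 / c ^ 2 * (1 / n)) * I)) +
            2 * I * τ i ^ 2) := by
          refine Finset.sum_le_sum fun i hi => ?_
          have h1 := hV_le i
          have h2 := hV'_le i hi
          have h3 : 4 / c ^ 2 * ∫ z, fK z ^ 2 ∂ν ≤
              4 / c ^ 2 * (2 * ∫ z, f z ^ 2 ∂ν + 2 * (4 / c ^ 2 * (1 / n)) * I) := by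
            refine mul_le_mul_of_nonneg_left (hfK_le.trans ?_) (by positivity)
            have := mul_le_mul_of_nonneg_right hβsq hI0
            linarith
          linarith
      _ = n * (2 * (4 / c ^ 2 * (2 * ∫ z, f z ^ 2 ∂ν + 2 * (4 / c ^ 2 * (1 / n)) * I))) +
            2 * I * ∑ i ∈ A, τ i ^ 2 := by
          rw [Finset.sum_add_distrib, Finset.sum_const, nsmul_eq_mul, ← Finset.mul_sum]
      _ ≤ _ := by
          have := mul_le_mul_of_nonneg_left hτsum (mul_nonneg zero_le_two hI0)
          linarith
  calc 1 / n * ∑ i ∈ A, ∫ z, V i z ^ 2 ∂ν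
      ≤ 1 / n * (n * (2 * (4 / c ^ 2 * (2 * ∫ z, f z ^ 2 ∂ν +
          2 * (4 / c ^ 2 * (1 / n)) * I))) + 2 * (4 / c ^ 4) * I) :=
        mul_le_mul_of_nonneg_left hfin (by positivity)
    _ = 16 / c ^ 2 * ∫ z, f z ^ 2 ∂ν + 72 / c ^ 4 * (I / n) := by
        field_simp
        ring

end OutOfBag

/-! ### The weights of the bagging step -/

section Weights

variable {a : ℕ}

theorem distinctCount_eq_iff (d : Fin a → ℕ) : distinctCount d = a ↔ Function.Injective d := by
  have : distinctCount d = a ↔ (Finset.univ.image d).card = (Finset.univ : Finset (Fin a)).card := by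
    simp [distinctCount]
  rw [this, Finset.card_image_iff]
  simp [Set.injOn_univ]

theorem card_filter_injective_piFinset (A : Finset ℕ) :
    ((Fintype.piFinset fun _ : Fin a => A).filter fun d => distinctCount d = a).card =
      A.card.descFactorial a := by
  classical
  have h := Fintype.card_embedding_eq (α := Fin a) (β := A)
  rw [Fintype.card_fin, Fintype.card_coe] at h
  rw [← h, ← Finset.card_univ]
  symm
  refine Finset.card_bij (fun e _ k => (e k : ℕ)) ?_ ?_ ?_
  · intro e _
    rw [Finset.mem_filter, distinctCount_eq_iff, Fintype.mem_piFinset]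
    exact ⟨fun k => (e k).2, Subtype.val_injective.comp e.injective⟩
  · intro e _ e' _ h
    ext k
    exact congrFun h k
  · intro d hd
    rw [Finset.mem_filter, distinctCount_eq_iff, Fintype.mem_piFinset] at hd
    exact ⟨⟨fun k => ⟨d k, hd.1 k⟩, fun k l hkl => hd.2 (by simpa using hkl)⟩,
      Finset.mem_univ _, rfl⟩

/-- The probability that the bagging step draws a given list of observations, in terms of the
number of distinct observations in it. -/
def drawWeight (scheme : Resampling) (n a k : ℕ) : ℝ :=
  match scheme with
  | .withReplacement => 1 / (n : ℝ) ^ a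
  | .withoutReplacement => if k = a then 1 / (n.descFactorial a : ℝ) else 0

/-- The probability that a given observation is not drawn. -/
def missProb (scheme : Resampling) (n a : ℕ) : ℝ :=
  match scheme with
  | .withReplacement => (((n : ℝ) - 1) / n) ^ a
  | .withoutReplacement => ((n : ℝ) - a) / n

theorem drawWeight_nonneg (scheme : Resampling) (n a k : ℕ) : 0 ≤ drawWeight scheme n a k := by
  cases scheme
  · simp only [drawWeight]
    positivity
  · simp only [drawWeight]
    split_ifs <;> positivity

theorem sum_drawWeight_without (n : ℕ) (A : Finset ℕ) (g : (Fin a → ℕ) → ℝ) :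
    ∑ d ∈ Fintype.piFinset fun _ : Fin a => A,
        drawWeight .withoutReplacement n a (distinctCount d) * g d =
      (∑ d ∈ (Fintype.piFinset fun _ : Fin a => A).filter fun d => distinctCount d = a, g d) /
        (n.descFactorial a : ℝ) := by
  rw [Finset.sum_filter, Finset.sum_div]
  refine Finset.sum_congr rfl fun d _ => ?_
  simp only [drawWeight]
  split_ifs <;> ring

theorem sum_drawWeight (scheme : Resampling) {n : ℕ} (hn : 1 ≤ n) (han : a ≤ n) {A : Finset ℕ}
    (hA : A.card = n) :
    ∑ d ∈ Fintype.piFinset fun _ : Fin a => A, drawWeight scheme n a (distinctCount d) = 1 := by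
  have hn0 : (n : ℝ) ≠ 0 := Nat.cast_ne_zero.2 (by omega)
  cases scheme
  · simp only [drawWeight, Finset.sum_const, Fintype.card_piFinset_const, hA, nsmul_eq_mul]
    push_cast
    field_simp
  · have h := sum_drawWeight_without (a := a) n A fun _ => 1
    simp only [mul_one, Finset.sum_const, nsmul_eq_mul] at h
    rw [h, card_filter_injective_piFinset, hA]
    exact div_self (Nat.cast_ne_zero.2 (Nat.descFactorial_pos.2 han).ne')

theorem sum_drawWeight_erase (scheme : Resampling) {n : ℕ} (hn : 1 ≤ n) (han : a ≤ n)
    {A : Finset ℕ} (hA : A.card = n) {i : ℕ} (hi : i ∈ A) :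
    ∑ d ∈ Fintype.piFinset fun _ : Fin a => A.erase i, drawWeight scheme n a (distinctCount d) =
      missProb scheme n a := by
  have hn0 : (n : ℝ) ≠ 0 := Nat.cast_ne_zero.2 (by omega)
  cases scheme
  · simp only [drawWeight, missProb, Finset.sum_const, Fintype.card_piFinset_const,
      Finset.card_erase_of_mem hi, hA, nsmul_eq_mul]
    push_cast [Nat.cast_sub hn]
    rw [div_pow, mul_one_div]
  · have h := sum_drawWeight_without (a := a) n (A.erase i) fun _ => 1
    simp only [mul_one, Finset.sum_const, nsmul_eq_mul] at h
    rw [h, card_filter_injective_piFinset, Finset.card_erase_of_mem hi, hA, missProb]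
    obtain ⟨k, rfl⟩ : ∃ k, n = k + 1 := ⟨n - 1, by omega⟩
    have h1 := Nat.succ_descFactorial k a
    have h2 : (((k + 1).descFactorial a : ℕ) : ℝ) ≠ 0 :=
      Nat.cast_ne_zero.2 (Nat.descFactorial_pos.2 han).ne'
    have h3 : (((k + 1 - a : ℕ) : ℝ)) = ((k + 1 : ℕ) : ℝ) - a := Nat.cast_sub han
    rw [div_eq_div_iff h2 hn0, ← h3]
    have h4 : (((k + 1 - a) * (k + 1).descFactorial a : ℕ) : ℝ) =
        (((k + 1) * k.descFactorial a : ℕ) : ℝ) := congrArg _ h1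
    rw [Nat.cast_mul, Nat.cast_mul] at h4
    rw [h4, Nat.add_sub_cancel]
    ring

/-- Missing `i` and missing `j` are negatively correlated, since `(n - 2) / n ≤ ((n - 1) / n) ^ 2`.
-/
theorem sum_drawWeight_erase_erase_le {n : ℕ} (hn : 1 ≤ n) {A : Finset ℕ} (hA : A.card = n)
    {i j : ℕ} (hi : i ∈ A) (hj : j ∈ A) (hij : i ≠ j) :
    ∑ d ∈ Fintype.piFinset fun _ : Fin a => (A.erase i).erase j,
      drawWeight .withReplacement n a (distinctCount d) ≤ missProb .withReplacement n a ^ 2 := by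
  have hn0 : (0 : ℝ) < n := Nat.cast_pos.2 (by omega)
  have hn2 : 2 ≤ n := by
    rw [← hA]
    exact Finset.one_lt_card.2 ⟨i, hi, j, hj, hij⟩
  have hn2' : (2 : ℝ) ≤ n := by exact_mod_cast hn2
  simp only [drawWeight, missProb, Finset.sum_const, Fintype.card_piFinset_const,
    Finset.card_erase_of_mem hi, Finset.card_erase_of_mem (Finset.mem_erase.2 ⟨hij.symm, hj⟩), hA,
    nsmul_eq_mul]
  rw [Nat.sub_sub, Nat.cast_pow, Nat.cast_sub hn2, mul_one_div, ← div_pow, ← pow_mul, mul_comm a,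
    pow_mul]
  refine pow_le_pow_left₀ (div_nonneg (by push_cast; linarith) hn0.le) ?_ a
  rw [div_pow, div_le_div_iff₀ hn0 (by positivity)]
  push_cast
  nlinarith

/-- The left side is the variance of the fraction of missed observations. With replacement, negative
correlation of the missing indicators bounds it by `(q - q ^ 2) / n`; without replacement the number
of distinct values is always `a` and the variance is zero. -/
theorem sum_drawWeight_mul_sq (scheme : Resampling) {n : ℕ} (hn : 1 ≤ n) (han : a ≤ n)
    {A : Finset ℕ} (hA : A.card = n) :
    ∑ d ∈ Fintype.piFinset fun _ : Fin a => A, drawWeight scheme n a (distinctCount d) *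
      (((n : ℝ) - distinctCount d) / n - missProb scheme n a) ^ 2 ≤ 1 / n := by
  have hn0 : (0 : ℝ) < n := Nat.cast_pos.2 (by omega)
  have hn1 : (1 : ℝ) ≤ n := by exact_mod_cast hn
  cases scheme
  · set q := missProb .withReplacement n a with hq
    set w : (Fin a → ℕ) → ℝ := fun d => drawWeight .withReplacement n a (distinctCount d) with hw
    have hw0 : ∀ d, 0 ≤ w d := fun d => drawWeight_nonneg _ _ _ _
    have hq0 : 0 ≤ q := pow_nonneg (div_nonneg (by linarith) hn0.le) _
    have hq1 : q ≤ 1 := pow_le_one₀ (div_nonneg (by linarith) hn0.le)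
      (by rw [div_le_one hn0]; linarith)
    have h1 : ∑ d ∈ Fintype.piFinset fun _ : Fin a => A, w d = 1 := sum_drawWeight _ hn han hA
    have h2 : ∑ d ∈ Fintype.piFinset fun _ : Fin a => A, ((n : ℝ) - distinctCount d) * w d =
        n * q := by
      have := sum_sum_piFinset_erase A w
      rw [hA] at this
      rw [← this, Finset.sum_congr rfl fun i hi => sum_drawWeight_erase _ hn han hA hi]
      simp [hA, hq]
    have h3 : ∑ d ∈ Fintype.piFinset fun _ : Fin a => A,
        ((n : ℝ) - distinctCount d) ^ 2 * w d ≤ n * q + n * (n - 1) * q ^ 2 := by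
      have hswap := sum_sum_piFinset_erase A fun d => ((n : ℝ) - distinctCount d) * w d
      rw [hA] at hswap
      have e : ∀ d, ((n : ℝ) - distinctCount d) ^ 2 * w d =
          (n - distinctCount d) * (((n : ℝ) - distinctCount d) * w d) := fun d => by ring
      simp only [e]
      rw [← hswap]
      have hi : ∀ i ∈ A, ∑ d ∈ Fintype.piFinset fun _ : Fin a => A.erase i,
          ((n : ℝ) - distinctCount d) * w d ≤ q + (n - 1) * q ^ 2 := by
        intro i hi
        have hs := sum_sum_piFinset_erase (A.erase i) w
        have hc : ((A.erase i).card : ℝ) = n - 1 := by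
          rw [Finset.card_erase_of_mem hi, hA, Nat.cast_sub hn, Nat.cast_one]
        rw [hc] at hs
        have hs' : ∑ d ∈ Fintype.piFinset fun _ : Fin a => A.erase i,
            ((n : ℝ) - distinctCount d) * w d =
            (∑ d ∈ Fintype.piFinset fun _ : Fin a => A.erase i, w d) +
            ∑ d ∈ Fintype.piFinset fun _ : Fin a => A.erase i,
              ((n : ℝ) - 1 - distinctCount d) * w d := by
          rw [← Finset.sum_add_distrib]
          exact Finset.sum_congr rfl fun d _ => by ring
        rw [hs', ← hs, sum_drawWeight_erase _ hn han hA hi]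
        gcongr
        calc _ ≤ ∑ _j ∈ A.erase i, q ^ 2 := Finset.sum_le_sum fun j hj =>
              sum_drawWeight_erase_erase_le hn hA hi (Finset.mem_erase.1 hj).2
                (Finset.mem_erase.1 hj).1.symm
          _ = (n - 1) * q ^ 2 := by rw [Finset.sum_const, nsmul_eq_mul, hc]
      calc _ ≤ ∑ _i ∈ A, (q + (n - 1) * q ^ 2) := Finset.sum_le_sum hi
        _ = n * q + n * (n - 1) * q ^ 2 := by
          rw [Finset.sum_const, nsmul_eq_mul, hA]
          ring
    have hexp : ∑ d ∈ Fintype.piFinset fun _ : Fin a => A,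
        w d * (((n : ℝ) - distinctCount d) / n - q) ^ 2 =
        (∑ d ∈ Fintype.piFinset fun _ : Fin a => A, ((n : ℝ) - distinctCount d) ^ 2 * w d) / n ^ 2
        - 2 * q / n * (∑ d ∈ Fintype.piFinset fun _ : Fin a => A, ((n : ℝ) - distinctCount d) * w d)
        + q ^ 2 * ∑ d ∈ Fintype.piFinset fun _ : Fin a => A, w d := by
      rw [Finset.sum_div, Finset.mul_sum, Finset.mul_sum, ← Finset.sum_sub_distrib,
        ← Finset.sum_add_distrib]
      refine Finset.sum_congr rfl fun d _ => ?_
      field_simp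
      ring
    rw [hexp, h1, h2]
    have h4 := div_le_div_of_nonneg_right h3 (sq_nonneg (n : ℝ))
    have h5 : (n * q + n * (n - 1) * q ^ 2) / (n : ℝ) ^ 2 - 2 * q / n * (n * q) + q ^ 2 * 1 =
        (q - q ^ 2) / n := by
      field_simp
      ring
    have h6 : (q - q ^ 2) / n ≤ 1 / (n : ℝ) :=
      div_le_div_of_nonneg_right (by nlinarith) hn0.le
    linarith
  · have : ∀ d ∈ Fintype.piFinset fun _ : Fin a => A,
        drawWeight .withoutReplacement n a (distinctCount d) *
        (((n : ℝ) - distinctCount d) / n - missProb .withoutReplacement n a) ^ 2 = 0 := by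
      intro d _
      simp only [drawWeight, missProb]
      split_ifs with h
      · rw [h]
        simp
      · simp
    rw [Finset.sum_eq_zero this]
    positivity

/-- With replacement `(1 - 1 / n) ^ a ≥ (1 - 1 / n) ^ n`, which tends to `exp (-1)`. Without
replacement the bound on `a n / n` is the claim. -/
theorem exists_missProb_ge (scheme : Resampling) {a : ℕ → ℕ} (han : ∀ n, a n ≤ n)
    (hscheme : scheme = Resampling.withoutReplacement →
      ∃ c : ℝ, c < 1 ∧ ∀ᶠ n : ℕ in atTop, (a n : ℝ) ≤ c * n) :
    ∃ c : ℝ, 0 < c ∧ ∀ᶠ n : ℕ in atTop, c ≤ missProb scheme n (a n) := by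
  cases scheme
  · refine ⟨Real.exp (-1) / 2, by positivity, ?_⟩
    have hlim := Real.tendsto_one_add_div_pow_exp (-1)
    filter_upwards [eventually_ge_atTop 1, hlim.eventually_const_le
      (half_lt_self (Real.exp_pos (-1)))] with n hn hexp
    have hn1 : (1 : ℝ) ≤ n := by exact_mod_cast hn
    have hn0 : (0 : ℝ) < n := by linarith
    have e : 1 + -1 / (n : ℝ) = (n - 1) / n := by
      field_simp
      ring
    rw [e] at hexp
    exact hexp.trans (pow_le_pow_of_le_one (div_nonneg (by linarith) hn0.le)
      (by rw [div_le_one hn0]; linarith) (han n))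
  · obtain ⟨c, hc, h⟩ := hscheme rfl
    refine ⟨1 - c, by linarith, ?_⟩
    filter_upwards [h, eventually_ge_atTop 1] with n hn hn1
    have hn0 : (0 : ℝ) < n := Nat.cast_pos.2 (by omega)
    simp only [missProb]
    rw [le_div_iff₀ hn0]
    linarith

end Weights

/-! ### Forests with infinitely many trees -/

section Seeds

variable {p n a t : ℕ}

/-- A tree seed is a list of drawn observations together with a list of feature sets. -/
def seedEquiv : ((Fin a → Fin n) × (Fin (2 * t) → Finset (Fin p))) ≃ TreeSeed p n a t where
  toFun x := ⟨x.1, x.2⟩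
  invFun s := (s.draw, s.feat)
  left_inv _ := rfl
  right_inv _ := rfl

instance : Fintype (TreeSeed p n a t) := Fintype.ofEquiv _ seedEquiv

open Classical in
instance : DecidableEq (TreeSeed p n a t) := inferInstance

instance : MeasurableSingletonClass (TreeSeed p n a t) := ⟨fun _ => trivial⟩

open Classical in
/-- The possible draws of the bagging step. -/
def allowedDraws (scheme : Resampling) (n a : ℕ) : Finset (Fin a → Fin n) :=
  Finset.univ.filter fun d => scheme = Resampling.withoutReplacement → Function.Injective d

/-- The possible choices of coordinates at the nodes. -/
def featSets (p t mtry : ℕ) : Finset (Fin (2 * t) → Finset (Fin p)) :=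
  Fintype.piFinset fun _ => Finset.univ.powersetCard mtry

/-- The finite set of the possible values of the randomness of a tree. -/
def seedFinset (scheme : Resampling) (p n a t mtry : ℕ) : Finset (TreeSeed p n a t) :=
  (allowedDraws scheme n a ×ˢ featSets p t mtry).map seedEquiv.toEmbedding

theorem coe_seedFinset (scheme : Resampling) (p n a t mtry : ℕ) :
    (seedFinset scheme p n a t mtry : Set (TreeSeed p n a t)) =
      treeSeeds scheme p n a t mtry := by
  ext s
  simp only [seedFinset, Finset.mem_coe, Finset.mem_map_equiv, Finset.mem_product, allowedDraws,
    featSets, Finset.mem_filter, Finset.mem_univ, true_and, Fintype.mem_piFinset,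
    Finset.mem_powersetCard, Finset.subset_univ, treeSeeds, Set.mem_ofPred_eq]
  rfl

theorem sum_seedFinset (scheme : Resampling) (mtry : ℕ) (g : TreeSeed p n a t → ℝ) :
    ∑ s ∈ seedFinset scheme p n a t mtry, g s =
      ∑ d ∈ allowedDraws scheme n a, ∑ φ ∈ featSets p t mtry, g ⟨d, φ⟩ := by
  rw [seedFinset, Finset.sum_map, Finset.sum_product]
  rfl

theorem featSets_nonempty {mtry : ℕ} (h : mtry ≤ p) : (featSets p t mtry).Nonempty := by
  rw [featSets, Fintype.piFinset_nonempty]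
  exact fun _ => Finset.powersetCard_nonempty.2 (by simpa using h)

-- The shift by one translates indices in `Fin n` to the observations `1, …, n` of a sequence whose
-- entry `0` is the unseen point.
open Classical in
theorem sum_allowedDraws (scheme : Resampling) (g : (Fin a → ℕ) → ℝ) :
    ∑ d ∈ allowedDraws scheme n a, g (fun k => (d k : ℕ) + 1) =
      ∑ d ∈ (Fintype.piFinset fun _ : Fin a => Finset.Icc 1 n).filter
        fun d => scheme = Resampling.withoutReplacement → distinctCount d = a, g d := by
  have hinj : Function.Injective fun (d : Fin a → Fin n) (k : Fin a) => (d k : ℕ) + 1 := by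
    intro d d' h
    funext k
    have := congrFun h k
    simp only at this
    exact Fin.ext (by omega)
  have hcomp : Function.Injective fun i : Fin n => (i : ℕ) + 1 := fun i j h => Fin.ext (by
    simp only at h
    omega)
  refine Finset.sum_nbij (fun d k => (d k : ℕ) + 1) ?_ hinj.injOn ?_ fun _ _ => rfl
  · intro d hd
    rw [allowedDraws, Finset.mem_filter] at hd
    rw [Finset.mem_filter, Fintype.mem_piFinset]
    refine ⟨fun k => Finset.mem_Icc.2 ⟨by omega, by have := (d k).2; omega⟩, fun hs => ?_⟩
    rw [distinctCount_eq_iff]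
    exact hcomp.comp (hd.2 hs)
  · intro d hd
    rw [Finset.mem_coe, Finset.mem_filter, Fintype.mem_piFinset] at hd
    have hd1 := fun k => Finset.mem_Icc.1 (hd.1 k)
    have he : (fun k => ((⟨d k - 1, by have := hd1 k; omega⟩ : Fin n) : ℕ) + 1) = d := by
      funext k
      have := hd1 k
      simp only
      omega
    refine ⟨fun k => ⟨d k - 1, by have := hd1 k; omega⟩, ?_, he⟩
    rw [Finset.mem_coe, allowedDraws, Finset.mem_filter]
    refine ⟨Finset.mem_univ _, fun hs => ?_⟩
    have h2 := hd.2 hs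
    rw [distinctCount_eq_iff, ← he] at h2
    exact fun k l hkl => h2 (congrArg (fun x : Fin n => (x : ℕ) + 1) hkl)

theorem card_allowedDraws (scheme : Resampling) :
    ((allowedDraws scheme n a).card : ℝ) =
      match scheme with
      | .withReplacement => (n : ℝ) ^ a
      | .withoutReplacement => (n.descFactorial a : ℝ) := by
  have h := sum_allowedDraws (n := n) (a := a) scheme fun _ => 1
  simp only [Finset.sum_const, nsmul_eq_mul, mul_one] at h
  rw [h]
  cases scheme
  · simp
  · have := card_filter_injective_piFinset (a := a) (Finset.Icc 1 n)
    simp only [forall_const]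
    rw [Finset.filter_congr_decidable, this]
    simp

theorem sum_allowedDraws_div_card (scheme : Resampling) (g : (Fin a → ℕ) → ℝ) :
    (∑ d ∈ allowedDraws scheme n a, g (fun k => (d k : ℕ) + 1)) / (allowedDraws scheme n a).card =
      ∑ d ∈ Fintype.piFinset fun _ : Fin a => Finset.Icc 1 n,
        drawWeight scheme n a (distinctCount d) * g d := by
  rw [sum_allowedDraws, card_allowedDraws]
  cases scheme
  · simp only [drawWeight, reduceCtorEq, false_imp_iff, Finset.filter_true]
    rw [Finset.sum_div]
    exact Finset.sum_congr rfl fun d _ => by ring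
  · rw [sum_drawWeight_without]
    simp only [forall_const]

/-- The mean of a tree over the choices of the coordinates at its nodes. -/
def meanTree (tie : TieRule p a) (t mtry : ℕ) (y : Fin a → (Fin p → ℝ) × ℝ) (x : Fin p → ℝ) : ℝ :=
  (∑ φ ∈ featSets p t mtry, Cart.predict tie t y φ x) / ((featSets p t mtry).card : ℝ)

theorem measurable_meanTree (tie : TieRule p a) (t mtry : ℕ) :
    Measurable fun q : (Fin a → (Fin p → ℝ) × ℝ) × (Fin p → ℝ) =>
      meanTree tie t mtry q.1 q.2 :=
  (Finset.measurable_fun_sum _ fun φ _ => Cart.measurable_predict tie t φ).div_const _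

theorem abs_meanTree_le (tie : TieRule p a) (t mtry : ℕ) {y : Fin a → (Fin p → ℝ) × ℝ}
    (x : Fin p → ℝ) {B : ℝ} (hB : 0 ≤ B) (h : ∀ k, |(y k).2| ≤ B) :
    |meanTree tie t mtry y x| ≤ B :=
  abs_sum_div_card_le _ hB fun φ => Cart.abs_predict_le tie t φ x hB h

/-- The prediction of a forest with infinitely many trees. -/
def forestMean (scheme : Resampling) (mtry : ℕ) (tie : TieRule p a) (t : ℕ)
    (D : Fin n → (Fin p → ℝ) × ℝ) (x : Fin p → ℝ) : ℝ :=
  (∑ s ∈ seedFinset scheme p n a t mtry, RandomForest.tree tie s D x) /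
    ((seedFinset scheme p n a t mtry).card : ℝ)

open Classical in
/-- The seeds that do not draw the observation `i`. -/
def seedsAvoiding (scheme : Resampling) (p n a t mtry : ℕ) (i : Fin n) :
    Finset (TreeSeed p n a t) :=
  (seedFinset scheme p n a t mtry).filter fun s => ∀ k, s.draw k ≠ i

/-- The out-of-bag prediction of a forest with infinitely many trees. -/
def oobMean (scheme : Resampling) (mtry : ℕ) (tie : TieRule p a) (t : ℕ)
    (D : Fin n → (Fin p → ℝ) × ℝ) (i : Fin n) : ℝ :=
  (∑ s ∈ seedsAvoiding scheme p n a t mtry i, RandomForest.tree tie s D (D i).1) /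
    ((seedsAvoiding scheme p n a t mtry i).card : ℝ)

theorem card_seedFinset (scheme : Resampling) (mtry : ℕ) :
    ((seedFinset scheme p n a t mtry).card : ℝ) =
      (allowedDraws scheme n a).card * (featSets p t mtry).card := by
  rw [seedFinset, Finset.card_map, Finset.card_product, Nat.cast_mul]

theorem forestMean_eq (scheme : Resampling) (mtry : ℕ) (tie : TieRule p a) (t : ℕ)
    (z : ℕ → (Fin p → ℝ) × ℝ) (x : Fin p → ℝ) :
    forestMean scheme mtry tie t (fun i : Fin n => z (i + 1)) x =
      ∑ d ∈ Fintype.piFinset fun _ : Fin a => Finset.Icc 1 n,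
        drawWeight scheme n a (distinctCount d) * meanTree tie t mtry (fun k => z (d k)) x := by
  rw [← sum_allowedDraws_div_card scheme fun d => meanTree tie t mtry (fun k => z (d k)) x,
    forestMean, sum_seedFinset, card_seedFinset,
    mul_comm ((allowedDraws scheme n a).card : ℝ), ← div_div, Finset.sum_div]
  rfl

open Classical in
theorem piFinset_erase_eq_filter (A : Finset ℕ) (i : ℕ) :
    (Fintype.piFinset fun _ : Fin a => A.erase i) =
      (Fintype.piFinset fun _ : Fin a => A).filter fun d => ∀ k, d k ≠ i := by
  ext d
  simp only [Fintype.mem_piFinset, Finset.mem_erase, Finset.mem_filter]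
  exact ⟨fun h => ⟨fun k => (h k).2, fun k => (h k).1⟩, fun h k => ⟨h.2 k, h.1 k⟩⟩

theorem sum_seedsAvoiding (scheme : Resampling) (mtry : ℕ) (i : Fin n)
    (g : (Fin a → ℕ) → (Fin (2 * t) → Finset (Fin p)) → ℝ) :
    (∑ s ∈ seedsAvoiding scheme p n a t mtry i, g (fun k => (s.draw k : ℕ) + 1) s.feat) /
      ((seedFinset scheme p n a t mtry).card : ℝ) =
    ∑ d ∈ Fintype.piFinset fun _ : Fin a => (Finset.Icc 1 n).erase ((i : ℕ) + 1),
      drawWeight scheme n a (distinctCount d) *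
        ((∑ φ ∈ featSets p t mtry, g d φ) / ((featSets p t mtry).card : ℝ)) := by
  classical
  rw [piFinset_erase_eq_filter, Finset.sum_filter]
  have h := sum_allowedDraws_div_card (n := n) scheme fun d : Fin a → ℕ =>
    if ∀ k, d k ≠ (i : ℕ) + 1 then
      (∑ φ ∈ featSets p t mtry, g d φ) / ((featSets p t mtry).card : ℝ) else 0
  simp only [mul_ite, mul_zero] at h
  rw [← h, seedsAvoiding, Finset.sum_filter, sum_seedFinset, card_seedFinset,
    mul_comm ((allowedDraws scheme n a).card : ℝ), ← div_div,
    Finset.sum_div]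
  congr 1
  refine Finset.sum_congr rfl fun d _ => ?_
  have hiff : (∀ k, d k ≠ i) ↔ ∀ k, (d k : ℕ) + 1 ≠ (i : ℕ) + 1 :=
    forall_congr' fun k => by simp [Fin.ext_iff]
  by_cases hd : ∀ k, d k ≠ i
  · simp only [if_pos hd, if_pos (hiff.1 hd)]
  · simp only [if_neg hd, if_neg (mt hiff.2 hd), Finset.sum_const_zero, zero_div]

theorem card_seedsAvoiding (scheme : Resampling) {mtry : ℕ} (hmtry : mtry ≤ p) (han : a ≤ n)
    (i : Fin n) :
    ((seedsAvoiding scheme p n a t mtry i).card : ℝ) /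
      ((seedFinset scheme p n a t mtry).card : ℝ) = missProb scheme n a := by
  have h := sum_seedsAvoiding (p := p) (t := t) (a := a) scheme mtry i fun _ _ => (1 : ℝ)
  have hf : ((featSets p t mtry).card : ℝ) ≠ 0 :=
    Nat.cast_ne_zero.2 (featSets_nonempty hmtry).card_pos.ne'
  simp only [Finset.sum_const, nsmul_eq_mul, mul_one, div_self hf] at h
  have hi : (i : ℕ) < n := i.2
  rw [h, sum_drawWeight_erase scheme (by omega) han (by simp)
    (Finset.mem_Icc.2 ⟨by omega, by omega⟩)]

theorem card_seedFinset_pos (scheme : Resampling) {mtry : ℕ} (hmtry : mtry ≤ p) (han : a ≤ n) :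
    0 < (seedFinset scheme p n a t mtry).card := by
  have h1 : ((allowedDraws scheme n a).card : ℝ) ≠ 0 := by
    rw [card_allowedDraws]
    cases scheme
    · simp only [ne_eq, pow_eq_zero_iff', Nat.cast_eq_zero, not_and, not_not]
      omega
    · exact Nat.cast_ne_zero.2 (Nat.descFactorial_pos.2 han).ne'
  have h2 : ((featSets p t mtry).card : ℝ) ≠ 0 :=
    Nat.cast_ne_zero.2 (featSets_nonempty hmtry).card_pos.ne'
  have h3 : ((seedFinset scheme p n a t mtry).card : ℝ) ≠ 0 := by
    rw [card_seedFinset]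
    exact mul_ne_zero h1 h2
  exact Nat.pos_of_ne_zero (Nat.cast_ne_zero.1 h3)

theorem oobMean_eq (scheme : Resampling) {mtry : ℕ} (hmtry : mtry ≤ p) (han : a ≤ n)
    (tie : TieRule p a) (t : ℕ) (z : ℕ → (Fin p → ℝ) × ℝ) (i : Fin n) :
    oobMean scheme mtry tie t (fun i : Fin n => z (i + 1)) i =
      1 / missProb scheme n a *
        ∑ d ∈ Fintype.piFinset fun _ : Fin a => (Finset.Icc 1 n).erase ((i : ℕ) + 1),
          drawWeight scheme n a (distinctCount d) *
            meanTree tie t mtry (fun k => z (d k)) (z (i + 1)).1 := by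
  have h := sum_seedsAvoiding (n := n) scheme mtry i fun (d : Fin a → ℕ) φ =>
    Cart.predict tie t (fun k => z (d k)) φ (z (i + 1)).1
  have h0 : ((seedFinset scheme p n a t mtry).card : ℝ) ≠ 0 :=
    Nat.cast_ne_zero.2 (card_seedFinset_pos scheme hmtry han).ne'
  simp only [meanTree]
  rw [← h, ← card_seedsAvoiding (t := t) scheme hmtry han i, one_div_div, oobMean,
    div_mul_div_comm, mul_comm _ ((seedFinset scheme p n a t mtry).card : ℝ),
    mul_div_mul_left _ _ h0]
  rfl

/-- The empirical averages along `θ` converge to the averages over `T`. -/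
def IsGenericFor {S : Type*} (T : Finset S) (θ : ℕ → S) : Prop :=
  ∀ g : S → ℝ, Tendsto (fun M : ℕ => (∑ j ∈ Finset.range M, g (θ j)) / (M : ℝ)) atTop
    (𝓝 ((∑ s ∈ T, g s) / (T.card : ℝ)))

/-- The strong law is applied to the indicator of each of the finitely many seeds, and every `g` is
a linear combination of these. The exceptional null set thus does not depend on `g`, so the data and
the evaluation point may be random. -/
theorem ae_isGenericFor {Ω S : Type*} [MeasurableSpace Ω] {μ : Measure Ω} [IsProbabilityMeasure μ]
    [Fintype S] [MeasurableSpace S] [MeasurableSingletonClass S] [DecidableEq S]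
    {T : Finset S} {θ : ℕ → Ω → S} (hm : ∀ j, Measurable (θ j)) (hind : iIndepFun θ μ)
    (hlaw : ∀ j, μ.map (θ j) = uniformOn (T : Set S)) :
    ∀ᵐ ω ∂μ, IsGenericFor T fun j => θ j ω := by
  let F : S → ℕ → Ω → ℝ := fun s j ω => if θ j ω = s then 1 else 0
  have hFs : ∀ s, Measurable fun x : S => if x = s then (1 : ℝ) else 0 := fun s =>
    measurable_of_finite _
  have hmean : ∀ s, μ[F s 0] = if s ∈ T then 1 / (T.card : ℝ) else 0 := by
    intro s
    have h1 : μ[F s 0] = μ.real {ω | θ 0 ω = s} := by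
      have : F s 0 = {ω | θ 0 ω = s}.indicator 1 := by
        funext ω
        simp [F, Set.indicator_apply]
      rw [this]
      exact integral_indicator_one (hm 0 (measurableSet_singleton s))
    have h2 : μ {ω | θ 0 ω = s} = μ.map (θ 0) {s} := by
      rw [Measure.map_apply (hm 0) (measurableSet_singleton s)]
      rfl
    rw [h1, Measure.real, h2, hlaw 0, ← Finset.coe_singleton, uniformOn_apply_finset]
    by_cases hs : s ∈ T
    · simp [hs]
    · simp [hs]
  have hslln : ∀ s, ∀ᵐ ω ∂μ, Tendsto (fun M : ℕ => (∑ j ∈ Finset.range M, F s j ω) / (M : ℝ)) atTop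
      (𝓝 (if s ∈ T then 1 / (T.card : ℝ) else 0)) := by
    intro s
    rw [← hmean s]
    refine strong_law_ae_real (F s) ?_ ?_ ?_
    · refine Integrable.of_bound ((hFs s).comp (hm 0)).aestronglyMeasurable 1
        (Eventually.of_forall fun ω => ?_)
      simp only [F]
      split_ifs <;> simp
    · intro i j hij
      exact (hind.indepFun hij).comp (hFs s) (hFs s)
    · intro j
      have : IdentDistrib (θ j) (θ 0) μ μ :=
        ⟨(hm j).aemeasurable, (hm 0).aemeasurable, by rw [hlaw, hlaw]⟩
      exact this.comp (hFs s)
  filter_upwards [ae_all_iff.2 hslln] with ω hω g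
  have h1 := tendsto_finsetSum Finset.univ fun s _ => (hω s).const_mul (g s)
  have h2 : ∀ M : ℕ, ∑ s, g s * ((∑ j ∈ Finset.range M, F s j ω) / (M : ℝ)) =
      (∑ j ∈ Finset.range M, g (θ j ω)) / (M : ℝ) := by
    intro M
    simp only [mul_div_assoc', Finset.mul_sum]
    rw [← Finset.sum_div, Finset.sum_comm]
    congr 1
    refine Finset.sum_congr rfl fun j _ => ?_
    simp [F]
  have h3 : ∑ s, g s * (if s ∈ T then 1 / (T.card : ℝ) else 0) = (∑ s ∈ T, g s) / T.card := by
    simp only [mul_ite, mul_zero, mul_one_div]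
    rw [← Finset.sum_filter, Finset.filter_univ_mem, Finset.sum_div]
  simpa only [h2, h3] using h1

theorem IsGenericFor.tendsto_finite {scheme : Resampling} {mtry : ℕ} {θ : ℕ → TreeSeed p n a t}
    (hθ : IsGenericFor (seedFinset scheme p n a t mtry) θ) (tie : TieRule p a)
    (D : Fin n → (Fin p → ℝ) × ℝ) (x : Fin p → ℝ) :
    Tendsto (fun M => RandomForest.finite tie θ D M x) atTop
      (𝓝 (forestMean scheme mtry tie t D x)) :=
  hθ fun s => RandomForest.tree tie s D x

theorem IsGenericFor.infinite_eq {scheme : Resampling} {mtry : ℕ} {θ : ℕ → TreeSeed p n a t}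
    (hθ : IsGenericFor (seedFinset scheme p n a t mtry) θ) (tie : TieRule p a)
    (D : Fin n → (Fin p → ℝ) × ℝ) (x : Fin p → ℝ) :
    RandomForest.infinite tie θ D x = forestMean scheme mtry tie t D x :=
  (hθ.tendsto_finite tie D x).limUnder_eq

/-- An out-of-bag prediction is a ratio of two averages over all trees, and the limit of the
denominator is `missProb`, hence positive. -/
theorem IsGenericFor.tendsto_oob {scheme : Resampling} {mtry : ℕ} {θ : ℕ → TreeSeed p n a t}
    (hθ : IsGenericFor (seedFinset scheme p n a t mtry) θ) (hmtry : mtry ≤ p) (han : a ≤ n)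
    (hmiss : 0 < missProb scheme n a) (tie : TieRule p a)
    (D : Fin n → (Fin p → ℝ) × ℝ) (i : Fin n) :
    Tendsto (fun M => RandomForest.oob tie θ D M i) atTop
      (𝓝 (oobMean scheme mtry tie t D i)) := by
  classical
  have h0 : ((seedFinset scheme p n a t mtry).card : ℝ) ≠ 0 :=
    Nat.cast_ne_zero.2 (card_seedFinset_pos scheme hmtry han).ne'
  have h1 := hθ fun s => if ∀ k, s.draw k ≠ i then RandomForest.tree tie s D (D i).1 else 0
  have h2 := hθ fun s => if ∀ k, s.draw k ≠ i then (1 : ℝ) else 0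
  have hcard := card_seedsAvoiding (t := t) scheme hmtry han i
  rw [← hcard] at hmiss
  have hne : (∑ s ∈ seedFinset scheme p n a t mtry, if ∀ k, s.draw k ≠ i then (1 : ℝ) else 0) /
      ((seedFinset scheme p n a t mtry).card : ℝ) ≠ 0 := by
    rw [← Finset.sum_filter]
    simpa [seedsAvoiding] using hmiss.ne'
  have h3 := h1.div h2 hne
  have e : (∑ s ∈ seedFinset scheme p n a t mtry,
      if ∀ k, s.draw k ≠ i then RandomForest.tree tie s D (D i).1 else 0) /
      ((seedFinset scheme p n a t mtry).card : ℝ) /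
      ((∑ s ∈ seedFinset scheme p n a t mtry, if ∀ k, s.draw k ≠ i then (1 : ℝ) else 0) /
      ((seedFinset scheme p n a t mtry).card : ℝ)) = oobMean scheme mtry tie t D i := by
    rw [div_div_div_cancel_right₀ h0, ← Finset.sum_filter, ← Finset.sum_filter, oobMean]
    simp [seedsAvoiding]
  rw [e] at h3
  refine h3.congr' ?_
  filter_upwards [eventually_ge_atTop 1] with M hM
  have hM0 : (M : ℝ) ≠ 0 := Nat.cast_ne_zero.2 (by omega)
  simp only [Pi.div_apply]
  rw [div_div_div_cancel_right₀ hM0, ← Finset.sum_filter, ← Finset.sum_filter, RandomForest.oob]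
  simp [RandomForest.oobTrees]

theorem IsGenericFor.oobInfinite_eq {scheme : Resampling} {mtry : ℕ} {θ : ℕ → TreeSeed p n a t}
    (hθ : IsGenericFor (seedFinset scheme p n a t mtry) θ) (hmtry : mtry ≤ p) (han : a ≤ n)
    (hmiss : 0 < missProb scheme n a) (tie : TieRule p a)
    (D : Fin n → (Fin p → ℝ) × ℝ) (i : Fin n) :
    RandomForest.oobInfinite tie θ D i = oobMean scheme mtry tie t D i :=
  (hθ.tendsto_oob hmtry han hmiss tie D i).limUnder_eq

end Seeds

/-! ### Consistency of the out-of-bag predictions -/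

section Consistency

/-- Reindexing by an injection changes neither of the two product laws, and the sequences remain
independent of each other. -/
theorem IsContractable.of_iid {Ω S T E : Type*} [MeasurableSpace Ω] [MeasurableSpace S]
    [MeasurableSpace T] [MeasurableSpace E] {μ : Measure Ω} [IsProbabilityMeasure μ]
    {X : ℕ → Ω → S} {ε : ℕ → Ω → T} (hX : ∀ i, Measurable (X i)) (hε : ∀ i, Measurable (ε i))
    (hXi : iIndepFun X μ) (hεi : iIndepFun ε μ) (hXd : ∀ i, IdentDistrib (X i) (X 0) μ μ)
    (hεd : ∀ i, IdentDistrib (ε i) (ε 0) μ μ)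
    (hXε : IndepFun (fun ω i => X i ω) (fun ω i => ε i ω) μ) {G : S × T → E}
    (hG : Measurable G) :
    IsContractable (μ.map fun ω i => G (X i ω, ε i ω)) := by
  intro ρ hρ
  have hXm : Measurable fun ω i => X i ω := measurable_pi_lambda _ hX
  have hεm : Measurable fun ω i => ε i ω := measurable_pi_lambda _ hε
  have hρS : Measurable fun (x : ℕ → S) i => x (ρ i) :=
    measurable_pi_lambda _ fun i => measurable_pi_apply _
  have hρT : Measurable fun (x : ℕ → T) i => x (ρ i) :=
    measurable_pi_lambda _ fun i => measurable_pi_apply _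
  have hρE : Measurable fun (x : ℕ → E) i => x (ρ i) :=
    measurable_pi_lambda _ fun i => measurable_pi_apply _
  have hXρ : Measurable fun ω i => X (ρ i) ω := measurable_pi_lambda _ fun i => hX (ρ i)
  have hερ : Measurable fun ω i => ε (ρ i) ω := measurable_pi_lambda _ fun i => hε (ρ i)
  have hlawX : μ.map (fun ω i => X (ρ i) ω) = μ.map fun ω i => X i ω := by
    rw [hXi.map_fun_eq_infinitePi_map hX,
      (hXi.precomp hρ).map_fun_eq_infinitePi_map fun i => hX (ρ i)]
    congr 1
    funext i
    exact (hXd (ρ i)).map_eq.trans (hXd i).map_eq.symm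
  have hlawε : μ.map (fun ω i => ε (ρ i) ω) = μ.map fun ω i => ε i ω := by
    rw [hεi.map_fun_eq_infinitePi_map hε,
      (hεi.precomp hρ).map_fun_eq_infinitePi_map fun i => hε (ρ i)]
    congr 1
    funext i
    exact (hεd (ρ i)).map_eq.trans (hεd i).map_eq.symm
  have hjoint : μ.map (fun ω => ((fun i => X (ρ i) ω), fun i => ε (ρ i) ω)) =
      μ.map fun ω => ((fun i => X i ω), fun i => ε i ω) := by
    rw [(indepFun_iff_map_prod_eq_prod_map_map hXm.aemeasurable hεm.aemeasurable).1 hXε,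
      (indepFun_iff_map_prod_eq_prod_map_map hXρ.aemeasurable
        hερ.aemeasurable).1 (hXε.comp hρS hρT), hlawX, hlawε]
  have hGm : Measurable fun (q : (ℕ → S) × (ℕ → T)) i => G (q.1 i, q.2 i) :=
    measurable_pi_lambda _ fun i => hG.comp
      (((measurable_pi_apply i).comp measurable_fst).prodMk
        ((measurable_pi_apply i).comp measurable_snd))
  have h := congrArg (Measure.map fun (q : (ℕ → S) × (ℕ → T)) i => G (q.1 i, q.2 i)) hjoint
  rw [Measure.map_map hGm (hXρ.prodMk hερ),
    Measure.map_map hGm (hXm.prodMk hεm)] at h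
  refine ⟨hρE, ?_⟩
  have hζ : Measurable fun ω i => G (X i ω, ε i ω) := hGm.comp (hXm.prodMk hεm)
  rw [Measure.map_map hρE hζ]
  exact h

/-! ### Moment bounds for responses and transfer of the error to out-of-bag points -/

variable {p : ℕ} {ν : Measure (ℕ → (Fin p → ℝ) × ℝ)}

theorem IsContractable.integral_comp_perm {E : Type*} [MeasurableSpace E] {ν : Measure (ℕ → E)}
    (hν : IsContractable ν) {ρ : ℕ → ℕ} (hρ : Function.Injective ρ) {f : (ℕ → E) → ℝ}
    (hf : AEStronglyMeasurable f ν) : ∫ z, f (fun i => z (ρ i)) ∂ν = ∫ z, f z ∂ν := by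
  have hmp := hν ρ hρ
  have h := integral_map hmp.measurable.aemeasurable (f := f) (by rwa [hmp.map_eq])
  rw [hmp.map_eq] at h
  exact h.symm

theorem IsContractable.memLp_coord {E : Type*} [MeasurableSpace E] {ν : Measure (ℕ → E)}
    (hν : IsContractable ν) {f : E → ℝ} (hf : MemLp (fun z : ℕ → E => f (z 0)) 2 ν) (i : ℕ) :
    MemLp (fun z : ℕ → E => f (z i)) 2 ν := by
  have h := hf.comp_measurePreserving (hν (fun k => k + i) (add_left_injective i))
  simpa [Function.comp_def] using h

theorem memLp_two_of_abs_le {Ω : Type*} [MeasurableSpace Ω] {ν : Measure Ω} {f g : Ω → ℝ}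
    (hg : MemLp g 2 ν) (hf : AEStronglyMeasurable f ν) (h : ∀ z, |f z| ≤ g z) : MemLp f 2 ν :=
  hg.mono hf (Eventually.of_forall fun z => (h z).trans (le_abs_self _))

/-- A bound for the first `n` responses, all of them at most `r` except for the square root. -/
def responseBound (r : ℝ) (n : ℕ) (z : ℕ → (Fin p → ℝ) × ℝ) : ℝ :=
  r + √(∑ i ∈ Finset.Icc 1 n, {y : ℝ | r < |y|}.indicator (fun y => y ^ 2) (z i).2)

theorem measurable_indicator_sq (r : ℝ) :
    Measurable ({y : ℝ | r < |y|}.indicator fun y => y ^ 2) :=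
  (measurable_id.pow_const 2).indicator (measurableSet_lt measurable_const measurable_norm)

theorem indicator_sq_nonneg (r y : ℝ) : 0 ≤ {y : ℝ | r < |y|}.indicator (fun y => y ^ 2) y :=
  Set.indicator_nonneg (fun y _ => sq_nonneg y) y

theorem abs_le_responseBound {r : ℝ} (hr : 0 ≤ r) {n : ℕ} (z : ℕ → (Fin p → ℝ) × ℝ) {i : ℕ}
    (hi : i ∈ Finset.Icc 1 n) : |(z i).2| ≤ responseBound r n z := by
  rw [responseBound]
  by_cases h : r < |(z i).2|
  · have h1 : |(z i).2| ^ 2 ≤ ∑ i ∈ Finset.Icc 1 n,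
        {y : ℝ | r < |y|}.indicator (fun y => y ^ 2) (z i).2 := by
      refine le_trans (le_of_eq ?_) (Finset.single_le_sum (f := fun i =>
        {y : ℝ | r < |y|}.indicator (fun y => y ^ 2) (z i).2)
        (fun j _ => indicator_sq_nonneg r _) hi)
      rw [sq_abs]
      exact (Set.indicator_of_mem (s := {y : ℝ | r < |y|}) h fun y => y ^ 2).symm
    have := Real.le_sqrt_of_sq_le h1
    linarith
  · have := Real.sqrt_nonneg (∑ i ∈ Finset.Icc 1 n,
      {y : ℝ | r < |y|}.indicator (fun y => y ^ 2) (z i).2)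
    linarith

theorem IsContractable.integrable_indicator_sq (hν : IsContractable ν)
    (hY : MemLp (fun z : ℕ → (Fin p → ℝ) × ℝ => (z 0).2) 2 ν) (r : ℝ) (i : ℕ) :
    Integrable (fun z : ℕ → (Fin p → ℝ) × ℝ =>
      {y : ℝ | r < |y|}.indicator (fun y => y ^ 2) (z i).2) ν := by
  refine (hν.memLp_coord (f := fun e => e.2) hY i).integrable_sq.mono
    ((measurable_indicator_sq r).comp (by fun_prop)).aestronglyMeasurable
    (Eventually.of_forall fun z => ?_)
  rw [Real.norm_of_nonneg (indicator_sq_nonneg r _), Real.norm_of_nonneg (sq_nonneg _)]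
  exact Set.indicator_le_self' (fun _ _ => sq_nonneg _) _

theorem IsContractable.memLp_responseBound [IsProbabilityMeasure ν] (hν : IsContractable ν)
    (hY : MemLp (fun z : ℕ → (Fin p → ℝ) × ℝ => (z 0).2) 2 ν) (r : ℝ) (n : ℕ) :
    MemLp (fun z => responseBound r n z) 2 ν := by
  refine (memLp_const r).add ?_
  have hm : Measurable fun z : ℕ → (Fin p → ℝ) × ℝ => ∑ i ∈ Finset.Icc 1 n,
      {y : ℝ | r < |y|}.indicator (fun y => y ^ 2) (z i).2 :=
    Finset.measurable_fun_sum _ fun i _ => (measurable_indicator_sq r).comp (by fun_prop)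
  rw [memLp_two_iff_integrable_sq hm.sqrt.aestronglyMeasurable]
  have : ∀ z : ℕ → (Fin p → ℝ) × ℝ, √(∑ i ∈ Finset.Icc 1 n,
      {y : ℝ | r < |y|}.indicator (fun y => y ^ 2) (z i).2) ^ 2 = ∑ i ∈ Finset.Icc 1 n,
      {y : ℝ | r < |y|}.indicator (fun y => y ^ 2) (z i).2 := fun z =>
    Real.sq_sqrt (Finset.sum_nonneg fun i _ => indicator_sq_nonneg r _)
  simp only [this]
  exact integrable_finsetSum _ fun i _ => hν.integrable_indicator_sq hY r i

theorem IsContractable.integral_sq_responseBound_add_le [IsProbabilityMeasure ν]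
    (hν : IsContractable ν) (hY : MemLp (fun z : ℕ → (Fin p → ℝ) × ℝ => (z 0).2) 2 ν)
    {h : (ℕ → (Fin p → ℝ) × ℝ) → ℝ} (hh : MemLp h 2 ν) (r : ℝ) (n : ℕ) :
    ∫ z, (responseBound r n z + |h z|) ^ 2 ∂ν ≤
      3 * (r ^ 2 + n * (∫ z, {y : ℝ | r < |y|}.indicator (fun y => y ^ 2) (z 0).2 ∂ν) +
        ∫ z, h z ^ 2 ∂ν) := by
  have hi := fun i => hν.integrable_indicator_sq hY r i
  have hsum : Integrable (fun z : ℕ → (Fin p → ℝ) × ℝ => ∑ i ∈ Finset.Icc 1 n,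
      {y : ℝ | r < |y|}.indicator (fun y => y ^ 2) (z i).2) ν := integrable_finsetSum _ fun i _ => hi i
  have heq : ∀ i, ∫ z, {y : ℝ | r < |y|}.indicator (fun y => y ^ 2) (z i).2 ∂ν =
      ∫ z, {y : ℝ | r < |y|}.indicator (fun y => y ^ 2) (z 0).2 ∂ν := fun i => by
    have := hν.integral_comp_perm (add_left_injective i) (hi 0).1
    simpa using this
  have hrhs : ∫ z, 3 * (r ^ 2 + (∑ i ∈ Finset.Icc 1 n,
      {y : ℝ | r < |y|}.indicator (fun y => y ^ 2) (z i).2) + h z ^ 2) ∂ν =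
      3 * (r ^ 2 + n * (∫ z, {y : ℝ | r < |y|}.indicator (fun y => y ^ 2) (z 0).2 ∂ν) +
        ∫ z, h z ^ 2 ∂ν) := by
    have hsum' : Integrable (fun z : ℕ → (Fin p → ℝ) × ℝ => r ^ 2 + ∑ i ∈ Finset.Icc 1 n,
      {y : ℝ | r < |y|}.indicator (fun y => y ^ 2) (z i).2) ν := (integrable_const _).add hsum
    rw [integral_const_mul, integral_add hsum' hh.integrable_sq, integral_add (integrable_const _) hsum, integral_finsetSum _ fun i _ => hi i]
    simp [heq]
  rw [← hrhs]
  refine integral_mono ((hν.memLp_responseBound hY r n).add hh.abs).integrable_sq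
    ((((integrable_const _).add hsum).add hh.integrable_sq).const_mul _) fun z => ?_
  have hs := Real.sq_sqrt (Finset.sum_nonneg fun i (_ : i ∈ Finset.Icc 1 n) =>
    indicator_sq_nonneg r (z i).2)
  simp only [responseBound]
  set s := √(∑ i ∈ Finset.Icc 1 n, {y : ℝ | r < |y|}.indicator (fun y => y ^ 2) (z i).2)
  rw [← hs, ← sq_abs (h z)]
  nlinarith [sq_nonneg (r - s), sq_nonneg (r - |h z|), sq_nonneg (s - |h z|)]

theorem tendsto_integral_indicator_sq [IsProbabilityMeasure ν]
    (hY : MemLp (fun z : ℕ → (Fin p → ℝ) × ℝ => (z 0).2) 2 ν) :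
    Tendsto (fun r : ℝ => ∫ z, {y : ℝ | r < |y|}.indicator (fun y => y ^ 2) (z 0).2 ∂ν) atTop
      (𝓝 0) := by
  have h := tendsto_integral_filter_of_dominated_convergence (μ := ν) (l := atTop)
    (F := fun (r : ℝ) (z : ℕ → (Fin p → ℝ) × ℝ) =>
      {y : ℝ | r < |y|}.indicator (fun y => y ^ 2) (z 0).2) (f := fun _ => 0)
    (fun z => (z 0).2 ^ 2) (Eventually.of_forall fun r =>
      ((measurable_indicator_sq r).comp (by fun_prop)).aestronglyMeasurable)
    (Eventually.of_forall fun r => Eventually.of_forall fun z => ?_) hY.integrable_sq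
    (Eventually.of_forall fun z => ?_)
  · simpa using h
  · rw [Real.norm_of_nonneg (indicator_sq_nonneg r _)]
    exact Set.indicator_le_self' (fun _ _ => sq_nonneg _) _
  · refine tendsto_const_nhds.congr' ?_
    filter_upwards [eventually_ge_atTop |(z 0).2|] with r hr
    exact (Set.indicator_of_notMem (s := {y : ℝ | r < |y|}) (not_lt.2 hr) _).symm

/-- The level `r = n ^ (1/4)` tends to infinity, so the truncated second moment of a response
vanishes, yet `r ^ 2 / n = n ^ (-1/2)` vanishes as well. -/
theorem IsContractable.tendsto_integral_sq_responseBound [IsProbabilityMeasure ν]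
    (hν : IsContractable ν) (hY : MemLp (fun z : ℕ → (Fin p → ℝ) × ℝ => (z 0).2) 2 ν)
    {h : (ℕ → (Fin p → ℝ) × ℝ) → ℝ} (hh : MemLp h 2 ν) :
    Tendsto (fun n : ℕ => (∫ z, (responseBound (√√(n : ℝ)) n z + |h z|) ^ 2 ∂ν) / (n : ℝ)) atTop
      (𝓝 0) := by
  set J : ℝ → ℝ := fun r => ∫ z, {y : ℝ | r < |y|}.indicator (fun y => y ^ 2) (z 0).2 ∂ν with hJ
  have hsq : Tendsto (fun n : ℕ => √(n : ℝ)) atTop atTop :=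
    Real.tendsto_sqrt_atTop.comp tendsto_natCast_atTop_atTop
  have h1 : Tendsto (fun n : ℕ => J (√√(n : ℝ))) atTop (𝓝 0) :=
    (tendsto_integral_indicator_sq hY).comp (Real.tendsto_sqrt_atTop.comp hsq)
  have h2 : Tendsto (fun n : ℕ => (√(n : ℝ))⁻¹) atTop (𝓝 0) := tendsto_inv_atTop_zero.comp hsq
  have h3 : Tendsto (fun n : ℕ => (∫ z, h z ^ 2 ∂ν) / (n : ℝ)) atTop (𝓝 0) :=
    tendsto_const_div_atTop_nhds_zero_nat _
  have h4 := ((h2.add h1).add h3).const_mul 3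
  rw [add_zero, add_zero, mul_zero] at h4
  refine squeeze_zero' (Eventually.of_forall fun n => div_nonneg
    (integral_nonneg fun z => sq_nonneg _) (Nat.cast_nonneg n)) ?_ h4
  filter_upwards [eventually_ge_atTop 1] with n hn
  have hn0 : (0 : ℝ) < n := Nat.cast_pos.2 (by omega)
  rw [div_le_iff₀ hn0]
  refine (hν.integral_sq_responseBound_add_le hY hh _ n).trans (le_of_eq ?_)
  have hs := Real.sq_sqrt hn0.le
  have hs0 : √(n : ℝ) ≠ 0 := (Real.sqrt_pos.2 hn0).ne'
  rw [Real.sq_sqrt (Real.sqrt_nonneg _)]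
  have e : √(n : ℝ) = (√(n : ℝ))⁻¹ * n := by
    nth_rewrite 3 [← hs]
    field_simp
  have e' : (∫ z, h z ^ 2 ∂ν) = (∫ z, h z ^ 2 ∂ν) / n * n := by field_simp
  nth_rewrite 1 [e, e']
  ring

/-- The error at `e` of the mean tree grown on `y`. -/
def treeError {a : ℕ} (m : (Fin p → ℝ) → ℝ) (tie : TieRule p a) (t mtry : ℕ)
    (y : Fin a → (Fin p → ℝ) × ℝ) (e : (Fin p → ℝ) × ℝ) : ℝ :=
  meanTree tie t mtry y e.1 - m e.1

theorem measurable_treeError {a : ℕ} {m : (Fin p → ℝ) → ℝ} (hm : Measurable m) (tie : TieRule p a)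
    (t mtry : ℕ) (d : Fin a → ℕ) (j : ℕ) : Measurable fun z : ℕ → (Fin p → ℝ) × ℝ =>
      treeError m tie t mtry (fun k => z (d k)) (z j) := by
  have h1 : Measurable fun z : ℕ → (Fin p → ℝ) × ℝ => ((fun k => z (d k)), (z j).1) := by fun_prop
  have h2 : Measurable fun z : ℕ → (Fin p → ℝ) × ℝ => (z j).1 := by fun_prop
  exact ((measurable_meanTree tie t mtry).comp h1).sub (hm.comp h2)

theorem abs_treeError_le {a : ℕ} (m : (Fin p → ℝ) → ℝ) (tie : TieRule p a) (t mtry : ℕ)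
    {y : Fin a → (Fin p → ℝ) × ℝ} (e : (Fin p → ℝ) × ℝ) {B : ℝ} (hB : 0 ≤ B)
    (h : ∀ k, |(y k).2| ≤ B) : |treeError m tie t mtry y e| ≤ B + |m e.1| :=
  (abs_sub _ _).trans (add_le_add (abs_meanTree_le _ _ _ _ hB h) le_rfl)

theorem IsContractable.memLp_treeError {a : ℕ} (hν : IsContractable ν)
    {m : (Fin p → ℝ) → ℝ} (hm : Measurable m)
    (hmL : MemLp (fun z : ℕ → (Fin p → ℝ) × ℝ => m (z 0).1) 2 ν)
    (hY : MemLp (fun z : ℕ → (Fin p → ℝ) × ℝ => (z 0).2) 2 ν)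
    (tie : TieRule p a) (t mtry : ℕ) (d : Fin a → ℕ) :
    MemLp (fun z : ℕ → (Fin p → ℝ) × ℝ => treeError m tie t mtry (fun k => z (d k)) (z 0)) 2 ν := by
  have hg : MemLp (fun z : ℕ → (Fin p → ℝ) × ℝ => ∑ k, |(z (d k)).2| + |m (z 0).1|) 2 ν :=
    (memLp_finsetSum _ fun k _ => (hν.memLp_coord (f := fun e => e.2) hY (d k)).abs).add hmL.abs
  refine memLp_two_of_abs_le hg (measurable_treeError hm tie t mtry d 0).aestronglyMeasurable
    fun z => ?_
  exact abs_treeError_le _ _ _ _ _ (Finset.sum_nonneg fun k _ => abs_nonneg _) fun k =>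
    Finset.single_le_sum (f := fun k => |(z (d k)).2|) (fun k _ => abs_nonneg _)
      (Finset.mem_univ k)

/-- Exchanging the indices `0` and `i + 1` preserves the law. The remaining draws contain neither
index, so only the evaluation point moves. -/
theorem IsContractable.integral_sq_oobMean_error (hν : IsContractable ν)
    {m : (Fin p → ℝ) → ℝ} (hm : Measurable m) (scheme : Resampling) {mtry : ℕ} (hmtry : mtry ≤ p)
    {n a : ℕ} (hn : 1 ≤ n) (han : a ≤ n) (hmiss : missProb scheme n a ≠ 0) (tie : TieRule p a)
    (t : ℕ) (i : Fin n) :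
    ∫ z, (oobMean scheme mtry tie t (fun i : Fin n => z (i + 1)) i - m (z (i + 1)).1) ^ 2 ∂ν =
    ∫ z, (1 / missProb scheme n a *
      ∑ d ∈ Fintype.piFinset fun _ : Fin a => (Finset.Icc 1 n).erase ((i : ℕ) + 1),
        drawWeight scheme n a (distinctCount d) *
          treeError m tie t mtry (fun k => z (d k)) (z 0)) ^ 2 ∂ν := by
  have hi : (i : ℕ) + 1 ∈ Finset.Icc 1 n := Finset.mem_Icc.2 ⟨by omega, i.2⟩
  have hmeas : Measurable fun z : ℕ → (Fin p → ℝ) × ℝ => (1 / missProb scheme n a *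
      ∑ d ∈ Fintype.piFinset fun _ : Fin a => (Finset.Icc 1 n).erase ((i : ℕ) + 1),
        drawWeight scheme n a (distinctCount d) *
          treeError m tie t mtry (fun k => z (d k)) (z 0)) ^ 2 :=
    ((Finset.measurable_fun_sum _ fun d _ =>
      (measurable_treeError hm tie t mtry d 0).const_mul _).const_mul _).pow_const 2
  rw [← hν.integral_comp_perm (Equiv.swap 0 ((i : ℕ) + 1)).injective hmeas.aestronglyMeasurable]
  refine integral_congr_ae (Eventually.of_forall fun z => ?_)
  simp only [Equiv.swap_apply_left]
  congr 1
  rw [oobMean_eq scheme hmtry han]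
  have hΦ : ∀ d ∈ Fintype.piFinset fun _ : Fin a => (Finset.Icc 1 n).erase ((i : ℕ) + 1),
      drawWeight scheme n a (distinctCount d) *
        treeError m tie t mtry (fun k => z (Equiv.swap 0 ((i : ℕ) + 1) (d k))) (z (i + 1)) =
      drawWeight scheme n a (distinctCount d) *
        meanTree tie t mtry (fun k => z (d k)) (z (i + 1)).1 -
      drawWeight scheme n a (distinctCount d) * m (z (i + 1)).1 := by
    intro d hd
    have : ∀ k, Equiv.swap 0 ((i : ℕ) + 1) (d k) = d k := by
      intro k
      have hk := Finset.mem_erase.1 (Fintype.mem_piFinset.1 hd k)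
      have hk1 := (Finset.mem_Icc.1 hk.2).1
      exact Equiv.swap_apply_of_ne_of_ne (by omega) hk.1
    simp only [this, treeError, mul_sub]
  -- The weights of the draws that avoid `i + 1` sum to `missProb`, so after normalization exactly
  -- one copy of `m` is subtracted.
  rw [Finset.sum_congr rfl hΦ, Finset.sum_sub_distrib, ← Finset.sum_mul,
    sum_drawWeight_erase scheme hn han (by simp) hi, mul_sub, ← mul_assoc,
    one_div_mul_cancel hmiss, one_mul]

theorem sum_Icc_one_eq_sum_fin (n : ℕ) (g : ℕ → ℝ) :
    ∑ i ∈ Finset.Icc 1 n, g i = ∑ i : Fin n, g ((i : ℕ) + 1) := by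
  rw [Fin.sum_univ_eq_sum_range fun i => g (i + 1), Finset.range_eq_Ico, Finset.sum_Ico_add']
  rfl

theorem IsContractable.oobMean_error_le [IsProbabilityMeasure ν] (hν : IsContractable ν)
    {m : (Fin p → ℝ) → ℝ} (hm : Measurable m)
    (hmL : MemLp (fun z : ℕ → (Fin p → ℝ) × ℝ => m (z 0).1) 2 ν)
    (hY : MemLp (fun z : ℕ → (Fin p → ℝ) × ℝ => (z 0).2) 2 ν)
    (scheme : Resampling) {mtry : ℕ} (hmtry : mtry ≤ p) {n a : ℕ} (hn : 1 ≤ n) (han : a ≤ n)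
    {c : ℝ} (hc : 0 < c) (hcq : c ≤ missProb scheme n a) (tie : TieRule p a) (t : ℕ) {r : ℝ}
    (hr : 0 ≤ r) :
    1 / (n : ℝ) * ∑ i : Fin n, ∫ z, (oobMean scheme mtry tie t
      (fun i : Fin n => z (i + 1)) i - m (z (i + 1)).1) ^ 2 ∂ν ≤
    16 / c ^ 2 * ∫ z, (forestMean scheme mtry tie t
      (fun i : Fin n => z (i + 1)) (z 0).1 - m (z 0).1) ^ 2 ∂ν +
    72 / c ^ 4 * ((∫ z, (responseBound r n z + |m (z 0).1|) ^ 2 ∂ν) / n) := by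
  have hcard : (Finset.Icc 1 n).card = n := by simp
  have hB : MemLp (fun z => responseBound r n z + |m (z 0).1|) 2 ν :=
    (hν.memLp_responseBound hY _ n).add hmL.abs
  have hmain := hν.sum_integral_sq_outOfBag_le (hν.memLp_treeError hm hmL hY tie t mtry)
    (u := drawWeight scheme n a) (drawWeight_nonneg scheme n a) (A := Finset.Icc 1 n) (by simp)
    (by simpa using hn) (sum_drawWeight scheme hn han hcard) hc hcq
    (fun i hi => sum_drawWeight_erase scheme hn han hcard hi)
    (by rw [hcard]; exact sum_drawWeight_mul_sq scheme hn han hcard) hB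
    (fun d hd z => abs_treeError_le _ _ _ _ _ (add_nonneg hr (Real.sqrt_nonneg _)) fun k =>
      abs_le_responseBound hr z (Fintype.mem_piFinset.1 hd k))
  rw [hcard, sum_Icc_one_eq_sum_fin] at hmain
  have hf : ∀ z : ℕ → (Fin p → ℝ) × ℝ, ∑ d ∈ Fintype.piFinset fun _ : Fin a => Finset.Icc 1 n,
      drawWeight scheme n a (distinctCount d) * treeError m tie t mtry (fun k => z (d k)) (z 0) =
      forestMean scheme mtry tie t (fun i : Fin n => z (i + 1)) (z 0).1 - m (z 0).1 := by
    intro z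
    rw [forestMean_eq]
    simp only [treeError, mul_sub, Finset.sum_sub_distrib]
    rw [← Finset.sum_mul, sum_drawWeight scheme hn han hcard, one_mul]
  simp only [hf] at hmain
  simp only [hν.integral_sq_oobMean_error hm scheme hmtry hn han (hc.trans_le hcq).ne' tie t]
  exact hmain

theorem IsContractable.tendsto_oobMean_error [IsProbabilityMeasure ν] (hν : IsContractable ν)
    {m : (Fin p → ℝ) → ℝ} (hm : Measurable m)
    (hmL : MemLp (fun z : ℕ → (Fin p → ℝ) × ℝ => m (z 0).1) 2 ν)
    (hY : MemLp (fun z : ℕ → (Fin p → ℝ) × ℝ => (z 0).2) 2 ν)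
    (scheme : Resampling) {mtry : ℕ} (hmtry : mtry ≤ p) {a t : ℕ → ℕ} (han : ∀ n, a n ≤ n)
    {c : ℝ} (hc : 0 < c) (hmiss : ∀ᶠ n : ℕ in atTop, c ≤ missProb scheme n (a n))
    (tie : (n : ℕ) → TieRule p (a n))
    (hcons : Tendsto (fun n : ℕ => ∫ z, (forestMean scheme mtry (tie n) (t n)
      (fun i : Fin n => z (i + 1)) (z 0).1 - m (z 0).1) ^ 2 ∂ν) atTop (𝓝 0)) :
    Tendsto (fun n : ℕ => 1 / (n : ℝ) * ∑ i : Fin n, ∫ z, (oobMean scheme mtry (tie n) (t n)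
      (fun i : Fin n => z (i + 1)) i - m (z (i + 1)).1) ^ 2 ∂ν) atTop (𝓝 0) := by
  have hlim := (hcons.const_mul (16 / c ^ 2)).add
    ((hν.tendsto_integral_sq_responseBound hY hmL).const_mul (72 / c ^ 4))
  rw [mul_zero, mul_zero, add_zero] at hlim
  refine squeeze_zero' (Eventually.of_forall fun n => mul_nonneg (by positivity)
    (Finset.sum_nonneg fun i _ => integral_nonneg fun z => sq_nonneg _)) ?_ hlim
  filter_upwards [hmiss, eventually_ge_atTop 1] with n hcq hn
  exact hν.oobMean_error_le hm hmL hY scheme hmtry hn (han n) hc hcq (tie n) (t n)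
    (Real.sqrt_nonneg _)

end Consistency

/-! ### Limits of coverage probabilities -/

section Coverage

variable {Ω : Type*} [MeasurableSpace Ω] {μ : Measure Ω}

/-- Off the null set where `g = 0`, the indicator of `f n ≤ 0` is eventually equal to that of `g ≤
0`. -/
theorem tendsto_measureReal_setOf_nonpos [IsProbabilityMeasure μ] {f : ℕ → Ω → ℝ} {g : Ω → ℝ}
    (hf : ∀ n, Measurable (f n)) (hg : Measurable g)
    (hlim : ∀ᵐ ω ∂μ, Tendsto (fun n => f n ω) atTop (𝓝 (g ω))) (h0 : ∀ᵐ ω ∂μ, g ω ≠ 0) :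
    Tendsto (fun n => μ.real {ω | f n ω ≤ 0}) atTop (𝓝 (μ.real {ω | g ω ≤ 0})) := by
  refine (ENNReal.tendsto_toReal (measure_ne_top μ _)).comp
    (tendsto_measure_of_ae_tendsto_indicator_of_isFiniteMeasure atTop
      (measurableSet_le hg measurable_const) (fun n => measurableSet_le (hf n) measurable_const) ?_)
  filter_upwards [hlim, h0] with ω hω hne
  rcases lt_or_gt_of_ne hne with hlt | hgt
  · filter_upwards [hω.eventually_lt_const hlt] with n hn
    exact ⟨fun _ => hlt.le, fun _ => hn.le⟩
  · filter_upwards [hω.eventually_const_lt hgt] with n hn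
    exact ⟨fun h => absurd h (not_le.2 hn), fun h => absurd h (not_le.2 hgt)⟩

/-- By Fubini: for each fixed value of `g`, the event asks `f` to hit a single point. -/
theorem measure_eq_comp_of_indepFun [IsProbabilityMeasure μ] {S : Type*} [MeasurableSpace S]
    {f : Ω → ℝ} {g : Ω → S} (hf : Measurable f) (hg : Measurable g) (hfg : IndepFun f g μ)
    (hatom : ∀ x, μ.map f {x} = 0) {h : S → ℝ} (hh : Measurable h) :
    ∀ᵐ ω ∂μ, f ω ≠ h (g ω) := by
  have hset : MeasurableSet {q : S × ℝ | q.2 = h q.1} :=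
    measurableSet_eq_fun measurable_snd (hh.comp measurable_fst)
  have hprod := (indepFun_iff_map_prod_eq_prod_map_map hg.aemeasurable hf.aemeasurable).1 hfg.symm
  have h1 : μ.map (fun ω => (g ω, f ω)) {q : S × ℝ | q.2 = h q.1} = 0 := by
    have := Measure.isFiniteMeasure_map μ f
    have := Measure.isFiniteMeasure_map μ g
    rw [hprod, Measure.measure_prod_null hset]
    refine Eventually.of_forall fun x => ?_
    exact hatom (h x)
  rw [Measure.map_apply (hg.prodMk hf) hset] at h1
  rw [ae_iff]
  simpa using h1

theorem indepFun_prodMk_of_indepFun {S T U : Type*} [MeasurableSpace S] [MeasurableSpace T]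
    [MeasurableSpace U] [IsProbabilityMeasure μ] {f : Ω → S} {g : Ω → T} {h : Ω → U}
    (hf : Measurable f) (hg : Measurable g) (hh : Measurable h) (hfg : IndepFun f g μ)
    (hfgh : IndepFun (fun ω => (f ω, g ω)) h μ) : IndepFun f (fun ω => (g ω, h ω)) μ := by
  have := Measure.isFiniteMeasure_map μ f
  have := Measure.isFiniteMeasure_map μ g
  have := Measure.isFiniteMeasure_map μ h
  have h1 := (indepFun_iff_map_prod_eq_prod_map_map (hf.prodMk hg).aemeasurable
    hh.aemeasurable).1 hfgh
  have h2 := (indepFun_iff_map_prod_eq_prod_map_map hf.aemeasurable hg.aemeasurable).1 hfg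
  have h3 := (indepFun_iff_map_prod_eq_prod_map_map hg.aemeasurable hh.aemeasurable).1
    (hfgh.comp measurable_snd measurable_id)
  rw [indepFun_iff_map_prod_eq_prod_map_map hf.aemeasurable (hg.prodMk hh).aemeasurable, h3,
    ← Measure.prodAssoc_prod, ← h2, ← h1, Measure.map_map MeasurableEquiv.prodAssoc.measurable
      ((hf.prodMk hg).prodMk hh)]
  rfl

theorem continuous_cdf_of_null {P : Measure ℝ} [IsProbabilityMeasure P] (hP : ∀ x, P {x} = 0) :
    Continuous (cdf P) := by
  refine continuous_iff_continuousAt.2 fun x => ?_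
  have h : Tendsto (fun y => P (Set.Iic y)) (𝓝 x) (𝓝 (P (Set.Iic x))) := by
    refine tendsto_measure_of_ae_tendsto_indicator_of_isFiniteMeasure _ measurableSet_Iic
      (fun _ => measurableSet_Iic) ?_
    have hne : ∀ᵐ w ∂P, w ≠ x := by
      rw [ae_iff]
      simpa using hP x
    filter_upwards [hne] with w hw
    rcases lt_or_gt_of_ne hw with hlt | hgt
    · filter_upwards [lt_mem_nhds hlt] with y hy
      exact ⟨fun _ => hlt.le, fun _ => hy.le⟩
    · filter_upwards [gt_mem_nhds hgt] with y hy
      exact ⟨fun h => absurd h (not_le.2 hy), fun h => absurd h (not_le.2 hgt)⟩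
  have h2 := (ENNReal.tendsto_toReal (measure_ne_top P (Set.Iic x))).comp h
  refine (tendsto_congr fun y => ?_).1 h2 |>.trans (le_of_eq ?_)
  · exact (cdf_eq_real P y).symm
  · rw [cdf_eq_real]
    rfl

theorem gaussianReal_singleton {v : NNReal} (hv : v ≠ 0) (x : ℝ) : gaussianReal 0 v {x} = 0 := by
  have := nullSingletonClass_gaussianReal (μ := 0) hv
  exact measure_singleton x

theorem cdf_stdNormalQuantile {u : ℝ} (h0 : 0 < u) (h1 : u < 1) :
    cdf (gaussianReal 0 1) (stdNormalQuantile u) = u := by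
  set F := cdf (gaussianReal 0 1) with hF
  have hcont : Continuous F := continuous_cdf_of_null fun x => gaussianReal_singleton one_ne_zero x
  have hne : {x : ℝ | u ≤ F x}.Nonempty :=
    ((tendsto_cdf_atTop (gaussianReal 0 1)).eventually_const_le h1).exists
  obtain ⟨b, hb⟩ := ((tendsto_cdf_atBot (gaussianReal 0 1)).eventually_lt_const h0).exists
  have hbdd : BddBelow {x : ℝ | u ≤ F x} := by
    refine ⟨b, fun x hx => le_of_not_gt fun hlt => ?_⟩
    have h2 := (monotone_cdf (gaussianReal 0 1)) hlt.le
    have hx' : u ≤ F x := hx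
    linarith
  have hclosed : IsClosed {x : ℝ | u ≤ F x} := isClosed_le continuous_const hcont
  refine le_antisymm ?_ (hclosed.csInf_mem hne hbdd)
  refine le_of_tendsto (hcont.continuousWithinAt (s := Set.Iio (stdNormalQuantile u))
    (x := stdNormalQuantile u)).tendsto ?_
  filter_upwards [self_mem_nhdsWithin] with y hy
  exact le_of_not_ge fun h => absurd (csInf_le hbdd h) (not_le.2 hy)

/-- By symmetry both tails beyond the quantile have mass `1 - u`. A negative quantile would make the
lower tail `u` at most `1 - u`. -/
theorem stdNormalQuantile_nonneg {u : ℝ} (h0 : 1 / 2 < u) (h1 : u < 1) :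
    0 ≤ stdNormalQuantile u ∧
      (gaussianReal 0 1).real (Set.Icc (-stdNormalQuantile u) (stdNormalQuantile u)) =
        2 * u - 1 := by
  set P := gaussianReal 0 1 with hP
  set z := stdNormalQuantile u with hz
  have hatom : ∀ x, P {x} = 0 := fun x => gaussianReal_singleton one_ne_zero x
  have hcdf : P.real (Set.Iic z) = u := by
    rw [← cdf_eq_real]
    exact cdf_stdNormalQuantile (by linarith) h1
  have hsymm : P.real (Set.Iio (-z)) = P.real (Set.Ioi z) := by
    have hmap : P.map (fun x => -x) = P := by
      have := gaussianReal_map_neg (μ := 0) (v := 1)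
      rwa [neg_zero] at this
    rw [Measure.real, Measure.real]
    nth_rewrite 1 [← hmap]
    rw [Measure.map_apply measurable_neg measurableSet_Iio]
    congr 2
    ext x
    simp
  have hcompl : P.real (Set.Ioi z) = 1 - u := by
    rw [← Set.compl_Iic, measureReal_compl measurableSet_Iic, hcdf]
    simp
  have hz0 : 0 ≤ z := by
    by_contra hneg
    push Not at hneg
    have : P.real (Set.Iic z) ≤ P.real (Set.Iio (-z)) :=
      measureReal_mono fun x hx => lt_of_le_of_lt (Set.mem_Iic.1 hx) (by linarith)
    rw [hsymm, hcompl, hcdf] at this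
    linarith
  refine ⟨hz0, ?_⟩
  have hunion : Set.Iic z = Set.Iio (-z) ∪ Set.Icc (-z) z :=
    (Set.Iio_union_Icc_eq_Iic (by linarith)).symm
  have hdisj : Disjoint (Set.Iio (-z)) (Set.Icc (-z) z) := by
    rw [Set.disjoint_left]
    intro x hx hx'
    exact absurd hx (not_lt.2 hx'.1)
  have := measureReal_union (μ := P) hdisj measurableSet_Icc
  rw [← hunion, hcdf, hsymm, hcompl] at this
  linarith

theorem measureReal_abs_le_quantile {ε : Ω → ℝ} (hε : Measurable ε) {σ : ℝ} (hσ : 0 < σ)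
    (hlaw : μ.map ε = gaussianReal 0 (σ ^ 2).toNNReal) {α : ℝ} (h0 : 0 < α) (h1 : α < 1) :
    μ.real {ω | |ε ω| - stdNormalQuantile (1 - α / 2) * σ ≤ 0} = 1 - α := by
  have hq := (stdNormalQuantile_nonneg (u := 1 - α / 2) (by linarith) (by linarith)).2
  set z := stdNormalQuantile (1 - α / 2)
  have hmap : gaussianReal 0 (σ ^ 2).toNNReal = (gaussianReal 0 1).map (σ * ·) := by
    rw [gaussianReal_map_const_mul, mul_zero, mul_one]
    congr 1
    exact Real.toNNReal_of_nonneg (sq_nonneg σ)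
  have hset : {ω | |ε ω| - z * σ ≤ 0} = ε ⁻¹' Set.Icc (-(z * σ)) (z * σ) := by
    ext ω
    simp [abs_le]
  have hpre : (σ * ·) ⁻¹' Set.Icc (-(z * σ)) (z * σ) = Set.Icc (-z) z := by
    ext x
    simp only [Set.mem_preimage, Set.mem_Icc]
    constructor <;> rintro ⟨h2, h3⟩ <;> constructor <;> nlinarith
  rw [hset, Measure.real, ← Measure.map_apply hε measurableSet_Icc, hlaw, hmap,
    Measure.map_apply (measurable_const_mul σ) measurableSet_Icc, hpre]
  rw [Measure.real] at hq
  rw [hq]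
  ring

theorem exists_subseq_ae_tendsto_zero {W : ℕ → Ω → ℝ} (hW0 : ∀ n ω, 0 ≤ W n ω)
    (hWi : ∀ n, Integrable (W n) μ) (hW : Tendsto (fun n => ∫ ω, W n ω ∂μ) atTop (𝓝 0)) :
    ∃ ms : ℕ → ℕ, StrictMono ms ∧ ∀ᵐ ω ∂μ, Tendsto (fun k => W (ms k) ω) atTop (𝓝 0) := by
  have hmeas : TendstoInMeasure μ W atTop fun _ => (0 : ℝ) := by
    refine tendstoInMeasure_of_tendsto_eLpNorm one_ne_zero (fun n => (hWi n).1)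
      aestronglyMeasurable_const ?_
    have h := ENNReal.tendsto_ofReal hW
    rw [ENNReal.ofReal_zero] at h
    refine h.congr fun n => ?_
    rw [ofReal_integral_eq_lintegral_ofReal (hWi n) (Eventually.of_forall (hW0 n)),
      eLpNorm_one_eq_lintegral_enorm]
    refine lintegral_congr fun ω => ?_
    simp only [Pi.sub_apply, sub_zero]
    rw [Real.enorm_eq_ofReal (hW0 n ω)]
  exact hmeas.exists_seq_tendsto_ae

/-- If the centers and the variance estimators converge in mean along subsequences, then the
intervals have the asymptotic coverage probability of a Gaussian interval. -/
theorem tendsto_coverage [IsProbabilityMeasure μ] {ε : Ω → ℝ} (hε : Measurable ε) {σ : ℝ}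
    (hσ : 0 < σ) (hlaw : μ.map ε = gaussianReal 0 (σ ^ 2).toNNReal) {α : ℝ} (h0 : 0 < α)
    (h1 : α < 1) {δ v W : ℕ → Ω → ℝ} (hδ : ∀ n, Measurable (δ n)) (hv : ∀ n, Measurable (v n))
    (hW0 : ∀ n ω, 0 ≤ W n ω) (hWi : ∀ n, Integrable (W n) μ)
    (hW : Tendsto (fun n => ∫ ω, W n ω ∂μ) atTop (𝓝 0))
    (hconv : ∀ᵐ ω ∂μ, ∀ ns : ℕ → ℕ, Tendsto ns atTop atTop →
      Tendsto (fun k => W (ns k) ω) atTop (𝓝 0) →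
      Tendsto (fun k => δ (ns k) ω) atTop (𝓝 0) ∧ Tendsto (fun k => v (ns k) ω) atTop (𝓝 (σ ^ 2))) :
    Tendsto (fun n => μ.real {ω | |ε ω - δ n ω| - stdNormalQuantile (1 - α / 2) * √(v n ω) ≤ 0})
      atTop (𝓝 (1 - α)) := by
  -- Convergence of real numbers can be tested on subsequences, and `W` converges almost surely
  -- along a further subsequence of any given one. This is why `hconv` speaks of arbitrary index
  -- sequences outside one null set.
  refine tendsto_of_subseq_tendsto fun ns hns => ?_
  obtain ⟨ms, hms, hae⟩ := exists_subseq_ae_tendsto_zero (W := fun k => W (ns k))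
    (fun k => hW0 (ns k)) (fun k => hWi (ns k)) (hW.comp hns)
  refine ⟨ms, ?_⟩
  have hns' : Tendsto (fun k => ns (ms k)) atTop atTop := hns.comp hms.tendsto_atTop
  rw [← measureReal_abs_le_quantile hε hσ hlaw h0 h1]
  refine tendsto_measureReal_setOf_nonpos
    (fun n => (((hε.sub (hδ _)).abs).sub ((hv _).sqrt.const_mul _))) (hε.abs.sub_const _) ?_ ?_
  · filter_upwards [hconv, hae] with ω hω hω'
    obtain ⟨hd, hv'⟩ := hω _ hns' hω'
    have h2 := (Real.continuous_sqrt.tendsto _).comp hv'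
    rw [Real.sqrt_sq hσ.le] at h2
    have h3 := ((tendsto_const_nhds (x := ε ω)).sub hd).abs
    rw [sub_zero] at h3
    exact h3.sub (h2.const_mul _)
  -- The boundary of the limit event is `|ε| = z * σ`, at most two values of an atomless variable.
  · have hv0 : (σ ^ 2).toNNReal ≠ 0 := by
      rw [ne_eq, Real.toNNReal_eq_zero, not_le]
      positivity
    have hpt : ∀ x : ℝ, ∀ᵐ ω ∂μ, ε ω ≠ x := fun x => by
      have h2 : μ.map ε {x} = 0 := by rw [hlaw]; exact gaussianReal_singleton hv0 x
      rw [Measure.map_apply hε (measurableSet_singleton x)] at h2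
      rw [ae_iff]
      simpa [Set.preimage] using h2
    filter_upwards [hpt (stdNormalQuantile (1 - α / 2) * σ),
      hpt (-(stdNormalQuantile (1 - α / 2) * σ))] with ω h2 h3 h4
    have h5 : |ε ω| = stdNormalQuantile (1 - α / 2) * σ := by linarith
    rcases eq_or_eq_neg_of_abs_eq h5 with h6 | h6
    · exact h2 h6
    · exact h3 h6

end Coverage

/-! ### Empirical variances under perturbations that are small in quadratic mean -/

section ResidualVariance

/-- The cross term is estimated by the Cauchy–Schwarz inequality. -/
theorem sum_sq_sub_bound {n : ℕ} (e Δ : Fin n → ℝ) :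
    |1 / (n : ℝ) * ∑ i, (e i - Δ i) ^ 2 - 1 / (n : ℝ) * ∑ i, e i ^ 2| ≤
      2 * √((1 / (n : ℝ) * ∑ i, e i ^ 2) * (1 / (n : ℝ) * ∑ i, Δ i ^ 2)) +
        1 / (n : ℝ) * ∑ i, Δ i ^ 2 := by
  have hcs := Finset.sum_mul_sq_le_sq_mul_sq Finset.univ e Δ
  have hn : (0 : ℝ) ≤ 1 / (n : ℝ) := by positivity
  have hQ : 0 ≤ 1 / (n : ℝ) * ∑ i, Δ i ^ 2 :=
    mul_nonneg hn (Finset.sum_nonneg fun i _ => sq_nonneg _)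
  have hC : |1 / (n : ℝ) * ∑ i, e i * Δ i| ≤
      √((1 / (n : ℝ) * ∑ i, e i ^ 2) * (1 / (n : ℝ) * ∑ i, Δ i ^ 2)) := by
    refine Real.abs_le_sqrt ?_
    have := mul_le_mul_of_nonneg_left hcs (mul_nonneg hn hn)
    calc _ = 1 / (n : ℝ) * (1 / (n : ℝ)) * (∑ i, e i * Δ i) ^ 2 := by ring
      _ ≤ _ := this
      _ = _ := by ring
  have hexp : 1 / (n : ℝ) * ∑ i, (e i - Δ i) ^ 2 - 1 / (n : ℝ) * ∑ i, e i ^ 2 =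
      -2 * (1 / (n : ℝ) * ∑ i, e i * Δ i) + 1 / (n : ℝ) * ∑ i, Δ i ^ 2 := by
    have : ∀ i, (e i - Δ i) ^ 2 = e i ^ 2 - 2 * (e i * Δ i) + Δ i ^ 2 := fun i => by ring
    simp only [this, Finset.sum_add_distrib, Finset.sum_sub_distrib, ← Finset.mul_sum]
    ring
  rw [hexp]
  refine (abs_add_le _ _).trans ?_
  rw [abs_of_nonneg hQ, abs_mul]
  norm_num
  simpa using hC

theorem sq_mean_le_mean_sq {n : ℕ} (Δ : Fin n → ℝ) :
    (1 / (n : ℝ) * ∑ i, Δ i) ^ 2 ≤ 1 / (n : ℝ) * ∑ i, Δ i ^ 2 := by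
  rcases Nat.eq_zero_or_pos n with rfl | hn
  · simp
  · have hn0 : (0 : ℝ) < n := Nat.cast_pos.2 hn
    have := sq_sum_le_card_mul_sum_sq (s := Finset.univ) (f := Δ)
    rw [Finset.card_univ, Fintype.card_fin] at this
    rw [mul_pow, div_pow, one_pow, div_mul_eq_mul_div, div_mul_eq_mul_div, one_mul, one_mul,
      div_le_div_iff₀ (by positivity) hn0]
    nlinarith

theorem tendsto_mean_sq_sub {e : ℕ → ℝ} {Δ : (n : ℕ) → Fin n → ℝ} {s : ℝ} {ns : ℕ → ℕ}
    (hns : Tendsto ns atTop atTop)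
    (he : Tendsto (fun n : ℕ => (∑ i ∈ Finset.range n, e i ^ 2) / (n : ℝ)) atTop (𝓝 s))
    (hΔ : Tendsto (fun k => 1 / (ns k : ℝ) * ∑ i, Δ (ns k) i ^ 2) atTop (𝓝 0)) :
    Tendsto (fun k => 1 / (ns k : ℝ) * ∑ i : Fin (ns k), (e i - Δ (ns k) i) ^ 2) atTop (𝓝 s) := by
  have he' : Tendsto (fun k => 1 / (ns k : ℝ) * ∑ i : Fin (ns k), e i ^ 2) atTop (𝓝 s) := by
    refine (he.comp hns).congr fun k => ?_
    simp only [Function.comp_apply]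
    rw [← Fin.sum_univ_eq_sum_range (fun i => e i ^ 2)]
    ring
  have hb : Tendsto (fun k => 2 * √((1 / (ns k : ℝ) * ∑ i : Fin (ns k), e i ^ 2) *
      (1 / (ns k : ℝ) * ∑ i, Δ (ns k) i ^ 2)) + 1 / (ns k : ℝ) * ∑ i, Δ (ns k) i ^ 2) atTop
      (𝓝 0) := by
    have h1 := (Real.continuous_sqrt.tendsto _).comp (he'.mul hΔ)
    rw [mul_zero, Real.sqrt_zero] at h1
    have := (h1.const_mul 2).add hΔ
    simpa using this
  have hdiff := squeeze_zero_norm (fun k => by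
    rw [Real.norm_eq_abs]
    exact sum_sq_sub_bound (fun i : Fin (ns k) => e i) (Δ (ns k))) hb
  have := hdiff.add he'
  simpa using this

/-- The sample variance is `n / (n - 1)` times the mean square minus the squared mean. The mean
vanishes by the law of large numbers for `e` and by Jensen's inequality for `Δ`. -/
theorem tendsto_sample_variance_sub {e : ℕ → ℝ} {Δ : (n : ℕ) → Fin n → ℝ} {s : ℝ} {ns : ℕ → ℕ}
    (hns : Tendsto ns atTop atTop)
    (he : Tendsto (fun n : ℕ => (∑ i ∈ Finset.range n, e i ^ 2) / (n : ℝ)) atTop (𝓝 s))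
    (hm : Tendsto (fun n : ℕ => (∑ i ∈ Finset.range n, e i) / (n : ℝ)) atTop (𝓝 0))
    (hΔ : Tendsto (fun k => 1 / (ns k : ℝ) * ∑ i, Δ (ns k) i ^ 2) atTop (𝓝 0)) :
    Tendsto (fun k => 1 / ((ns k : ℝ) - 1) * ∑ i : Fin (ns k), ((e i - Δ (ns k) i) -
      1 / (ns k : ℝ) * ∑ j : Fin (ns k), (e j - Δ (ns k) j)) ^ 2) atTop (𝓝 s) := by
  have h1 := tendsto_mean_sq_sub hns he hΔ
  have hm' : Tendsto (fun k => 1 / (ns k : ℝ) * ∑ i : Fin (ns k), e i) atTop (𝓝 0) := by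
    refine (hm.comp hns).congr fun k => ?_
    simp only [Function.comp_apply]
    rw [← Fin.sum_univ_eq_sum_range e]
    ring
  have hΔm : Tendsto (fun k => 1 / (ns k : ℝ) * ∑ i : Fin (ns k), Δ (ns k) i) atTop (𝓝 0) := by
    have h2 := (Real.continuous_sqrt.tendsto _).comp hΔ
    rw [Real.sqrt_zero] at h2
    exact squeeze_zero_norm (fun k => by
      rw [Real.norm_eq_abs]
      exact Real.abs_le_sqrt (sq_mean_le_mean_sq (Δ (ns k)))) h2
  have hfac : Tendsto (fun k => (ns k : ℝ) / ((ns k : ℝ) - 1)) atTop (𝓝 1) := by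
    have h2 : Tendsto (fun n : ℕ => (1 - (n : ℝ)⁻¹)⁻¹) atTop (𝓝 1) := by
      have := ((tendsto_inv_atTop_zero.comp (tendsto_natCast_atTop_atTop (R := ℝ))).const_sub
        1).inv₀ (by norm_num)
      simpa using this
    refine ((h2.comp hns).congr' ?_)
    filter_upwards [hns.eventually_ge_atTop 2] with k hk
    have hk' : (2 : ℝ) ≤ ns k := by exact_mod_cast hk
    have h3 : (ns k : ℝ) ≠ 0 := by linarith
    have h4 : (ns k : ℝ) - 1 ≠ 0 := by linarith
    simp only [Function.comp_apply]
    field_simp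
  have hlim := hfac.mul (h1.sub ((hm'.sub hΔm).pow 2))
  rw [sub_zero, one_mul, zero_pow two_ne_zero, sub_zero] at hlim
  refine hlim.congr' ?_
  filter_upwards [hns.eventually_ge_atTop 2] with k hk
  have hk' : (2 : ℝ) ≤ ns k := by exact_mod_cast hk
  have h3 : (ns k : ℝ) ≠ 0 := by linarith
  have h4 : (ns k : ℝ) - 1 ≠ 0 := by linarith
  set r : Fin (ns k) → ℝ := fun i => e i - Δ (ns k) i with hr
  have hsum : 1 / (ns k : ℝ) * ∑ i : Fin (ns k), e i - 1 / (ns k : ℝ) * ∑ i, Δ (ns k) i =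
      1 / (ns k : ℝ) * ∑ i, r i := by
    rw [← mul_sub, ← Finset.sum_sub_distrib]
  rw [hsum]
  change (ns k : ℝ) / ((ns k : ℝ) - 1) * (1 / (ns k : ℝ) * ∑ i, r i ^ 2 -
    (1 / (ns k : ℝ) * ∑ i, r i) ^ 2) = 1 / ((ns k : ℝ) - 1) * ∑ i, (r i -
      1 / (ns k : ℝ) * ∑ j, r j) ^ 2
  have hexp : ∑ i, (r i - 1 / (ns k : ℝ) * ∑ j, r j) ^ 2 = ∑ i, r i ^ 2 -
      ns k * (1 / (ns k : ℝ) * ∑ j, r j) ^ 2 := by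
    set c := 1 / (ns k : ℝ) * ∑ j, r j with hc
    have : ∀ i, (r i - c) ^ 2 = r i ^ 2 - 2 * c * r i + c ^ 2 := fun i => by ring
    simp only [this, Finset.sum_add_distrib, Finset.sum_sub_distrib, ← Finset.mul_sum,
      Finset.sum_const, Finset.card_univ, Fintype.card_fin, nsmul_eq_mul]
    have hs : ∑ j, r j = ns k * c := by
      rw [hc]
      field_simp
    rw [hs]
    ring
  rw [hexp]
  field_simp

end ResidualVariance

/-! ### Measurability of the forest and of the variance estimators -/

section ForestMeasurability

attribute [local irreducible] Cart.predict

variable {p n a t : ℕ}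

theorem measurable_tree (tie : TieRule p a) (s : TreeSeed p n a t) :
    Measurable fun q : (Fin n → (Fin p → ℝ) × ℝ) × (Fin p → ℝ) =>
      RandomForest.tree tie s q.1 q.2 := by
  have h : Measurable fun q : (Fin n → (Fin p → ℝ) × ℝ) × (Fin p → ℝ) =>
      ((fun k => q.1 (s.draw k)), q.2) := by fun_prop
  exact (Cart.measurable_predict tie t s.feat).comp h

theorem abs_tree_le (tie : TieRule p a) (s : TreeSeed p n a t) (D : Fin n → (Fin p → ℝ) × ℝ)
    (x : Fin p → ℝ) : |RandomForest.tree tie s D x| ≤ ∑ i, |(D i).2| :=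
  Cart.abs_predict_le tie t s.feat x (Finset.sum_nonneg fun _ _ => abs_nonneg _) fun _ =>
    Finset.single_le_sum (f := fun i => |(D i).2|) (fun _ _ => abs_nonneg _) (Finset.mem_univ _)

theorem measurable_forestMean (scheme : Resampling) (mtry : ℕ) (tie : TieRule p a) (t : ℕ) :
    Measurable fun q : (Fin n → (Fin p → ℝ) × ℝ) × (Fin p → ℝ) =>
      forestMean scheme mtry tie t q.1 q.2 :=
  (Finset.measurable_fun_sum _ fun s _ => measurable_tree tie s).div_const _

theorem measurable_oobMean (scheme : Resampling) (mtry : ℕ) (tie : TieRule p a) (t : ℕ)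
    (i : Fin n) :
    Measurable fun D : Fin n → (Fin p → ℝ) × ℝ => oobMean scheme mtry tie t D i := by
  have h : Measurable fun D : Fin n → (Fin p → ℝ) × ℝ => (D, (D i).1) := by fun_prop
  exact (Finset.measurable_fun_sum _ fun s _ => (measurable_tree tie s).comp h).div_const _

theorem abs_forestMean_le (scheme : Resampling) (mtry : ℕ) (tie : TieRule p a) (t : ℕ)
    (D : Fin n → (Fin p → ℝ) × ℝ) (x : Fin p → ℝ) :
    |forestMean scheme mtry tie t D x| ≤ ∑ i, |(D i).2| :=
  abs_sum_div_card_le _ (Finset.sum_nonneg fun _ _ => abs_nonneg _) fun s => abs_tree_le tie s D x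

theorem abs_oobMean_le (scheme : Resampling) (mtry : ℕ) (tie : TieRule p a) (t : ℕ)
    (D : Fin n → (Fin p → ℝ) × ℝ) (i : Fin n) :
    |oobMean scheme mtry tie t D i| ≤ ∑ i, |(D i).2| :=
  abs_sum_div_card_le _ (Finset.sum_nonneg fun _ _ => abs_nonneg _) fun s => abs_tree_le tie s D _

variable {Ω : Type*} [MeasurableSpace Ω] {θ : ℕ → Ω → TreeSeed p n a t}
  {D : Ω → Fin n → (Fin p → ℝ) × ℝ}

theorem measurableSet_seed_eq (hθ : ∀ j, Measurable (θ j)) (j : ℕ) (s : TreeSeed p n a t) :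
    MeasurableSet {ω | θ j ω = s} :=
  hθ j (measurableSet_singleton s)

theorem measurable_finite (hθ : ∀ j, Measurable (θ j)) (hD : Measurable D) {x : Ω → Fin p → ℝ}
    (hx : Measurable x) (tie : TieRule p a) (M : ℕ) :
    Measurable fun ω => RandomForest.finite tie (fun j => θ j ω) (D ω) M (x ω) := by
  refine (Finset.measurable_fun_sum _ fun j _ => ?_).div_const _
  exact Cart.measurable_comp_of_fibers (B := θ j)
    (g := fun s ω => RandomForest.tree tie s (D ω) (x ω)) (measurableSet_seed_eq hθ j)
    fun s => (measurable_tree tie s).comp (hD.prodMk hx)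

theorem measurable_oob (hθ : ∀ j, Measurable (θ j)) (hD : Measurable D) (tie : TieRule p a)
    (M : ℕ) (i : Fin n) :
    Measurable fun ω => RandomForest.oob tie (fun j => θ j ω) (D ω) M i := by
  classical
  have hDi : Measurable fun ω => (D ω, (D ω i).1) := by fun_prop
  have h1 : Measurable fun ω => ∑ j ∈ Finset.range M,
      if ∀ k, (θ j ω).draw k ≠ i then RandomForest.tree tie (θ j ω) (D ω) (D ω i).1 else 0 := by
    refine Finset.measurable_fun_sum _ fun j _ => ?_
    refine Cart.measurable_comp_of_fibers (B := θ j) (g := fun s ω =>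
      if ∀ k, s.draw k ≠ i then RandomForest.tree tie s (D ω) (D ω i).1 else 0)
      (measurableSet_seed_eq hθ j) fun s => ?_
    by_cases hs : ∀ k, s.draw k ≠ i
    · simp only [if_pos hs]
      exact (measurable_tree tie s).comp hDi
    · simp only [if_neg hs]
      exact measurable_const
  have h2 : Measurable fun ω => ∑ j ∈ Finset.range M,
      if ∀ k, (θ j ω).draw k ≠ i then (1 : ℝ) else 0 := by
    refine Finset.measurable_fun_sum _ fun j _ => ?_
    exact Cart.measurable_comp_of_fibers (B := θ j) (g := fun s (_ : Ω) =>
      if ∀ k, s.draw k ≠ i then (1 : ℝ) else 0) (measurableSet_seed_eq hθ j)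
      fun s => measurable_const
  convert h1.div h2 using 2 with ω
  simp only [RandomForest.oob, RandomForest.oobTrees, Finset.sum_filter, Finset.sum_boole,
    Pi.div_apply]

theorem measurable_varFinite (hθ : ∀ j, Measurable (θ j)) (hD : Measurable D) (tie : TieRule p a)
    (M : ℕ) : Measurable fun ω => RandomForest.varFinite tie (fun j => θ j ω) (D ω) M := by
  refine (Finset.measurable_fun_sum _ fun i _ => ?_).const_mul _
  have h : Measurable fun ω => (D ω i).2 := by fun_prop
  exact (h.sub (measurable_oob hθ hD tie M i)).pow_const 2

theorem measurable_varCorrect (hθ : ∀ j, Measurable (θ j)) (hD : Measurable D) (tie : TieRule p a)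
    (M : ℕ) : Measurable fun ω => RandomForest.varCorrect tie (fun j => θ j ω) (D ω) M := by
  have hv := measurable_varFinite hθ hD tie M
  have hs : Measurable fun ω => ⨆ i, |RandomForest.oob tie (fun j => θ j ω) (D ω) M i| :=
    Measurable.iSup fun i => (measurable_oob hθ hD tie M i).abs
  exact (hv.sub (((hs.pow_const 2).add (hv.mul_const _)).const_mul _)).abs

theorem measurable_varWeighted (w : ℝ) (hθ : ∀ j, Measurable (θ j)) (hD : Measurable D)
    (tie : TieRule p a) (M : ℕ) :
    Measurable fun ω => RandomForest.varWeighted w tie (fun j => θ j ω) (D ω) M :=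
  ((measurable_varCorrect hθ hD tie M).const_mul _).add
    ((measurable_varFinite hθ hD tie M).const_mul _)

/-- The limit of `RandomForest.varFinite` for infinitely many trees. -/
def varMean (scheme : Resampling) (mtry : ℕ) (tie : TieRule p a) (t : ℕ)
    (D : Fin n → (Fin p → ℝ) × ℝ) : ℝ :=
  1 / (n : ℝ) * ∑ i, ((D i).2 - oobMean scheme mtry tie t D i) ^ 2

theorem measurable_varMean (scheme : Resampling) (mtry : ℕ) (tie : TieRule p a) (t : ℕ) :
    Measurable fun D : Fin n → (Fin p → ℝ) × ℝ => varMean scheme mtry tie t D := by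
  refine (Finset.measurable_fun_sum _ fun i _ => ?_).const_mul _
  have h : Measurable fun D : Fin n → (Fin p → ℝ) × ℝ => (D i).2 := by fun_prop
  exact (h.sub (measurable_oobMean scheme mtry tie t i)).pow_const 2

/-- The centered version of `varMean`. -/
def centeredVarMean (scheme : Resampling) (mtry : ℕ) (tie : TieRule p a) (t : ℕ)
    (D : Fin n → (Fin p → ℝ) × ℝ) : ℝ :=
  1 / ((n : ℝ) - 1) * ∑ i, (((D i).2 - oobMean scheme mtry tie t D i)
    - 1 / (n : ℝ) * ∑ k, ((D k).2 - oobMean scheme mtry tie t D k)) ^ 2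

theorem measurable_centeredVarMean (scheme : Resampling) (mtry : ℕ) (tie : TieRule p a) (t : ℕ) :
    Measurable fun D : Fin n → (Fin p → ℝ) × ℝ => centeredVarMean scheme mtry tie t D := by
  have h : ∀ i, Measurable fun D : Fin n → (Fin p → ℝ) × ℝ =>
      (D i).2 - oobMean scheme mtry tie t D i := fun i => by
    have h : Measurable fun D : Fin n → (Fin p → ℝ) × ℝ => (D i).2 := by fun_prop
    exact h.sub (measurable_oobMean scheme mtry tie t i)
  exact (Finset.measurable_fun_sum _ fun i _ => ((h i).sub ((Finset.measurable_fun_sum _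
    fun k _ => h k).const_mul _)).pow_const 2).const_mul _

variable {scheme : Resampling} {mtry : ℕ} {θ' : ℕ → TreeSeed p n a t}

theorem IsGenericFor.varInfinite_eq (hθ : IsGenericFor (seedFinset scheme p n a t mtry) θ')
    (hmtry : mtry ≤ p) (han : a ≤ n) (hmiss : 0 < missProb scheme n a) (tie : TieRule p a)
    (D : Fin n → (Fin p → ℝ) × ℝ) :
    RandomForest.varInfinite tie θ' D = centeredVarMean scheme mtry tie t D := by
  simp only [RandomForest.varInfinite, RandomForest.residInfinite, centeredVarMean,
    hθ.oobInfinite_eq hmtry han hmiss]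

theorem IsGenericFor.tendsto_varFinite (hθ : IsGenericFor (seedFinset scheme p n a t mtry) θ')
    (hmtry : mtry ≤ p) (han : a ≤ n) (hmiss : 0 < missProb scheme n a) (tie : TieRule p a)
    (D : Fin n → (Fin p → ℝ) × ℝ) :
    Tendsto (fun M => RandomForest.varFinite tie θ' D M) atTop
      (𝓝 (varMean scheme mtry tie t D)) :=
  (tendsto_finsetSum _ fun i _ =>
    ((hθ.tendsto_oob hmtry han hmiss tie D i).const_sub _).pow 2).const_mul _

theorem varMean_nonneg (scheme : Resampling) (mtry : ℕ) (tie : TieRule p a) (t : ℕ)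
    (D : Fin n → (Fin p → ℝ) × ℝ) : 0 ≤ varMean scheme mtry tie t D :=
  mul_nonneg (by positivity) (Finset.sum_nonneg fun i _ => sq_nonneg _)

/-- For fixed `n` the bracket multiplied by `8 / M` stays bounded: the maximum is at most the sum of
the absolute out-of-bag predictions, which converges. The outer absolute value is harmless because
the limit is nonnegative. -/
theorem IsGenericFor.tendsto_varCorrect (hθ : IsGenericFor (seedFinset scheme p n a t mtry) θ')
    (hmtry : mtry ≤ p) (han : a ≤ n) (hmiss : 0 < missProb scheme n a) (tie : TieRule p a)
    (D : Fin n → (Fin p → ℝ) × ℝ) :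
    Tendsto (fun M => RandomForest.varCorrect tie θ' D M) atTop
      (𝓝 (varMean scheme mtry tie t D)) := by
  have hv := hθ.tendsto_varFinite hmtry han hmiss tie D
  have h8 : Tendsto (fun M : ℕ => 8 / (M : ℝ)) atTop (𝓝 0) := tendsto_const_div_atTop_nhds_zero_nat 8
  have hsum : Tendsto (fun M => ∑ i, |RandomForest.oob tie θ' D M i|) atTop
      (𝓝 (∑ i, |oobMean scheme mtry tie t D i|)) :=
    tendsto_finsetSum _ fun i _ => (hθ.tendsto_oob hmtry han hmiss tie D i).abs
  have hsup : Tendsto (fun M : ℕ => 8 / (M : ℝ) * (⨆ i, |RandomForest.oob tie θ' D M i|) ^ 2) atTop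
      (𝓝 0) := by
    have h1 := h8.mul (hsum.pow 2)
    rw [zero_mul] at h1
    refine squeeze_zero (fun M => by positivity) (fun M => ?_) h1
    refine mul_le_mul_of_nonneg_left (pow_le_pow_left₀ (Real.iSup_nonneg fun i => abs_nonneg _)
      ?_ 2) (by positivity)
    exact Real.iSup_le (fun i => Finset.single_le_sum
      (f := fun i => |RandomForest.oob tie θ' D M i|) (fun i _ => abs_nonneg _)
      (Finset.mem_univ i)) (Finset.sum_nonneg fun i _ => abs_nonneg _)
  have hrest := h8.mul (hv.mul_const (1 + 4 * Real.log n))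
  rw [zero_mul] at hrest
  have h := (hv.sub (hsup.add hrest)).abs
  rw [add_zero, sub_zero, abs_of_nonneg (varMean_nonneg _ _ _ _ _)] at h
  refine h.congr fun M => ?_
  rw [RandomForest.varCorrect, mul_add (8 / (M : ℝ))]

theorem IsGenericFor.tendsto_varWeighted (hθ : IsGenericFor (seedFinset scheme p n a t mtry) θ')
    (hmtry : mtry ≤ p) (han : a ≤ n) (hmiss : 0 < missProb scheme n a) (tie : TieRule p a)
    (D : Fin n → (Fin p → ℝ) × ℝ) (w : ℝ) :
    Tendsto (fun M => RandomForest.varWeighted w tie θ' D M) atTop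
      (𝓝 (varMean scheme mtry tie t D)) := by
  have h := ((hθ.tendsto_varCorrect hmtry han hmiss tie D).const_mul w).add
    ((hθ.tendsto_varFinite hmtry han hmiss tie D).const_mul (1 - w))
  have e : w * varMean scheme mtry tie t D + (1 - w) * varMean scheme mtry tie t D =
      varMean scheme mtry tie t D := by ring
  rwa [e] at h

end ForestMeasurability

/-! ### Coverage of the prediction intervals -/

section Model

theorem mem_normalInterval_iff {α c v y : ℝ} :
    y ∈ normalInterval α c v ↔ |y - c| - stdNormalQuantile (1 - α / 2) * √v ≤ 0 := by
  rw [normalInterval, Set.mem_Icc, sub_nonpos, abs_le]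
  constructor <;> rintro ⟨h1, h2⟩ <;> constructor <;> linarith

variable {Ω : Type*} [MeasurableSpace Ω] {μ : Measure Ω} {p : ℕ} {m : (Fin p → ℝ) → ℝ} {σ : ℝ}
  {X : ℕ → Ω → Fin p → ℝ} {ε Y : ℕ → Ω → ℝ}

theorem RegressionModel.measurable_Y (h : RegressionModel μ m σ X ε Y) (i : ℕ) :
    Measurable (Y i) := by
  rw [show Y i = fun ω => m (X i ω) + ε i ω from funext (h.response i)]
  exact (h.measurable_m.comp (h.measurable_X i)).add (h.measurable_ε i)

theorem RegressionModel.measurable_dataSet (h : RegressionModel μ m σ X ε Y) (n : ℕ) :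
    Measurable (dataSet X Y n) :=
  measurable_pi_lambda _ fun i => (h.measurable_X (i + 1)).prodMk (h.measurable_Y (i + 1))

theorem RegressionModel.measurable_sequence (h : RegressionModel μ m σ X ε Y) :
    Measurable fun ω i => (X i ω, Y i ω) :=
  measurable_pi_lambda _ fun i => (h.measurable_X i).prodMk (h.measurable_Y i)

theorem RegressionModel.isContractable [IsProbabilityMeasure μ]
    (h : RegressionModel μ m σ X ε Y) : IsContractable (μ.map fun ω i => (X i ω, Y i ω)) := by
  have hG : Measurable fun q : (Fin p → ℝ) × ℝ => (q.1, m q.1 + q.2) :=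
    measurable_fst.prodMk ((h.measurable_m.comp measurable_fst).add measurable_snd)
  have := IsContractable.of_iid h.measurable_X h.measurable_ε h.indep_X h.indep_ε
    h.identDistrib_X h.identDistrib_ε h.indep_X_ε hG
  simpa only [← h.response] using this

theorem RegressionModel.identDistrib_m (h : RegressionModel μ m σ X ε Y) (i : ℕ) :
    IdentDistrib (fun ω => m (X i ω)) (fun ω => m (X 0 ω)) μ μ :=
  (h.identDistrib_X i).comp h.measurable_m

theorem RegressionModel.memLp_m (h : RegressionModel μ m σ X ε Y)
    (hmL : MemLp (fun ω => m (X 0 ω)) 2 μ) (i : ℕ) : MemLp (fun ω => m (X i ω)) 2 μ :=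
  (h.identDistrib_m i).memLp_iff.2 hmL

theorem RegressionModel.memLp_Y (h : RegressionModel μ m σ X ε Y)
    (hmL : MemLp (fun ω => m (X 0 ω)) 2 μ) (i : ℕ) : MemLp (Y i) 2 μ := by
  rw [show Y i = fun ω => m (X i ω) + ε i ω from funext (h.response i)]
  exact (h.memLp_m hmL i).add ((h.identDistrib_ε i).memLp_iff.2 h.memLp_ε)

theorem RegressionModel.ae_tendsto_errors [IsProbabilityMeasure μ]
    (h : RegressionModel μ m σ X ε Y) :
    ∀ᵐ ω ∂μ, Tendsto (fun n : ℕ => (∑ i ∈ Finset.range n, ε (i + 1) ω ^ 2) / (n : ℝ)) atTop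
        (𝓝 (σ ^ 2)) ∧
      Tendsto (fun n : ℕ => (∑ i ∈ Finset.range n, ε (i + 1) ω) / (n : ℝ)) atTop (𝓝 0) := by
  have hpair : Pairwise (Function.onFun (fun f g => IndepFun f g μ) fun i => ε (i + 1)) :=
    fun i j hij => h.indep_ε.indepFun (by omega)
  have hid : ∀ i, IdentDistrib (ε (i + 1)) (ε (0 + 1)) μ μ := fun i =>
    (h.identDistrib_ε _).trans (h.identDistrib_ε _).symm
  have hL : MemLp (ε (0 + 1)) 2 μ := (h.identDistrib_ε _).memLp_iff.2 h.memLp_ε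
  have hsq : Measurable fun x : ℝ => x ^ 2 := measurable_id.pow_const 2
  have h1 := strong_law_ae_real (μ := μ) (fun i => ε (i + 1)) (hL.integrable one_le_two) hpair hid
  have h2 := strong_law_ae_real (μ := μ) (fun i ω => ε (i + 1) ω ^ 2) hL.integrable_sq
    (fun i j hij => (hpair hij).comp hsq hsq) (fun i => (hid i).comp hsq)
  have e1 : μ[ε (0 + 1)] = 0 := ((h.identDistrib_ε _).integral_eq).trans h.mean_ε
  have e2 : μ[fun ω => ε (0 + 1) ω ^ 2] = σ ^ 2 := by
    refine ((h.identDistrib_ε (0 + 1)).comp hsq).integral_eq.trans ?_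
    rw [← h.variance_ε, variance_of_integral_eq_zero (h.measurable_ε 0).aemeasurable h.mean_ε]
    rfl
  rw [e1] at h1
  rw [e2] at h2
  filter_upwards [h1, h2] with ω hω1 hω2
  exact ⟨hω2, hω1⟩

/-- The second variable determines the data set and the unseen input, hence all that the limiting
interval uses besides `ε 0`. -/
theorem RegressionModel.indepFun_error_zero [IsProbabilityMeasure μ]
    (h : RegressionModel μ m σ X ε Y) (n : ℕ) :
    IndepFun (ε 0) (fun ω => ((fun i : Fin n => ε (i + 1) ω), fun i => X i ω)) μ := by
  have hεn : Measurable fun ω => fun i : Fin n => ε (i + 1) ω :=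
    measurable_pi_lambda _ fun i => h.measurable_ε _
  have hX : Measurable fun ω => fun i => X i ω := measurable_pi_lambda _ h.measurable_X
  refine indepFun_prodMk_of_indepFun (h.measurable_ε 0) hεn hX ?_ ?_
  · have hfin := h.indep_ε.indepFun_finset {0} (Finset.Icc 1 n) (by simp) h.measurable_ε
    have hφ : Measurable fun x : ({0} : Finset ℕ) → ℝ => x ⟨0, Finset.mem_singleton_self 0⟩ :=
      measurable_pi_apply _
    have hψ : Measurable fun (x : Finset.Icc 1 n → ℝ) (i : Fin n) =>
        x ⟨(i : ℕ) + 1, Finset.mem_Icc.2 ⟨by omega, i.2⟩⟩ :=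
      measurable_pi_lambda _ fun i => measurable_pi_apply _
    exact hfin.comp hφ hψ
  · have hφ : Measurable fun x : ℕ → ℝ => (x 0, fun i : Fin n => x ((i : ℕ) + 1)) :=
      (measurable_pi_apply 0).prodMk (measurable_pi_lambda _ fun i => measurable_pi_apply _)
    exact h.indep_X_ε.symm.comp hφ measurable_id

/-- The prediction error of the forest with infinitely many trees. -/
def forestError (m : (Fin p → ℝ) → ℝ) (X : ℕ → Ω → Fin p → ℝ) (Y : ℕ → Ω → ℝ) (scheme : Resampling)
    (mtry : ℕ) {n a : ℕ} (tie : TieRule p a) (t : ℕ) (ω : Ω) : ℝ :=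
  forestMean scheme mtry tie t (dataSet X Y n ω) (X 0 ω) - m (X 0 ω)

/-- The out-of-bag errors of the forest with infinitely many trees. -/
def oobError (m : (Fin p → ℝ) → ℝ) (X : ℕ → Ω → Fin p → ℝ) (Y : ℕ → Ω → ℝ) (scheme : Resampling)
    (mtry : ℕ) {n a : ℕ} (tie : TieRule p a) (t : ℕ) (i : Fin n) (ω : Ω) : ℝ :=
  oobMean scheme mtry tie t (dataSet X Y n ω) i - m (X (i + 1) ω)

theorem RegressionModel.memLp_sum_abs_Y (h : RegressionModel μ m σ X ε Y)
    (hmL : MemLp (fun ω => m (X 0 ω)) 2 μ) (n : ℕ) :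
    MemLp (fun ω => ∑ i : Fin n, |(dataSet X Y n ω i).2|) 2 μ :=
  memLp_finsetSum _ fun i _ => (h.memLp_Y hmL (i + 1)).abs

variable (scheme : Resampling) (mtry : ℕ)

theorem RegressionModel.measurable_forestError (h : RegressionModel μ m σ X ε Y) {n a : ℕ}
    (tie : TieRule p a) (t : ℕ) :
    Measurable (forestError (n := n) m X Y scheme mtry tie t) :=
  ((measurable_forestMean scheme mtry tie t).comp
    ((h.measurable_dataSet n).prodMk (h.measurable_X 0))).sub
    (h.measurable_m.comp (h.measurable_X 0))

theorem RegressionModel.measurable_oobError (h : RegressionModel μ m σ X ε Y) {n a : ℕ}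
    (tie : TieRule p a) (t : ℕ) (i : Fin n) :
    Measurable (oobError m X Y scheme mtry tie t i) :=
  ((measurable_oobMean scheme mtry tie t i).comp (h.measurable_dataSet n)).sub
    (h.measurable_m.comp (h.measurable_X _))

theorem RegressionModel.memLp_forestError (h : RegressionModel μ m σ X ε Y)
    (hmL : MemLp (fun ω => m (X 0 ω)) 2 μ) {n a : ℕ} (tie : TieRule p a) (t : ℕ) :
    MemLp (forestError (n := n) m X Y scheme mtry tie t) 2 μ :=
  memLp_two_of_abs_le ((h.memLp_sum_abs_Y hmL n).add hmL.abs)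
    (h.measurable_forestError scheme mtry tie t).aestronglyMeasurable fun _ =>
    (abs_sub _ _).trans (add_le_add (abs_forestMean_le _ _ _ _ _ _) le_rfl)

theorem RegressionModel.memLp_oobError (h : RegressionModel μ m σ X ε Y)
    (hmL : MemLp (fun ω => m (X 0 ω)) 2 μ) {n a : ℕ} (tie : TieRule p a) (t : ℕ) (i : Fin n) :
    MemLp (oobError m X Y scheme mtry tie t i) 2 μ :=
  memLp_two_of_abs_le ((h.memLp_sum_abs_Y hmL n).add (h.memLp_m hmL (i + 1)).abs)
    (h.measurable_oobError scheme mtry tie t i).aestronglyMeasurable fun _ =>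
    (abs_sub _ _).trans (add_le_add (abs_oobMean_le _ _ _ _ _ _) le_rfl)

theorem RegressionModel.residual_eq (h : RegressionModel μ m σ X ε Y) {n a : ℕ}
    (tie : TieRule p a) (t : ℕ) (i : Fin n) (ω : Ω) :
    (dataSet X Y n ω i).2 - oobMean scheme mtry tie t (dataSet X Y n ω) i =
      ε (i + 1) ω - oobError m X Y scheme mtry tie t i ω := by
  have e : (dataSet X Y n ω i).2 = m (X (i + 1) ω) + ε (i + 1) ω := h.response _ ω
  rw [e, oobError]
  ring

/-- `IsContractable.tendsto_oobMean_error`, transported from the law on sequence space to `Ω`. -/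
theorem RegressionModel.tendsto_oobError [IsProbabilityMeasure μ]
    (h : RegressionModel μ m σ X ε Y) (hmL : MemLp (fun ω => m (X 0 ω)) 2 μ)
    (hmtry : mtry ≤ p) {a t : ℕ → ℕ} (han : ∀ n, a n ≤ n)
    {c : ℝ} (hc : 0 < c) (hmiss : ∀ᶠ n : ℕ in atTop, c ≤ missProb scheme n (a n))
    (tie : (n : ℕ) → TieRule p (a n))
    (hcons : Tendsto (fun n : ℕ => ∫ ω, forestError (n := n) m X Y scheme mtry (tie n) (t n) ω ^ 2 ∂μ)
      atTop (𝓝 0)) :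
    Tendsto (fun n : ℕ => 1 / (n : ℝ) * ∑ i : Fin n,
      ∫ ω, oobError m X Y scheme mtry (tie n) (t n) i ω ^ 2 ∂μ) atTop (𝓝 0) := by
  have hζ := h.measurable_sequence
  have hprob : IsProbabilityMeasure (μ.map fun ω i => (X i ω, Y i ω)) :=
    Measure.isProbabilityMeasure_map hζ.aemeasurable
  have hz0 : Measurable fun z : ℕ → (Fin p → ℝ) × ℝ => m (z 0).1 :=
    h.measurable_m.comp (by fun_prop)
  have hz1 : Measurable fun z : ℕ → (Fin p → ℝ) × ℝ => (z 0).2 := by fun_prop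
  have hDm : ∀ n : ℕ, Measurable fun (z : ℕ → (Fin p → ℝ) × ℝ) (i : Fin n) => z (i + 1) :=
    fun n => measurable_pi_lambda _ fun i => measurable_pi_apply _
  have hX0 : Measurable fun z : ℕ → (Fin p → ℝ) × ℝ => (z 0).1 := by fun_prop
  have key := h.isContractable.tendsto_oobMean_error h.measurable_m
    ((memLp_map_measure_iff hz0.aestronglyMeasurable hζ.aemeasurable).2 hmL)
    ((memLp_map_measure_iff hz1.aestronglyMeasurable hζ.aemeasurable).2 (h.memLp_Y hmL 0))
    scheme hmtry han hc hmiss tie (t := t) ?_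
  · refine key.congr fun n => ?_
    congr 1
    refine Finset.sum_congr rfl fun i _ => ?_
    have hm' : Measurable fun z : ℕ → (Fin p → ℝ) × ℝ => m (z (i + 1)).1 :=
      h.measurable_m.comp (by fun_prop)
    have hmeas : Measurable fun z : ℕ → (Fin p → ℝ) × ℝ => (oobMean scheme mtry (tie n) (t n)
        (fun i : Fin n => z (i + 1)) i - m (z (i + 1)).1) ^ 2 :=
      (((measurable_oobMean scheme mtry (tie n) (t n) i).comp (hDm n)).sub hm').pow_const 2
    rw [integral_map hζ.aemeasurable hmeas.aestronglyMeasurable]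
    rfl
  · refine hcons.congr fun n => ?_
    have hmeas : Measurable fun z : ℕ → (Fin p → ℝ) × ℝ => (forestMean scheme mtry (tie n) (t n)
        (fun i : Fin n => z (i + 1)) (z 0).1 - m (z 0).1) ^ 2 :=
      (((measurable_forestMean scheme mtry (tie n) (t n)).comp ((hDm n).prodMk hX0)).sub
        hz0).pow_const 2
    rw [integral_map hζ.aemeasurable hmeas.aestronglyMeasurable]
    rfl

/-- Asymptotic coverage of the intervals around the predictions with infinitely many trees. -/
theorem RegressionModel.tendsto_coverage_varMean [IsProbabilityMeasure μ]
    (h : RegressionModel μ m σ X ε Y) (hmL : MemLp (fun ω => m (X 0 ω)) 2 μ)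
    (hlaw : μ.map (ε 0) = gaussianReal 0 (σ ^ 2).toNNReal)
    (hmtry : mtry ≤ p) {a t : ℕ → ℕ} (han : ∀ n, a n ≤ n)
    {c : ℝ} (hc : 0 < c) (hmiss : ∀ᶠ n : ℕ in atTop, c ≤ missProb scheme n (a n))
    (tie : (n : ℕ) → TieRule p (a n))
    (hcons : Tendsto (fun n : ℕ => ∫ ω, forestError (n := n) m X Y scheme mtry (tie n) (t n) ω ^ 2 ∂μ)
      atTop (𝓝 0)) {α : ℝ} (h0 : 0 < α) (h1 : α < 1) :
    Tendsto (fun n : ℕ => μ.real {ω | |ε 0 ω - forestError (n := n) m X Y scheme mtry (tie n) (t n) ω| -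
      stdNormalQuantile (1 - α / 2) *
        √(varMean scheme mtry (tie n) (t n) (dataSet X Y n ω)) ≤ 0}) atTop (𝓝 (1 - α)) ∧
    Tendsto (fun n : ℕ => μ.real {ω | |ε 0 ω - forestError (n := n) m X Y scheme mtry (tie n) (t n) ω| -
      stdNormalQuantile (1 - α / 2) *
        √(centeredVarMean scheme mtry (tie n) (t n) (dataSet X Y n ω)) ≤ 0}) atTop (𝓝 (1 - α)) := by
  set δ : ℕ → Ω → ℝ := fun n => forestError (n := n) m X Y scheme mtry (tie n) (t n) with hδ
  set Δ : Ω → (n : ℕ) → Fin n → ℝ := fun ω n i =>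
    oobError m X Y scheme mtry (tie n) (t n) i ω with hΔ
  -- Adding the two squared errors lets one subsequence serve both the center and the variance
  -- estimator.
  set W : ℕ → Ω → ℝ := fun n ω => δ n ω ^ 2 + 1 / (n : ℝ) * ∑ i, Δ ω n i ^ 2 with hWdef
  have hQ0 : ∀ (n : ℕ) ω, 0 ≤ 1 / (n : ℝ) * ∑ i, Δ ω n i ^ 2 := fun n ω =>
    mul_nonneg (by positivity) (Finset.sum_nonneg fun i _ => sq_nonneg _)
  have hW0 : ∀ n ω, 0 ≤ W n ω := fun n ω => add_nonneg (sq_nonneg _) (hQ0 n ω)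
  have hδi : ∀ n, Integrable (fun ω => δ n ω ^ 2) μ := fun n =>
    (h.memLp_forestError scheme mtry hmL (tie n) (t n)).integrable_sq
  have hΔi : ∀ n i, Integrable (fun ω => Δ ω n i ^ 2) μ := fun n i =>
    (h.memLp_oobError scheme mtry hmL (tie n) (t n) i).integrable_sq
  have hQi : ∀ n : ℕ, Integrable (fun ω => 1 / (n : ℝ) * ∑ i, Δ ω n i ^ 2) μ := fun n =>
    (integrable_finsetSum _ fun i _ => hΔi n i).const_mul _
  have hWi : ∀ n, Integrable (W n) μ := fun n => (hδi n).add (hQi n)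
  have hW : Tendsto (fun n => ∫ ω, W n ω ∂μ) atTop (𝓝 0) := by
    have := hcons.add (h.tendsto_oobError scheme mtry hmL hmtry han hc hmiss tie hcons)
    rw [add_zero] at this
    refine this.congr fun n => ?_
    simp only [hWdef]
    rw [integral_add (hδi n) (hQi n), integral_const_mul, integral_finsetSum _ fun i _ => hΔi n i]
  have hsplit : ∀ ω (ns : ℕ → ℕ), Tendsto (fun k => W (ns k) ω) atTop (𝓝 0) →
      Tendsto (fun k => δ (ns k) ω) atTop (𝓝 0) ∧
      Tendsto (fun k => 1 / (ns k : ℝ) * ∑ i, Δ ω (ns k) i ^ 2) atTop (𝓝 0) := by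
    intro ω ns hlim
    refine ⟨?_, squeeze_zero (fun k => hQ0 _ ω) (fun k => le_add_of_nonneg_left (sq_nonneg _)) hlim⟩
    have h2 : Tendsto (fun k => δ (ns k) ω ^ 2) atTop (𝓝 0) :=
      squeeze_zero (fun k => sq_nonneg _) (fun k => le_add_of_nonneg_right (hQ0 _ ω)) hlim
    have h3 := (Real.continuous_sqrt.tendsto _).comp h2
    rw [Real.sqrt_zero] at h3
    exact squeeze_zero_norm (fun k => (Real.sqrt_sq_eq_abs (δ (ns k) ω)).symm.le) h3
  constructor
  · refine tendsto_coverage (h.measurable_ε 0) h.σ_pos hlaw h0 h1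
      (fun n => h.measurable_forestError scheme mtry (tie n) (t n))
      (fun n => (measurable_varMean scheme mtry (tie n) (t n)).comp (h.measurable_dataSet n))
      hW0 hWi hW ?_
    filter_upwards [h.ae_tendsto_errors] with ω hω ns hns hlim
    refine ⟨(hsplit ω ns hlim).1, ?_⟩
    have := tendsto_mean_sq_sub (e := fun i => ε (i + 1) ω) (Δ := Δ ω) hns hω.1 (hsplit ω ns hlim).2
    refine this.congr fun k => ?_
    simp only [varMean, h.residual_eq scheme mtry, hΔ]
  · refine tendsto_coverage (h.measurable_ε 0) h.σ_pos hlaw h0 h1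
      (fun n => h.measurable_forestError scheme mtry (tie n) (t n))
      (fun n => (measurable_centeredVarMean scheme mtry (tie n) (t n)).comp
        (h.measurable_dataSet n)) hW0 hWi hW ?_
    filter_upwards [h.ae_tendsto_errors] with ω hω ns hns hlim
    refine ⟨(hsplit ω ns hlim).1, ?_⟩
    have := tendsto_sample_variance_sub (e := fun i => ε (i + 1) ω) (Δ := Δ ω) hns hω.1 hω.2
      (hsplit ω ns hlim).2
    refine this.congr fun k => ?_
    simp only [centeredVarMean, h.residual_eq scheme mtry, hΔ]

/-- On the boundary `ε 0` equals the forest error plus or minus `r √v`. Both are functions of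
variables independent of `ε 0`, which has no atoms. -/
theorem RegressionModel.ae_boundary_ne [IsProbabilityMeasure μ]
    (h : RegressionModel μ m σ X ε Y)
    (hlaw : μ.map (ε 0) = gaussianReal 0 (σ ^ 2).toNNReal) {n a : ℕ} (tie : TieRule p a) (t : ℕ)
    (r : ℝ) :
    ∀ᵐ ω ∂μ, |ε 0 ω - forestError (n := n) m X Y scheme mtry tie t ω| -
      r * √(varMean scheme mtry tie t (dataSet X Y n ω)) ≠ 0 := by
  have hv0 : (σ ^ 2).toNNReal ≠ 0 := by
    have := h.σ_pos
    rw [ne_eq, Real.toNNReal_eq_zero, not_le]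
    positivity
  have hatom : ∀ x, μ.map (ε 0) {x} = 0 := fun x => by
    rw [hlaw]
    exact gaussianReal_singleton hv0 x
  set G : Ω → (Fin n → ℝ) × (ℕ → Fin p → ℝ) := fun ω =>
    ((fun i : Fin n => ε (i + 1) ω), fun i => X i ω) with hG
  have hGm : Measurable G := (measurable_pi_lambda _ fun i => h.measurable_ε _).prodMk
    (measurable_pi_lambda _ h.measurable_X)
  let D : (Fin n → ℝ) × (ℕ → Fin p → ℝ) → Fin n → (Fin p → ℝ) × ℝ := fun q i =>
    (q.2 (i + 1), m (q.2 (i + 1)) + q.1 i)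
  have hX : ∀ i, Measurable fun q : (Fin n → ℝ) × (ℕ → Fin p → ℝ) => q.2 i := fun i => by fun_prop
  have he : ∀ i, Measurable fun q : (Fin n → ℝ) × (ℕ → Fin p → ℝ) => q.1 i := fun i => by fun_prop
  have hD : Measurable D := measurable_pi_lambda _ fun i =>
    (hX _).prodMk ((h.measurable_m.comp (hX _)).add (he i))
  have hDG : ∀ ω, D (G ω) = dataSet X Y n ω := fun ω => by
    funext i
    simp only [D, hG, dataSet, h.response]
  have h1 : Measurable fun q => forestMean scheme mtry tie t (D q) (q.2 0) - m (q.2 0) :=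
    ((measurable_forestMean scheme mtry tie t).comp (hD.prodMk (hX 0))).sub
      (h.measurable_m.comp (hX 0))
  have h2 : Measurable fun q => r * √(varMean scheme mtry tie t (D q)) :=
    ((measurable_varMean scheme mtry tie t).comp hD).sqrt.const_mul r
  have hind := h.indepFun_error_zero n
  have hp := measure_eq_comp_of_indepFun (h.measurable_ε 0) hGm hind hatom (h1.add h2)
  have hm := measure_eq_comp_of_indepFun (h.measurable_ε 0) hGm hind hatom (h1.sub h2)
  filter_upwards [hp, hm] with ω hωp hωm heq
  simp only [Pi.add_apply, Pi.sub_apply, hDG] at hωp hωm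
  rcases eq_or_eq_neg_of_abs_eq (sub_eq_zero.1 heq) with h3 | h3
  · refine hωp ?_
    simp only [forestError] at h3
    linarith
  · refine hωm ?_
    simp only [forestError] at h3
    linarith

/-- The law of `X 0` is carried by its support, so the bound on the cube holds almost surely. -/
theorem RegressionModel.memLp_of_bounded [IsProbabilityMeasure μ]
    (h : RegressionModel μ m σ X ε Y) (hsupp : (μ.map (X 0)).support = Set.Icc 0 1)
    {K : ℝ} (hK : ∀ x ∈ Set.Icc (0 : Fin p → ℝ) 1, |m x| ≤ K) :
    MemLp (fun ω => m (X 0 ω)) 2 μ := by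
  have hae : ∀ᵐ x ∂μ.map (X 0), x ∈ Set.Icc (0 : Fin p → ℝ) 1 := by
    rw [← hsupp]
    exact Measure.support_mem_ae
  have hae' := ae_of_ae_map (h.measurable_X 0).aemeasurable hae
  refine MemLp.of_bound (h.measurable_m.comp (h.measurable_X 0)).aestronglyMeasurable K ?_
  filter_upwards [hae'] with ω hω
  exact hK _ hω

variable {scheme mtry}

/-- Here `n` is fixed and only the number of trees grows. The limit depends on `v` only through
`varMean`, so all three estimators share it. -/
theorem RegressionModel.tendsto_finite_coverage [IsProbabilityMeasure μ]
    (h : RegressionModel μ m σ X ε Y)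
    (hlaw : μ.map (ε 0) = gaussianReal 0 (σ ^ 2).toNNReal) {n a t : ℕ} {tie : TieRule p a}
    {θ : ℕ → Ω → TreeSeed p n a t} (hθ : ∀ j, Measurable (θ j))
    (hgen : ∀ᵐ ω ∂μ, IsGenericFor (seedFinset scheme p n a t mtry) fun j => θ j ω)
    {v : ℕ → Ω → ℝ} (hv : ∀ M, Measurable (v M))
    (hlim : ∀ᵐ ω ∂μ, Tendsto (fun M => v M ω) atTop
      (𝓝 (varMean scheme mtry tie t (dataSet X Y n ω)))) (α : ℝ) :
    Tendsto (fun M => μ.real {ω | Y 0 ω ∈ normalInterval α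
        (RandomForest.finite tie (fun j => θ j ω) (dataSet X Y n ω) M (X 0 ω)) (v M ω)}) atTop
      (𝓝 (μ.real {ω | |ε 0 ω - forestError (n := n) m X Y scheme mtry tie t ω| -
        stdNormalQuantile (1 - α / 2) * √(varMean scheme mtry tie t (dataSet X Y n ω)) ≤ 0})) := by
  simp only [mem_normalInterval_iff]
  refine tendsto_measureReal_setOf_nonpos (fun M => (((h.measurable_Y 0).sub (measurable_finite hθ
    (h.measurable_dataSet n) (h.measurable_X 0) tie M)).abs.sub ((hv M).sqrt.const_mul _)))
    ((((h.measurable_ε 0).sub (h.measurable_forestError scheme mtry tie t)).abs.sub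
      (((measurable_varMean scheme mtry tie t).comp (h.measurable_dataSet n)).sqrt.const_mul _)))
    ?_ (h.ae_boundary_ne scheme mtry hlaw tie t _)
  filter_upwards [hgen, hlim] with ω hω hvω
  have h1 := (hω.tendsto_finite tie (dataSet X Y n ω) (X 0 ω)).const_sub (Y 0 ω)
  have e : Y 0 ω - forestMean scheme mtry tie t (dataSet X Y n ω) (X 0 ω) =
      ε 0 ω - forestError (n := n) m X Y scheme mtry tie t ω := by
    rw [forestError, h.response]
    ring
  rw [e] at h1
  exact h1.abs.sub (((Real.continuous_sqrt.tendsto _).comp hvω).const_mul _)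

theorem tendsto_integral_sq_of_tendsto_lintegral {f : ℕ → Ω → ℝ} (hf : ∀ n, Measurable (f n))
    (h : Tendsto (fun n => ∫⁻ ω, ENNReal.ofReal (f n ω ^ 2) ∂μ) atTop (𝓝 0)) :
    Tendsto (fun n => ∫ ω, f n ω ^ 2 ∂μ) atTop (𝓝 0) := by
  have h1 := (ENNReal.tendsto_toReal ENNReal.zero_ne_top).comp h
  refine h1.congr fun n => ?_
  exact (integral_eq_lintegral_of_nonneg_ae (Eventually.of_forall fun ω => sq_nonneg _)
    ((hf n).pow_const 2).aestronglyMeasurable).symm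

end Model

end

/-! ### Asymptotic validity of the intervals -/

theorem mainTheorem3 {Ω : Type*} [MeasurableSpace Ω] (μ : Measure Ω) [IsProbabilityMeasure μ]
    {p : ℕ} (m : (Fin p → ℝ) → ℝ) (σ : ℝ)
    (X : ℕ → Ω → Fin p → ℝ) (ε Y : ℕ → Ω → ℝ)
    (hmodel : RegressionModel μ m σ X ε Y)
    -- tuning parameters, tie-breaking rule and randomness of the forest
    (scheme : Resampling) (mtry : ℕ) (hmtry : 1 ≤ mtry ∧ mtry ≤ p)
    (a t : ℕ → ℕ) (ha : ∀ n, 1 ≤ n → 1 ≤ a n) (han : ∀ n, a n ≤ n) (ht : ∀ n, 1 ≤ t n)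
    (hscheme : scheme = Resampling.withoutReplacement →
      ∃ c : ℝ, c < 1 ∧ ∀ᶠ n : ℕ in atTop, (a n : ℝ) ≤ c * n)
    (tie : (n : ℕ) → TieRule p (a n))
    (Θ : (n : ℕ) → ℕ → Ω → TreeSeed p n (a n) (t n))
    (hΘ : ForestRandomness μ scheme mtry a t X ε Θ)
    -- the features have support `[0,1]^p`
    (hA1 : (μ.map (X 0)).support = Set.Icc 0 1)
    -- the errors are centered Gaussian
    (hA3 : μ.map (ε 0) = gaussianReal 0 (σ ^ 2).toNNReal)
    -- the infinite forest is consistent in mean square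
    (hA4 : Tendsto (fun n => ∫⁻ ω, ENNReal.ofReal
      ((RandomForest.infinite (tie n) (fun j => Θ n j ω) (dataSet X Y n ω) (X 0 ω)
        - m (X 0 ω)) ^ 2) ∂μ) atTop (𝓝 0))
    (α : ℝ) (hα : 0 < α ∧ α < 1) :
    (MemLp (fun ω => m (X 0 ω)) 2 μ →
      AsympTypeI μ α (Y 0) fun n ω => normalInterval α
        (RandomForest.infinite (tie n) (fun j => Θ n j ω) (dataSet X Y n ω) (X 0 ω))
        (RandomForest.varInfinite (tie n) (fun j => Θ n j ω) (dataSet X Y n ω))) ∧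
    ((∃ K : ℝ, ∀ x ∈ Set.Icc (0 : Fin p → ℝ) 1, |m x| ≤ K) →
      SeqAsympTypeI μ α (Y 0) (fun n M ω => normalInterval α
        (RandomForest.finite (tie n) (fun j => Θ n j ω) (dataSet X Y n ω) M (X 0 ω))
        (RandomForest.varFinite (tie n) (fun j => Θ n j ω) (dataSet X Y n ω) M)) ∧
      SeqAsympTypeI μ α (Y 0) (fun n M ω => normalInterval α
        (RandomForest.finite (tie n) (fun j => Θ n j ω) (dataSet X Y n ω) M (X 0 ω))
        (RandomForest.varCorrect (tie n) (fun j => Θ n j ω) (dataSet X Y n ω) M)) ∧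
      ∀ w : ℝ, 0 < w → w < 1 →
        SeqAsympTypeI μ α (Y 0) (fun n M ω => normalInterval α
          (RandomForest.finite (tie n) (fun j => Θ n j ω) (dataSet X Y n ω) M (X 0 ω))
          (RandomForest.varWeighted w (tie n) (fun j => Θ n j ω) (dataSet X Y n ω) M))) := by
  obtain ⟨c, hc, hmiss⟩ := exists_missProb_ge scheme han hscheme
  have hgen : ∀ n, ∀ᵐ ω ∂μ, IsGenericFor (seedFinset scheme p n (a n) (t n) mtry)
      fun j => Θ n j ω := fun n =>
    ae_isGenericFor (hΘ.measurable n) (hΘ.indep n) fun j => by rw [hΘ.law n j, coe_seedFinset]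
  have hcons : Tendsto (fun n : ℕ => ∫ ω,
      forestError (n := n) m X Y scheme mtry (tie n) (t n) ω ^ 2 ∂μ) atTop (𝓝 0) := by
    refine tendsto_integral_sq_of_tendsto_lintegral
      (fun n => hmodel.measurable_forestError scheme mtry (tie n) (t n)) (hA4.congr fun n => ?_)
    -- The `limUnder` that defines the infinite forest agrees almost surely with the measurable
    -- average `forestMean`.
    refine lintegral_congr_ae ?_
    filter_upwards [hgen n] with ω hω
    rw [hω.infinite_eq, forestError]
  constructor
  · intro hmL
    refine ⟨1 - α, le_rfl, (hmodel.tendsto_coverage_varMean scheme mtry hmL hA3 hmtry.2 han hc hmiss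
      tie hcons hα.1 hα.2).2.congr' ?_⟩
    -- For large `n` the missing probability is positive, which the limit of the out-of-bag
    -- predictions requires.
    filter_upwards [hmiss] with n hn
    refine measureReal_congr ?_
    filter_upwards [hgen n] with ω hω
    refine propext (Iff.trans ?_ mem_normalInterval_iff.symm)
    rw [hω.infinite_eq, hω.varInfinite_eq hmtry.2 (han n) (hc.trans_le hn), hmodel.response,
      show m (X 0 ω) + ε 0 ω - forestMean scheme mtry (tie n) (t n) (dataSet X Y n ω) (X 0 ω) =
        ε 0 ω - forestError (n := n) m X Y scheme mtry (tie n) (t n) ω by rw [forestError]; ring]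
    rfl
  · rintro ⟨K, hK⟩
    have hmL := hmodel.memLp_of_bounded hA1 hK
    have hL := (hmodel.tendsto_coverage_varMean scheme mtry hmL hA3 hmtry.2 han hc hmiss
      tie hcons hα.1 hα.2).1
    have hD := hmodel.measurable_dataSet
    -- In all three cases the inner limit `ℓ n` is the coverage with the infinite forest and
    -- `varMean`, as dictated by `hL`.
    refine ⟨⟨_, 1 - α, le_rfl, ?_, hL⟩, ⟨_, 1 - α, le_rfl, ?_, hL⟩,
      fun w _ _ => ⟨_, 1 - α, le_rfl, ?_, hL⟩⟩
    · filter_upwards [hmiss] with n hn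
      refine hmodel.tendsto_finite_coverage hA3 (hΘ.measurable n) (hgen n)
        (fun M => measurable_varFinite (hΘ.measurable n) (hD n) (tie n) M) ?_ α
      filter_upwards [hgen n] with ω hω
      exact hω.tendsto_varFinite hmtry.2 (han n) (hc.trans_le hn) (tie n) _
    · filter_upwards [hmiss] with n hn
      refine hmodel.tendsto_finite_coverage hA3 (hΘ.measurable n) (hgen n)
        (fun M => measurable_varCorrect (hΘ.measurable n) (hD n) (tie n) M) ?_ α
      filter_upwards [hgen n] with ω hω
      exact hω.tendsto_varCorrect hmtry.2 (han n) (hc.trans_le hn) (tie n) _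
    · filter_upwards [hmiss] with n hn
      refine hmodel.tendsto_finite_coverage hA3 (hΘ.measurable n) (hgen n)
        (fun M => measurable_varWeighted w (hΘ.measurable n) (hD n) (tie n) M) ?_ α
      filter_upwards [hgen n] with ω hω
      exact hω.tendsto_varWeighted hmtry.2 (han n) (hc.trans_le hn) (tie n) _ w
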